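/- **Setting.** A C\*-probability space is a unital C\*-algebra $\mathcal A$ with a state $\varphi$. A self-adjoint $a\in\mathcal A$ has law $\mu$ if $\varphi(a^n)=\int x^n\,d\mu$ for all $n\ge 0$ (all moments of $\mu$ being finite). Elements $a,b$ are free if $\varphi(x_1\cdots x_r)=0$ whenever $r\ge 2$, $\varphi(x_i)=0$ for all $i$, and $x_1,\dots,x_r$ lie alternately in the unital subalgebras generated by $a$ and by $b$. If $a,b$ are free and self-adjoint with laws $\mu,\nu$, then $\mu\boxplus\nu$ is the law of $a+b$. For arbitrary probability measures on $\mathbb R$, $\boxplus$ denotes the extension by continuity for weak convergence. Let $\mathcal Q_3$ be the set of probability measures $\mu$ on $\mathbb R$ with $\int|x|^3d\mu<\infty$, $\int x\,d\mu=0$ and $\int x^2d\mu=1$. For $\mu\in\mathcal Q_3$ let $T\mu$ be the image of $\mu\boxplus\mu$ under $x\mapsto x/\sqrt2$. Let $G_\mu(z)=\int\frac{d\mu(t)}{z-t}$ for $z\in\mathbb C\setminus\mathbb R$, and let $R_\mu$ be the analytic function on the two open discs with centres $\pm i/4$ and radius $1/4$ such that $R_\mu(z)+1/z\notin\mathbb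 R$, $G_\mu(R_\mu(z)+1/z)=z$, and $zR_\mu(z)\to0$ as $z\to0$. Let $$d(\nu,\mu)=\sup_{0<y\le 1/4}\frac{|R_\mu(iy)-R_\nu(iy)|}{y^2},\qquad d\rho(x)=\frac1{2\pi}\sqrt{(4-x^2)_+}\,dx .$$ **Theorem.** (1) For every $\mu\in\mathcal Q_3$ the function $R_\mu$ exists and is unique, and $d$ is a finite metric on $\mathcal Q_3$. (2) For every $\mu\in\mathcal Q_3$ the measure $\mu\boxplus\mu$ is well defined and $T\mu\in\mathcal Q_3$. If $a,a'$ are free self-adjoint elements of a C\*-probability space, both with law $\mu$, then $T\mu$ is the law of $(a+a')/\sqrt2$. (3) $T$ is a contraction on $(\mathcal Q_3,d)$ with constant $2^{-1/2}$: $d(T\mu,T\nu)\le 2^{-1/2}d(\mu,\nu)$ for all $\mu,\nu\in\mathcal Q_3$. (4) The semicircle law $\rho$ belongs to $\mathcal Q_3$, $T\rho=\rho$, and $d(T^n\nu,\rho)\le 2^{-n/2}d(\nu,\rho)$ for all $\nu\in\mathcal Q_3$ and $n\ge 0$. -/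

import Mathlib

open MeasureTheory ProbabilityTheory Filter Topology Complex Set
open scoped ENNReal ComplexOrder

namespace FreeCLT

/-! Free probability in a C*-probability space. -/

section Free

variable {A : Type*} [CStarAlgebra A]

/-- A state: a positive linear functional with `φ 1 = 1` (equivalently, positive of norm `1`). -/
structure IsState (φ : A →ₗ[ℂ] ℂ) : Prop where
  map_one : φ 1 = 1
  nonneg : ∀ x : A, 0 ≤ φ (star x * x)

/-- Free independence of a family of unital subalgebras: alternating products of centered
elements are centered. -/
def FreeSubalgebras {ι : Type*} (φ : A →ₗ[ℂ] ℂ) (S : ι → Subalgebra ℂ A) : Prop :=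
  ∀ (r : ℕ) (j : Fin r → ι) (x : Fin r → A), 2 ≤ r →
    (∀ i, φ (x i) = 0) →
    (∀ i, x i ∈ S (j i)) →
    (∀ i k : Fin r, (k : ℕ) = i + 1 → j i ≠ j k) →
    φ (List.ofFn x).prod = 0

/-- Two elements are free when the unital subalgebras that they generate are free. -/
def FreeElements (φ : A →ₗ[ℂ] ℂ) (a b : A) : Prop :=
  FreeSubalgebras φ (fun i : Fin 2 => Algebra.adjoin ℂ {![a, b] i})

/-- `a` has law `μ`: all moments of `μ` exist and they are the moments of `a`. -/
def IsLawOf (φ : A →ₗ[ℂ] ℂ) (a : A) (μ : ProbabilityMeasure ℝ) : Prop :=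
  ∀ n : ℕ, Integrable (fun x : ℝ => x ^ n) (μ : Measure ℝ) ∧
    φ (a ^ n) = ((∫ x : ℝ, x ^ n ∂(μ : Measure ℝ) : ℝ) : ℂ)

end Free

/-! Free additive convolution. -/

/-- `ρ` is the law of `a + b` for free self-adjoint elements `a`, `b` of a C*-probability space
with laws `μ` and `ν`. (Then `μ`, `ν`, `ρ` have compact support.) -/
def IsBoundedFreeConv (μ ν ρ : ProbabilityMeasure ℝ) : Prop :=
  ∃ (A : Type) (_ : CStarAlgebra A) (φ : A →ₗ[ℂ] ℂ) (a b : A),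
    IsState φ ∧ IsSelfAdjoint a ∧ IsSelfAdjoint b ∧ FreeElements φ a b ∧
    IsLawOf φ a μ ∧ IsLawOf φ b ν ∧ IsLawOf φ (a + b) ρ

/-- `ρ = μ ⊞ ν` for arbitrary probability measures on the line: the value at `(μ, ν)` of the
weakly continuous extension of the free additive convolution of compactly supported measures.
The topology on `ProbabilityMeasure ℝ` is that of weak convergence. -/
structure IsFreeConv (μ ν ρ : ProbabilityMeasure ℝ) : Prop where
  exists_approx : ∃ μs νs ρs : ℕ → ProbabilityMeasure ℝ,
    (∀ n, IsBoundedFreeConv (μs n) (νs n) (ρs n)) ∧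
    Tendsto μs atTop (𝓝 μ) ∧ Tendsto νs atTop (𝓝 ν)
  tendsto : ∀ μs νs ρs : ℕ → ProbabilityMeasure ℝ,
    (∀ n, IsBoundedFreeConv (μs n) (νs n) (ρs n)) →
    Tendsto μs atTop (𝓝 μ) → Tendsto νs atTop (𝓝 ν) → Tendsto ρs atTop (𝓝 ρ)

/-- The free additive convolution `μ ⊞ ν`. -/
noncomputable def freeConv (μ ν : ProbabilityMeasure ℝ) : ProbabilityMeasure ℝ :=
  Classical.epsilon (IsFreeConv μ ν)

/-- The renormalization map: the law of `(a + a') / √2`, where `a` has law `μ` and `a'` is a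
free copy of `a`. -/
noncomputable def renorm (μ : ProbabilityMeasure ℝ) : ProbabilityMeasure ℝ :=
  (freeConv μ μ).map (f := fun x : ℝ => x / √2) (by fun_prop)

/-! Cauchy transform, `R`-transform and the metric. -/

/-- The Cauchy transform `G_μ(z) = ∫ 1 / (z - t) dμ(t)`. -/
noncomputable def cauchyTransform (μ : ProbabilityMeasure ℝ) (z : ℂ) : ℂ :=
  ∫ t : ℝ, 1 / (z - (t : ℂ)) ∂(μ : Measure ℝ)

/-- The domain of the `R`-transform of a measure of standard deviation `σ`: the open disc with
centre `-i / (4σ)` and radius `1 / (4σ)`, and its complex conjugate. -/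
noncomputable def rDomain (σ : ℝ) : Set ℂ :=
  Metric.ball (-I / (4 * σ)) (1 / (4 * σ)) ∪ Metric.ball (I / (4 * σ)) (1 / (4 * σ))

/-- The standard deviation of `μ`. -/
noncomputable def stdDev (μ : ProbabilityMeasure ℝ) : ℝ :=
  √(Var[fun x : ℝ => x; (μ : Measure ℝ)])

/-- `R` is the `R`-transform of the measure `μ` of finite variance: the analytic solution of
`G_μ(R(z) + 1/z) = z` on the domain above. The last condition, `R(z) + 1/z ∼ 1/z` at `0`, selects
the branch at infinity of the inverse of `G_μ`; the equation alone can have other solutions. -/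
structure IsRTransform (μ : ProbabilityMeasure ℝ) (R : ℂ → ℂ) : Prop where
  analytic : AnalyticOnNhd ℂ R (rDomain (stdDev μ))
  im_ne_zero : ∀ z ∈ rDomain (stdDev μ), (R z + 1 / z).im ≠ 0
  cauchy_eq : ∀ z ∈ rDomain (stdDev μ), cauchyTransform μ (R z + 1 / z) = z
  tendsto_zero : Tendsto (fun z => z * R z) (𝓝[rDomain (stdDev μ)] 0) (𝓝 0)

/-- The `R`-transform of `μ`. -/
noncomputable def rTransform (μ : ProbabilityMeasure ℝ) : ℂ → ℂ :=
  Classical.epsilon (IsRTransform μ)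

/-- The space of centered probability measures of unit variance with finite third moment. -/
def Q3 : Set (ProbabilityMeasure ℝ) :=
  {μ | Integrable (fun x : ℝ => |x| ^ 3) (μ : Measure ℝ) ∧
    ∫ x : ℝ, x ∂(μ : Measure ℝ) = 0 ∧ ∫ x : ℝ, x ^ 2 ∂(μ : Measure ℝ) = 1}

/-- `d(ν, μ) = sup_{0 < y ≤ 1/4} |R_μ(iy) - R_ν(iy)| / y²`, as an extended real. -/
noncomputable def rDist (ν μ : ProbabilityMeasure ℝ) : ℝ≥0∞ :=
  ⨆ y ∈ Ioc (0 : ℝ) (1 / 4),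
    ENNReal.ofReal (‖rTransform μ (I * y) - rTransform ν (I * y)‖ / y ^ 2)

/-! The semicircle law. -/

/-- The semicircle density `(1 / 2π) √((4 - x²)₊)`. -/
noncomputable def semicircleDensity (x : ℝ) : ℝ :=
  1 / (2 * Real.pi) * √(max (4 - x ^ 2) 0)

theorem integral_semicircle : ∫ x in (-2 : ℝ)..2, semicircleDensity x = 1 := by
  have h1 : ∀ x : ℝ, semicircleDensity x = (1 / Real.pi) * √(1 - (x / 2) ^ 2) := by
    intro x
    have h2 : max (4 - x ^ 2) 0 = 2 ^ 2 * max (1 - (x / 2) ^ 2) 0 := by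
      rw [mul_max_of_nonneg _ _ (by norm_num)]
      congr 1 <;> ring
    have h3 : √(max (1 - (x / 2) ^ 2) 0) = √(1 - (x / 2) ^ 2) := by
      rcases le_total (1 - (x / 2) ^ 2) 0 with h | h
      · rw [max_eq_right h, Real.sqrt_eq_zero_of_nonpos h, Real.sqrt_zero]
      · rw [max_eq_left h]
    unfold semicircleDensity
    rw [h2, Real.sqrt_mul (by norm_num), Real.sqrt_sq (by norm_num), h3]
    field_simp
  simp_rw [h1]
  rw [intervalIntegral.integral_const_mul,
    intervalIntegral.integral_comp_div (fun x : ℝ => √(1 - x ^ 2)) (by norm_num : (2 : ℝ) ≠ 0)]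
  norm_num [integral_sqrt_one_sub_sq]
  field_simp

theorem isProbabilityMeasure_semicircle : IsProbabilityMeasure
    ((volume : Measure ℝ).withDensity fun x => ENNReal.ofReal (semicircleDensity x)) := by
  have hcont : Continuous semicircleDensity := by
    unfold semicircleDensity
    fun_prop
  have hnn : ∀ x, 0 ≤ semicircleDensity x := by
    intro x
    unfold semicircleDensity
    positivity
  have hsupp : ∀ x ∉ Ioc (-2 : ℝ) 2, semicircleDensity x = 0 := by
    intro x hx
    have h : 4 - x ^ 2 ≤ 0 := by
      by_contra! hc
      exact hx ⟨by nlinarith, by nlinarith⟩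
    simp [semicircleDensity, max_eq_right h]
  have hint : IntegrableOn semicircleDensity (Ioc (-2 : ℝ) 2) :=
    (hcont.integrableOn_Icc (a := -2) (b := 2)).mono_set Ioc_subset_Icc_self
  have hint' : Integrable semicircleDensity :=
    (integrableOn_iff_integrable_of_support_subset fun x hx => by
      by_contra hc
      exact hx (hsupp x hc)).1 hint
  refine ⟨?_⟩
  rw [withDensity_apply _ MeasurableSet.univ, Measure.restrict_univ,
    ← ofReal_integral_eq_lintegral_ofReal hint' (Eventually.of_forall hnn),
    ← setIntegral_eq_integral_of_forall_compl_eq_zero (s := Ioc (-2 : ℝ) 2) hsupp,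
    ← intervalIntegral.integral_of_le (by norm_num), integral_semicircle, ENNReal.ofReal_one]

/-- The semicircle law `ρ`. -/
noncomputable def semicircle : ProbabilityMeasure ℝ :=
  ⟨(volume : Measure ℝ).withDensity fun x => ENNReal.ofReal (semicircleDensity x),
    isProbabilityMeasure_semicircle⟩

end FreeCLT

open FreeCLT

namespace FreeCLT

/-! ### The Cauchy transform of a probability measure -/

/-! Everything is expressed through the self-energy `K(z) = z - 1/G(z)`: the equation `G(R(1/w) +
1/(1/w)) = 1/w` says that `z = w + R(1/w)` solves `z - K(z) = w`. For normalized centered resolvents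
`c_z` one has `(z - w) ∫ c_z c_w dμ = K(w) - K(z)` (`sub_mul_integral_centeredResolvent`). With mean
zero and variance `σ²`, Cauchy–Schwarz turns this into `|K(z)| ≤ σ²/|Im z|` and a Lipschitz constant
`σ²/(|Im z| |Im w|)`. For unit variance the equation is therefore a contraction problem on the unit
ball about `w` as soon as `|Im w| > 2`, and inversion carries that region to the two discs on which
`R` lives. Uniqueness holds because no solution can cross the height `|Im| = 1`. Addition of free
bounded variables is computed inside the C*-algebra. If `x`, `y` are the centered resolvents of `a`,
`b` at points where both Cauchy transforms equal `s`, the resolvent of `a + b` at `α + β - 1/s` is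
`s (1 + y)(1 - xy)⁻¹(1 + x)`. Freeness kills every term of its Neumann series but `1`, so its
expectation is `s` (`IsBoundedFreeConv.exists_cauchyTransform_add`). To pass to unbounded measures,
`z - K(z) = w` is also solved far out in a cone for an arbitrary probability measure, uniformly
along weakly convergent sequences. This yields tightness of the convolutions and identifies every
limit point, so limits exist and are unique (`exists_isFreeConv_of_approx`). Approximants exist for
finite variance: a measure is the law of a function on the circle, that function is an `L²` limit of
trigonometric polynomials, and these have free copies in the left regular representation of `ℤ * ℤ`.
Moments of `μ ⊞ μ` are read off from its Cauchy transform on the imaginary axis; the third absolute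
moment is comparable with an integral over `s` of `∫ t⁴/(t² + s²)`, which is at most twice that of
`μ` up to `O(s⁻²)`. Finally `R_{Tμ}(z) = √2 R_μ(z/√2)`, and the weight `y⁻²` in `d` turns this into
the factor `√2/2`. The distance is finite because a third moment gives `R(iy) = iy + O(y²)`; it
separates points because `R` on a segment determines `G`, hence the measure. The semicircle law has
`R(z) = z`, which the scaling fixes. -/

theorem abs_im_le_norm_sub_ofReal (z : ℂ) (t : ℝ) : |z.im| ≤ ‖z - (t : ℂ)‖ := by
  simpa using Complex.abs_im_le_norm (z - (t : ℂ))

theorem sub_ofReal_ne_zero {z : ℂ} (hz : z.im ≠ 0) (t : ℝ) : z - (t : ℂ) ≠ 0 := by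
  intro h
  apply hz
  simpa using congrArg Complex.im h

theorem continuous_resolvent {z : ℂ} (hz : z.im ≠ 0) : Continuous fun t : ℝ => 1 / (z - (t : ℂ)) :=
  continuous_const.div (by fun_prop) (sub_ofReal_ne_zero hz)

theorem norm_resolvent_le {z : ℂ} (hz : z.im ≠ 0) (t : ℝ) : ‖1 / (z - (t : ℂ))‖ ≤ 1 / |z.im| := by
  rw [norm_div, norm_one]
  exact one_div_le_one_div_of_le (abs_pos.2 hz) (abs_im_le_norm_sub_ofReal z t)

theorem integrable_of_continuous_of_bound {μ : Measure ℝ} [IsFiniteMeasure μ] {f : ℝ → ℂ}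
    (hf : Continuous f) (C : ℝ) (hC : ∀ t, ‖f t‖ ≤ C) : Integrable f μ :=
  Integrable.of_bound hf.aestronglyMeasurable C (Eventually.of_forall hC)

theorem integrable_resolvent (μ : Measure ℝ) [IsFiniteMeasure μ] {z : ℂ} (hz : z.im ≠ 0) :
    Integrable (fun t : ℝ => 1 / (z - (t : ℂ))) μ :=
  integrable_of_continuous_of_bound (continuous_resolvent hz) _ (norm_resolvent_le hz)

theorem norm_integral_le_of_prob (μ : ProbabilityMeasure ℝ) {f : ℝ → ℂ} {C : ℝ}
    (hC : ∀ t, ‖f t‖ ≤ C) : ‖∫ t, f t ∂(μ : Measure ℝ)‖ ≤ C := by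
  simpa using norm_integral_le_of_norm_le_const (μ := (μ : Measure ℝ)) (Eventually.of_forall hC)

/-- The resolvent identity, integrated. -/
theorem cauchyTransform_sub (μ : ProbabilityMeasure ℝ) {z w : ℂ} (hz : z.im ≠ 0) (hw : w.im ≠ 0) :
    cauchyTransform μ z - cauchyTransform μ w =
      (w - z) * ∫ t : ℝ, 1 / (z - (t : ℂ)) * (1 / (w - (t : ℂ))) ∂(μ : Measure ℝ) := by
  unfold cauchyTransform
  rw [← integral_sub (integrable_resolvent _ hz) (integrable_resolvent _ hw),
    ← integral_const_mul]
  congr 1 with t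
  have := sub_ofReal_ne_zero hz t
  have := sub_ofReal_ne_zero hw t
  field_simp
  ring

theorem norm_cauchyTransform_sub_le (μ : ProbabilityMeasure ℝ) {z w : ℂ} (hz : z.im ≠ 0)
    (hw : w.im ≠ 0) :
    ‖cauchyTransform μ z - cauchyTransform μ w‖ ≤ ‖z - w‖ / (|z.im| * |w.im|) := by
  rw [cauchyTransform_sub μ hz hw, norm_mul, norm_sub_rev, div_eq_mul_inv]
  gcongr
  refine norm_integral_le_of_prob μ fun t => ?_
  rw [norm_mul]
  refine (mul_le_mul (norm_resolvent_le hz t) (norm_resolvent_le hw t) (norm_nonneg _)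
    (by positivity)).trans_eq ?_
  field_simp

theorem cauchyTransform_conj (μ : ProbabilityMeasure ℝ) (z : ℂ) :
    cauchyTransform μ (starRingEnd ℂ z) = starRingEnd ℂ (cauchyTransform μ z) := by
  unfold cauchyTransform
  rw [← integral_conj]
  congr 1 with t
  simp

theorem im_resolvent (z : ℂ) (t : ℝ) :
    (1 / (z - (t : ℂ))).im = -z.im * (1 / ‖z - (t : ℂ)‖ ^ 2) := by
  rw [one_div, Complex.inv_im, Complex.normSq_eq_norm_sq]
  simp [div_eq_mul_inv]

theorem im_cauchyTransform (μ : ProbabilityMeasure ℝ) {z : ℂ} (hz : z.im ≠ 0) :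
    (cauchyTransform μ z).im = -z.im * ∫ t : ℝ, 1 / ‖z - (t : ℂ)‖ ^ 2 ∂(μ : Measure ℝ) := by
  unfold cauchyTransform
  rw [← integral_const_mul]
  simp_rw [← im_resolvent]
  exact (integral_im (integrable_resolvent _ hz)).symm

theorem integrable_inv_normSq (μ : Measure ℝ) [IsFiniteMeasure μ] {z : ℂ} (hz : z.im ≠ 0) :
    Integrable (fun t : ℝ => 1 / ‖z - (t : ℂ)‖ ^ 2) μ := by
  have h : ∀ t : ℝ, ‖z - (t : ℂ)‖ ^ 2 ≠ 0 := fun t => by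
    have := sub_ofReal_ne_zero hz t
    positivity
  refine Integrable.of_bound (C := 1 / |z.im| ^ 2) ?_ (Eventually.of_forall fun t => ?_)
  · exact (continuous_const.div (by fun_prop) h).aestronglyMeasurable
  · have := abs_im_le_norm_sub_ofReal z t
    have := abs_pos.2 hz
    rw [Real.norm_of_nonneg (by positivity)]
    gcongr

/-- The imaginary part is `-Im z` times the integral of a strictly positive function. -/
theorem cauchyTransform_ne_zero (μ : ProbabilityMeasure ℝ) {z : ℂ} (hz : z.im ≠ 0) :
    cauchyTransform μ z ≠ 0 := by
  intro h
  have h1 := im_cauchyTransform μ hz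
  rw [h] at h1
  have h2 : 0 < ∫ t : ℝ, 1 / ‖z - (t : ℂ)‖ ^ 2 ∂(μ : Measure ℝ) := by
    rw [integral_pos_iff_support_of_nonneg (fun t => by positivity) (integrable_inv_normSq _ hz)]
    have : Function.support (fun t : ℝ => 1 / ‖z - (t : ℂ)‖ ^ 2) = univ := by
      ext t
      have := sub_ofReal_ne_zero hz t
      simp [this]
    rw [this]
    simp
  rcases mul_eq_zero.1 h1.symm with h3 | h3
  · exact hz (neg_eq_zero.1 h3)
  · exact h2.ne' h3

theorem cauchyTransform_eq_neg_resolventTransform (μ : ProbabilityMeasure ℝ) (z : ℂ) :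
    cauchyTransform μ z = - resolventTransform (μ : Measure ℝ) z := by
  unfold cauchyTransform resolventTransform
  rw [← integral_neg]
  congr 1 with t
  simp only [resolvent, Ring.inverse_eq_inv', Complex.coe_algebraMap]
  rw [← inv_neg, one_div]
  congr 1
  ring

theorem differentiableAt_cauchyTransform (μ : ProbabilityMeasure ℝ) {z : ℂ} (hz : z.im ≠ 0) :
    DifferentiableAt ℂ (cauchyTransform μ) z := by
  have : cauchyTransform μ = fun z => - resolventTransform (μ : Measure ℝ) z :=
    funext (cauchyTransform_eq_neg_resolventTransform μ)
  rw [this]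
  refine (hasDerivAt_resolventTransform z ?_).differentiableAt.neg
  rintro ⟨t, -, ht⟩
  apply hz
  rw [← ht]
  simp

/-- The self-energy `z - 1 / G_μ(z)`: a point `z` satisfies `G_μ(z) = 1 / w` exactly when
`z = w + selfEnergy μ z`. -/
noncomputable def selfEnergy (μ : ProbabilityMeasure ℝ) (z : ℂ) : ℂ := z - 1 / cauchyTransform μ z

theorem sub_selfEnergy (μ : ProbabilityMeasure ℝ) (z : ℂ) :
    z - selfEnergy μ z = 1 / cauchyTransform μ z := by
  simp [selfEnergy]

theorem cauchyTransform_eq_of_sub_selfEnergy {μ : ProbabilityMeasure ℝ} {z w : ℂ}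
    (h : z - selfEnergy μ z = w) : cauchyTransform μ z = 1 / w := by
  rw [sub_selfEnergy] at h
  simp [← h]

theorem differentiableAt_selfEnergy (μ : ProbabilityMeasure ℝ) {z : ℂ} (hz : z.im ≠ 0) :
    DifferentiableAt ℂ (selfEnergy μ) z := by
  unfold selfEnergy
  exact differentiableAt_id.sub ((differentiableAt_const _).div
    (differentiableAt_cauchyTransform μ hz) (cauchyTransform_ne_zero μ hz))

theorem selfEnergy_conj (μ : ProbabilityMeasure ℝ) (z : ℂ) :
    selfEnergy μ (starRingEnd ℂ z) = starRingEnd ℂ (selfEnergy μ z) := by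
  simp [selfEnergy, cauchyTransform_conj]

theorem tendsto_cauchyTransform {ι : Type*} {l : Filter ι} {μs : ι → ProbabilityMeasure ℝ}
    {μ : ProbabilityMeasure ℝ} (h : Tendsto μs l (𝓝 μ)) {z : ℂ} (hz : z.im ≠ 0) :
    Tendsto (fun i => cauchyTransform (μs i) z) l (𝓝 (cauchyTransform μ z)) := by
  rw [ProbabilityMeasure.tendsto_iff_forall_integral_rclike_tendsto ℂ] at h
  exact h (BoundedContinuousFunction.ofNormedAddCommGroup _ (continuous_resolvent hz) _
    (norm_resolvent_le hz))

theorem tendsto_selfEnergy {ι : Type*} {l : Filter ι} {μs : ι → ProbabilityMeasure ℝ}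
    {μ : ProbabilityMeasure ℝ} (h : Tendsto μs l (𝓝 μ)) {z : ℂ} (hz : z.im ≠ 0) :
    Tendsto (fun i => selfEnergy (μs i) z) l (𝓝 (selfEnergy μ z)) :=
  tendsto_const_nhds.sub
    (tendsto_const_nhds.div (tendsto_cauchyTransform h hz) (cauchyTransform_ne_zero μ hz))

/-! ### The Cauchy transform determines the measure -/

theorem neg_im_cauchyTransform_upper (μ : ProbabilityMeasure ℝ) {y : ℝ} (hy : 0 < y) (x : ℝ) :
    -(cauchyTransform μ (x + y * I)).im = ∫ t : ℝ, y / ((x - t) ^ 2 + y ^ 2) ∂(μ : Measure ℝ) := by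
  rw [im_cauchyTransform μ (by simpa using hy.ne'), ← neg_mul, neg_neg, ← integral_const_mul]
  congr 1 with t
  have : ‖(x + y * I : ℂ) - (t : ℂ)‖ ^ 2 = (x - t) ^ 2 + y ^ 2 := by
    rw [← Complex.normSq_eq_norm_sq, Complex.normSq_apply]
    simp
    ring
  rw [this]
  simp [div_eq_mul_inv]

/-- The substitution `x = t + y u` moves the dependence on `y` from the Poisson kernel into the
argument of `f`, so that the limit `y → 0` becomes dominated convergence against a fixed Cauchy
density. -/
theorem integral_poisson_rescale (f : ℝ → ℝ) {y : ℝ} (hy : 0 < y) (t : ℝ) :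
    ∫ x : ℝ, f x * (y / ((x - t) ^ 2 + y ^ 2)) = ∫ u : ℝ, f (t + y * u) * (1 + u ^ 2)⁻¹ := by
  have h1 : ∫ x : ℝ, f x * (y / ((x - t) ^ 2 + y ^ 2)) =
      ∫ x : ℝ, f (t + x) * (y / (x ^ 2 + y ^ 2)) := by
    rw [← integral_add_left_eq_self _ t]
    simp
  have h2 := Measure.integral_comp_mul_left (fun x : ℝ => f (t + x) * (y / (x ^ 2 + y ^ 2))) y
  rw [h1]
  have h3 : (fun u : ℝ => f (t + y * u) * (1 + u ^ 2)⁻¹) =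
      fun u : ℝ => y * (f (t + y * u) * (y / ((y * u) ^ 2 + y ^ 2))) := by
    ext u
    field_simp
    ring
  rw [h3, integral_const_mul, h2, abs_of_pos (by positivity), smul_eq_mul, ← mul_assoc,
    mul_inv_cancel₀ hy.ne', one_mul]

theorem tendsto_integral_poisson (μ : ProbabilityMeasure ℝ) (f : BoundedContinuousFunction ℝ ℝ) :
    Tendsto (fun y : ℝ => ∫ t, ∫ u : ℝ, f (t + y * u) * (1 + u ^ 2)⁻¹ ∂volume ∂(μ : Measure ℝ))
      (𝓝 0) (𝓝 (Real.pi * ∫ t, f t ∂(μ : Measure ℝ))) := by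
  have key : ∀ (y t u : ℝ), ‖f (t + y * u) * (1 + u ^ 2)⁻¹‖ ≤ ‖f‖ * (1 + u ^ 2)⁻¹ := by
    intro y t u
    rw [norm_mul, Real.norm_of_nonneg (by positivity : 0 ≤ (1 + u ^ 2)⁻¹)]
    gcongr
    exact f.norm_coe_le_norm _
  have hint : Integrable fun u : ℝ => ‖f‖ * (1 + u ^ 2)⁻¹ := integrable_inv_one_add_sq.const_mul _
  have hinner : ∀ t : ℝ, Continuous fun y : ℝ => ∫ u : ℝ, f (t + y * u) * (1 + u ^ 2)⁻¹ := by
    intro t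
    refine continuous_of_dominated (bound := fun u : ℝ => ‖f‖ * (1 + u ^ 2)⁻¹) (fun y => ?_)
      (fun y => Eventually.of_forall (key y t)) hint (Eventually.of_forall fun u => by fun_prop)
    exact ((f.continuous.comp (by fun_prop)).mul
      (Continuous.inv₀ (by fun_prop) fun u => by positivity)).aestronglyMeasurable
  have hmeas : ∀ y : ℝ, Continuous fun t : ℝ => ∫ u : ℝ, f (t + y * u) * (1 + u ^ 2)⁻¹ := by
    intro y
    refine continuous_of_dominated (bound := fun u : ℝ => ‖f‖ * (1 + u ^ 2)⁻¹) (fun t => ?_)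
      (fun t => Eventually.of_forall (key y t)) hint (Eventually.of_forall fun u => by fun_prop)
    exact ((f.continuous.comp (by fun_prop)).mul
      (Continuous.inv₀ (by fun_prop) fun u => by positivity)).aestronglyMeasurable
  have h0 : ∀ t : ℝ, ∫ u : ℝ, f (t + 0 * u) * (1 + u ^ 2)⁻¹ = Real.pi * f t := by
    intro t
    simp only [zero_mul, add_zero]
    rw [integral_const_mul, integral_univ_inv_one_add_sq, mul_comm]
  rw [← integral_const_mul]
  refine tendsto_integral_filter_of_dominated_convergence (fun _ => ‖f‖ * Real.pi)
    (Eventually.of_forall fun y => (hmeas y).aestronglyMeasurable)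
    (Eventually.of_forall fun y => Eventually.of_forall fun t => ?_) (integrable_const _)
    (Eventually.of_forall fun t => ?_)
  · refine (norm_integral_le_of_norm_le hint (Eventually.of_forall (key y t))).trans_eq ?_
    rw [integral_const_mul, integral_univ_inv_one_add_sq]
  · rw [← h0]
    exact (hinner t).tendsto 0

theorem integral_mul_im_cauchyTransform (μ : ProbabilityMeasure ℝ)
    (f : BoundedContinuousFunction ℝ ℝ) {y : ℝ} (hy : 0 < y) :
    ∫ x : ℝ, f x * -(cauchyTransform μ (x + y * I)).im =
      ∫ t, ∫ u : ℝ, f (t + y * u) * (1 + u ^ 2)⁻¹ ∂volume ∂(μ : Measure ℝ) := by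
  simp_rw [neg_im_cauchyTransform_upper μ hy, ← integral_const_mul, ← integral_poisson_rescale f hy]
  refine integral_integral_swap ?_
  have hc : Continuous fun p : ℝ × ℝ => f p.1 * (y / ((p.1 - p.2) ^ 2 + y ^ 2)) :=
    (f.continuous.comp continuous_fst).mul (continuous_const.div (by fun_prop) fun p => by positivity)
  have hpi : ∀ t : ℝ, Integrable fun x : ℝ => y / ((x - t) ^ 2 + y ^ 2) := by
    intro t
    have h1 : Integrable fun x : ℝ => (1 + ((x - t) * y⁻¹) ^ 2)⁻¹ :=
      (integrable_inv_one_add_sq.comp_mul_right' (inv_ne_zero hy.ne')).comp_sub_right t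
    refine (h1.const_mul y⁻¹).congr (Eventually.of_forall fun x => ?_)
    simp only
    field_simp
    ring
  refine (integrable_prod_iff' hc.aestronglyMeasurable).2 ⟨Eventually.of_forall fun t => ?_, ?_⟩
  · refine ((hpi t).const_mul ‖f‖).mono'
      ((hc.comp (by fun_prop : Continuous fun x : ℝ => (x, t))).aestronglyMeasurable)
      (Eventually.of_forall fun x => ?_)
    rw [norm_mul, Real.norm_of_nonneg (by positivity : 0 ≤ y / ((x - t) ^ 2 + y ^ 2))]
    gcongr
    exact f.norm_coe_le_norm _
  · refine Integrable.of_bound (C := ‖f‖ * Real.pi)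
      (hc.norm.aestronglyMeasurable.prod_swap.integral_prod_right') (Eventually.of_forall fun t => ?_)
    rw [Real.norm_of_nonneg (integral_nonneg fun _ => norm_nonneg _)]
    have h2 := integral_poisson_rescale (fun _ => ‖f‖) hy t
    rw [integral_const_mul (μ := volume) ‖f‖ (fun u : ℝ => (1 + u ^ 2)⁻¹),
      integral_univ_inv_one_add_sq] at h2
    rw [← h2]
    refine integral_mono_of_nonneg (Eventually.of_forall fun _ => norm_nonneg _)
      ((hpi t).const_mul _) (Eventually.of_forall fun x => ?_)
    simp only
    rw [norm_mul, Real.norm_of_nonneg (by positivity : 0 ≤ y / ((x - t) ^ 2 + y ^ 2))]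
    gcongr
    exact f.norm_coe_le_norm _

/-- Stieltjes inversion in weak form: `-Im G(x + iy) dx` is the Poisson smoothing of the measure and
tends to `π μ` when tested against bounded continuous functions. -/
theorem eq_of_cauchyTransform_eq_upper {μ ν : ProbabilityMeasure ℝ}
    (h : ∀ z : ℂ, 0 < z.im → cauchyTransform μ z = cauchyTransform ν z) : μ = ν := by
  refine Subtype.ext (a1 := μ) (a2 := ν) ?_
  change (μ : Measure ℝ) = (ν : Measure ℝ)
  refine ext_of_forall_integral_eq_of_IsFiniteMeasure fun f => ?_
  have h1 : (fun y : ℝ => ∫ t, ∫ u : ℝ, f (t + y * u) * (1 + u ^ 2)⁻¹ ∂volume ∂(μ : Measure ℝ))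
      =ᶠ[𝓝[>] 0] fun y : ℝ =>
        ∫ t, ∫ u : ℝ, f (t + y * u) * (1 + u ^ 2)⁻¹ ∂volume ∂(ν : Measure ℝ) := by
    filter_upwards [self_mem_nhdsWithin] with y hy
    rw [← integral_mul_im_cauchyTransform μ f hy, ← integral_mul_im_cauchyTransform ν f hy]
    congr 1 with x
    rw [h _ (by simpa using hy)]
  have h2 := ((tendsto_integral_poisson μ f).mono_left nhdsWithin_le_nhds).congr' h1
  have h3 := tendsto_nhds_unique h2 ((tendsto_integral_poisson ν f).mono_left nhdsWithin_le_nhds)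
  exact mul_left_cancel₀ Real.pi_ne_zero h3

theorem isPreconnected_im_gt (c : ℝ) : IsPreconnected {z : ℂ | c < z.im} :=
  (convex_halfSpace_im_gt c).isPreconnected

/-- Two probability measures whose Cauchy transforms agree frequently near a point of the upper
half plane are equal. -/
theorem eq_of_frequently_cauchyTransform_eq {μ ν : ProbabilityMeasure ℝ} {z₀ : ℂ} (hz₀ : 0 < z₀.im)
    (h : ∃ᶠ z in 𝓝[≠] z₀, cauchyTransform μ z = cauchyTransform ν z) : μ = ν := by
  have ho : IsOpen {z : ℂ | 0 < z.im} := isOpen_lt continuous_const Complex.continuous_im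
  have ha : ∀ κ : ProbabilityMeasure ℝ, AnalyticOnNhd ℂ (cauchyTransform κ) {z : ℂ | 0 < z.im} :=
    fun κ => DifferentiableOn.analyticOnNhd (fun z hz =>
      (differentiableAt_cauchyTransform κ (ne_of_gt hz)).differentiableWithinAt) ho
  exact eq_of_cauchyTransform_eq_upper fun z hz =>
    (ha μ).eqOn_of_preconnected_of_frequently_eq (ha ν) (isPreconnected_im_gt 0) hz₀ h hz

end FreeCLT

namespace FreeCLT

/-! ### The self-energy of a centered measure of finite variance -/

theorem integral_norm_mul_norm_le_sqrt {μ : Measure ℝ} {f g : ℝ → ℂ} (hf : MemLp f 2 μ)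
    (hg : MemLp g 2 μ) :
    ∫ t, ‖f t‖ * ‖g t‖ ∂μ ≤ √(∫ t, ‖f t‖ ^ 2 ∂μ) * √(∫ t, ‖g t‖ ^ 2 ∂μ) := by
  have h := integral_mul_norm_le_Lp_mul_Lq (μ := μ) (f := f) (g := g) Real.HolderConjugate.two_two
    (by simpa using hf) (by simpa using hg)
  simpa [Real.sqrt_eq_rpow] using h

/-- The normalized and centered resolvent function. -/
noncomputable def centeredResolvent (μ : ProbabilityMeasure ℝ) (z : ℂ) (t : ℝ) : ℂ :=
  1 / (z - (t : ℂ)) / cauchyTransform μ z - 1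

theorem continuous_centeredResolvent (μ : ProbabilityMeasure ℝ) {z : ℂ} (hz : z.im ≠ 0) :
    Continuous (centeredResolvent μ z) :=
  ((continuous_resolvent hz).div_const _).sub continuous_const

theorem norm_centeredResolvent_le (μ : ProbabilityMeasure ℝ) {z : ℂ} (hz : z.im ≠ 0) (t : ℝ) :
    ‖centeredResolvent μ z t‖ ≤ 1 / |z.im| / ‖cauchyTransform μ z‖ + 1 := by
  refine (norm_sub_le _ _).trans ?_
  rw [norm_div _ (cauchyTransform μ z), norm_one]
  gcongr
  exact norm_resolvent_le hz t

theorem memLp_centeredResolvent (μ : ProbabilityMeasure ℝ) {z : ℂ} (hz : z.im ≠ 0) :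
    MemLp (centeredResolvent μ z) 2 (μ : Measure ℝ) :=
  MemLp.of_bound (continuous_centeredResolvent μ hz).aestronglyMeasurable _
    (Eventually.of_forall (norm_centeredResolvent_le μ hz))

/-- The resolvent identity divided by `G(z) G(w)`; centering subtracts `z - w`, which is exactly
what separates `1/G` from the self-energy. Increments of the self-energy thus become a bilinear form
in `L²`, without any moment assumption. -/
theorem sub_mul_integral_centeredResolvent (μ : ProbabilityMeasure ℝ) {z w : ℂ} (hz : z.im ≠ 0)
    (hw : w.im ≠ 0) :
    (z - w) * ∫ t, centeredResolvent μ z t * centeredResolvent μ w t ∂(μ : Measure ℝ) =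
      selfEnergy μ w - selfEnergy μ z := by
  have hGz := cauchyTransform_ne_zero μ hz
  have hGw := cauchyTransform_ne_zero μ hw
  have hi : Integrable (fun t : ℝ => 1 / (z - (t : ℂ)) * (1 / (w - (t : ℂ)))) (μ : Measure ℝ) := by
    refine integrable_of_continuous_of_bound
      ((continuous_resolvent hz).mul (continuous_resolvent hw)) (1 / |z.im| * (1 / |w.im|))
      fun t => ?_
    rw [norm_mul]
    gcongr
    exacts [norm_resolvent_le hz t, norm_resolvent_le hw t]
  have h1 : ∫ t, centeredResolvent μ z t * centeredResolvent μ w t ∂(μ : Measure ℝ) =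
      (∫ t : ℝ, 1 / (z - (t : ℂ)) * (1 / (w - (t : ℂ))) ∂(μ : Measure ℝ)) /
        (cauchyTransform μ z * cauchyTransform μ w) - 1 := by
    have : ∀ t : ℝ, centeredResolvent μ z t * centeredResolvent μ w t =
        1 / (z - (t : ℂ)) * (1 / (w - (t : ℂ))) / (cauchyTransform μ z * cauchyTransform μ w)
        - 1 / (z - (t : ℂ)) / cauchyTransform μ z - 1 / (w - (t : ℂ)) / cauchyTransform μ w + 1 := by
      intro t
      unfold centeredResolvent
      ring
    simp_rw [this]
    have a := hi.div_const (cauchyTransform μ z * cauchyTransform μ w)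
    have b := (integrable_resolvent (μ : Measure ℝ) hz).div_const (cauchyTransform μ z)
    have c := (integrable_resolvent (μ : Measure ℝ) hw).div_const (cauchyTransform μ w)
    rw [integral_add (by exact (a.sub b).sub c) (integrable_const _),
      integral_sub (by exact a.sub b) c, integral_sub a b, integral_div, integral_div, integral_div]
    change _ - cauchyTransform μ z / _ - cauchyTransform μ w / _ + _ = _
    rw [div_self hGz, div_self hGw]
    simp
  have h2 := cauchyTransform_sub μ hz hw
  have h3 : (∫ t : ℝ, 1 / (z - (t : ℂ)) * (1 / (w - (t : ℂ))) ∂(μ : Measure ℝ)) * (z - w) =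
      cauchyTransform μ w - cauchyTransform μ z := by linear_combination h2
  rw [h1, mul_sub, mul_div_assoc', mul_comm (z - w), h3]
  unfold selfEnergy
  field_simp
  ring

theorem centeredResolvent_conj (μ : ProbabilityMeasure ℝ) (z : ℂ) (t : ℝ) :
    centeredResolvent μ (starRingEnd ℂ z) t = starRingEnd ℂ (centeredResolvent μ z t) := by
  simp [centeredResolvent, cauchyTransform_conj]

/-- The case `w = conj z` of the bilinear identity, where the form becomes a squared norm. -/
theorem im_selfEnergy (μ : ProbabilityMeasure ℝ) {z : ℂ} (hz : z.im ≠ 0) :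
    (selfEnergy μ z).im = -z.im * ∫ t, ‖centeredResolvent μ z t‖ ^ 2 ∂(μ : Measure ℝ) := by
  have h := sub_mul_integral_centeredResolvent μ (z := z) (w := starRingEnd ℂ z) hz (by simpa)
  simp_rw [centeredResolvent_conj, Complex.mul_conj, Complex.normSq_eq_norm_sq] at h
  rw [integral_complex_ofReal, selfEnergy_conj, Complex.sub_conj] at h
  have h' := congrArg Complex.im h
  simp at h'
  linarith

variable {μ : ProbabilityMeasure ℝ}

theorem integrable_id_of_sq (h2 : Integrable (fun x : ℝ => x ^ 2) (μ : Measure ℝ)) :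
    Integrable (fun x : ℝ => x) (μ : Measure ℝ) :=
  (((memLp_two_iff_integrable_sq (by fun_prop)).2 h2).integrable (by norm_num))

theorem memLp_ofReal_of_sq (h2 : Integrable (fun x : ℝ => x ^ 2) (μ : Measure ℝ)) :
    MemLp (fun x : ℝ => (x : ℂ)) 2 (μ : Measure ℝ) :=
  ((memLp_two_iff_integrable_sq (by fun_prop)).2 h2).ofReal

theorem integrable_ofReal_of_sq (h2 : Integrable (fun x : ℝ => x ^ 2) (μ : Measure ℝ)) :
    Integrable (fun x : ℝ => (x : ℂ)) (μ : Measure ℝ) :=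
  (integrable_id_of_sq h2).ofReal

theorem integral_mul_resolvent (μ : ProbabilityMeasure ℝ) {z : ℂ} (hz : z.im ≠ 0) :
    ∫ t : ℝ, (t : ℂ) * (1 / (z - (t : ℂ))) ∂(μ : Measure ℝ) = z * cauchyTransform μ z - 1 := by
  have : ∀ t : ℝ, (t : ℂ) * (1 / (z - (t : ℂ))) = z * (1 / (z - (t : ℂ))) - 1 := by
    intro t
    have := sub_ofReal_ne_zero hz t
    field_simp
    ring
  simp_rw [this]
  rw [integral_sub ((integrable_resolvent _ hz).const_mul z) (integrable_const _),
    integral_const_mul]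
  simp [cauchyTransform]

theorem norm_mul_resolvent_le {z : ℂ} (hz : z.im ≠ 0) (t : ℝ) :
    ‖(t : ℂ) * (1 / (z - (t : ℂ)))‖ ≤ ‖z‖ / |z.im| + 1 := by
  have h : (t : ℂ) * (1 / (z - (t : ℂ))) = z * (1 / (z - (t : ℂ))) - 1 := by
    have := sub_ofReal_ne_zero hz t
    field_simp
    ring
  rw [h]
  refine (norm_sub_le _ _).trans ?_
  rw [norm_mul, norm_one, div_eq_mul_one_div ‖z‖]
  gcongr
  exact norm_resolvent_le hz t

theorem integrable_mul_resolvent (μ : ProbabilityMeasure ℝ) {z : ℂ} (hz : z.im ≠ 0) :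
    Integrable (fun t : ℝ => (t : ℂ) * (1 / (z - (t : ℂ)))) (μ : Measure ℝ) :=
  integrable_of_continuous_of_bound (Complex.continuous_ofReal.mul (continuous_resolvent hz)) _
    (norm_mul_resolvent_le hz)

theorem selfEnergy_eq_integral (h2 : Integrable (fun x : ℝ => x ^ 2) (μ : Measure ℝ))
    (h0 : ∫ x : ℝ, x ∂(μ : Measure ℝ) = 0) {z : ℂ} (hz : z.im ≠ 0) :
    selfEnergy μ z = ∫ t : ℝ, (t : ℂ) * centeredResolvent μ z t ∂(μ : Measure ℝ) := by
  have hG := cauchyTransform_ne_zero μ hz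
  have : ∀ t : ℝ, (t : ℂ) * centeredResolvent μ z t =
      (t : ℂ) * (1 / (z - (t : ℂ))) / cauchyTransform μ z - (t : ℂ) := by
    intro t
    unfold centeredResolvent
    ring
  simp_rw [this]
  rw [integral_sub ((integrable_mul_resolvent μ hz).div_const _) (integrable_ofReal_of_sq h2),
    integral_div, integral_mul_resolvent μ hz, integral_complex_ofReal, h0, selfEnergy]
  field_simp
  simp

/-- A self-improving estimate. With `A` the squared `L²` norm of the centered resolvent, `|Im z| A =
|Im K| ≤ |K| ≤ σ √A`, the last step by Cauchy–Schwarz since `K = ∫ t c_z dμ`; dividing by `√A`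
bounds `√A` itself. -/
theorem sqrt_integral_centeredResolvent_le (h2 : Integrable (fun x : ℝ => x ^ 2) (μ : Measure ℝ))
    (h0 : ∫ x : ℝ, x ∂(μ : Measure ℝ) = 0) {z : ℂ} (hz : z.im ≠ 0) :
    ‖selfEnergy μ z‖ ≤ √(∫ x : ℝ, x ^ 2 ∂(μ : Measure ℝ)) *
        √(∫ t, ‖centeredResolvent μ z t‖ ^ 2 ∂(μ : Measure ℝ)) ∧
      √(∫ t, ‖centeredResolvent μ z t‖ ^ 2 ∂(μ : Measure ℝ)) ≤
        √(∫ x : ℝ, x ^ 2 ∂(μ : Measure ℝ)) / |z.im| := by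
  have h1 : ‖selfEnergy μ z‖ ≤ √(∫ x : ℝ, x ^ 2 ∂(μ : Measure ℝ)) *
      √(∫ t, ‖centeredResolvent μ z t‖ ^ 2 ∂(μ : Measure ℝ)) := by
    rw [selfEnergy_eq_integral h2 h0 hz]
    refine (norm_integral_le_integral_norm _).trans ?_
    simp_rw [norm_mul]
    refine (integral_norm_mul_norm_le_sqrt (memLp_ofReal_of_sq h2)
      (memLp_centeredResolvent μ hz)).trans_eq ?_
    simp
  refine ⟨h1, ?_⟩
  set A := ∫ t, ‖centeredResolvent μ z t‖ ^ 2 ∂(μ : Measure ℝ) with hA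
  have hA0 : 0 ≤ A := integral_nonneg fun t => by positivity
  have h3 : |z.im| * A ≤ √(∫ x : ℝ, x ^ 2 ∂(μ : Measure ℝ)) * √A := by
    refine le_trans ?_ h1
    refine le_trans (le_of_eq ?_) (Complex.abs_im_le_norm _)
    rw [im_selfEnergy μ hz, abs_mul, abs_neg, abs_of_nonneg hA0]
  have hz' := abs_pos.2 hz
  rw [le_div_iff₀ hz']
  rcases (Real.sqrt_nonneg A).eq_or_lt with h | h
  · rw [← h]
    simp
  · have h4 : A = √A * √A := (Real.mul_self_sqrt hA0).symm
    rw [h4] at h3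
    refine le_of_mul_le_mul_right ?_ h
    rw [Real.sqrt_mul_self h.le] at h3
    linarith

theorem norm_selfEnergy_le (h2 : Integrable (fun x : ℝ => x ^ 2) (μ : Measure ℝ))
    (h0 : ∫ x : ℝ, x ∂(μ : Measure ℝ) = 0) {z : ℂ} (hz : z.im ≠ 0) :
    ‖selfEnergy μ z‖ ≤ (∫ x : ℝ, x ^ 2 ∂(μ : Measure ℝ)) / |z.im| := by
  obtain ⟨h1, h3⟩ := sqrt_integral_centeredResolvent_le h2 h0 hz
  refine h1.trans ((mul_le_mul_of_nonneg_left h3 (Real.sqrt_nonneg _)).trans_eq ?_)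
  rw [mul_div_assoc', Real.mul_self_sqrt (integral_nonneg fun t => by positivity)]

/-- Cauchy–Schwarz in the bilinear identity. As no path between `z` and `w` is involved, the two
points may lie in opposite half planes. -/
theorem norm_selfEnergy_sub_le (h2 : Integrable (fun x : ℝ => x ^ 2) (μ : Measure ℝ))
    (h0 : ∫ x : ℝ, x ∂(μ : Measure ℝ) = 0) {z w : ℂ} (hz : z.im ≠ 0) (hw : w.im ≠ 0) :
    ‖selfEnergy μ z - selfEnergy μ w‖ ≤
      (∫ x : ℝ, x ^ 2 ∂(μ : Measure ℝ)) / (|z.im| * |w.im|) * ‖z - w‖ := by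
  obtain ⟨-, h3⟩ := sqrt_integral_centeredResolvent_le h2 h0 hz
  obtain ⟨-, h4⟩ := sqrt_integral_centeredResolvent_le h2 h0 hw
  rw [norm_sub_rev, ← sub_mul_integral_centeredResolvent μ hz hw, norm_mul, mul_comm]
  refine mul_le_mul_of_nonneg_right ?_ (norm_nonneg _)
  refine (norm_integral_le_integral_norm _).trans ?_
  simp_rw [norm_mul]
  refine (integral_norm_mul_norm_le_sqrt (memLp_centeredResolvent μ hz)
    (memLp_centeredResolvent μ hw)).trans ?_
  refine (mul_le_mul h3 h4 (Real.sqrt_nonneg _) (by positivity)).trans_eq ?_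
  rw [div_mul_div_comm, Real.mul_self_sqrt (integral_nonneg fun t => by positivity)]

/-! ### Asymptotics along the imaginary axis -/

theorem norm_I_mul_div_sub_le {s : ℝ} (hs : 0 < s) (t : ℝ) :
    ‖I * s * (1 / (I * s - (t : ℂ)))‖ ≤ 1 := by
  have h1 : (I * (s : ℂ)).im = s := by simp
  have h2 := norm_resolvent_le (z := I * s) (by rw [h1]; exact hs.ne') t
  rw [h1, abs_of_pos hs] at h2
  rw [norm_mul, norm_mul, norm_I, one_mul, Complex.norm_real, Real.norm_of_nonneg hs.le]
  calc s * _ ≤ s * (1 / s) := by gcongr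
    _ = 1 := by field_simp

theorem tendsto_I_mul_div_sub (t : ℝ) :
    Tendsto (fun s : ℝ => I * s * (1 / (I * s - (t : ℂ)))) atTop (𝓝 1) := by
  have h1 : Tendsto (fun s : ℝ => 1 / (1 - (t : ℂ) * ((s : ℂ)⁻¹ * I⁻¹))) atTop (𝓝 1) := by
    have h2 : Tendsto (fun s : ℝ => ((s : ℂ)⁻¹)) atTop (𝓝 0) := by
      have := (Complex.continuous_ofReal.tendsto 0).comp (tendsto_inv_atTop_zero (𝕜 := ℝ))
      simpa [Function.comp_def] using this
    have h3 : Tendsto (fun s : ℝ => 1 / (1 - (t : ℂ) * ((s : ℂ)⁻¹ * I⁻¹))) atTop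
        (𝓝 (1 / (1 - (t : ℂ) * (0 * I⁻¹)))) :=
      tendsto_const_nhds.div (tendsto_const_nhds.sub (tendsto_const_nhds.mul
        (h2.mul tendsto_const_nhds))) (by simp)
    simpa using h3
  refine h1.congr' ?_
  filter_upwards [eventually_gt_atTop 0] with s hs
  have hs' : (s : ℂ) ≠ 0 := by exact_mod_cast hs.ne'
  have h4 : I * (s : ℂ) - (t : ℂ) ≠ 0 := sub_ofReal_ne_zero (by simpa using hs.ne') t
  have h5 : (1 : ℂ) - (t : ℂ) * ((s : ℂ)⁻¹ * I⁻¹) = (I * s - t) / (I * s) := by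
    field_simp
  rw [h5]
  field_simp

/-- The factor `is/(is - t)` has norm at most `1` and tends to `1`, so integrability of `f` alone
suffices. Moments are extracted by taking `f = 1`, `t`, `t²`. -/
theorem tendsto_integral_mul_resolvent {f : ℝ → ℂ} (hf : Integrable f (μ : Measure ℝ)) :
    Tendsto (fun s : ℝ => ∫ t : ℝ, f t * (I * s * (1 / (I * s - (t : ℂ)))) ∂(μ : Measure ℝ)) atTop
      (𝓝 (∫ t, f t ∂(μ : Measure ℝ))) := by
  refine tendsto_integral_filter_of_dominated_convergence (fun t => ‖f t‖) ?_ ?_ hf.norm ?_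
  · filter_upwards [eventually_gt_atTop 0] with s hs
    exact hf.aestronglyMeasurable.mul (continuous_const.mul
      (continuous_resolvent (by simpa using hs.ne'))).aestronglyMeasurable
  · filter_upwards [eventually_gt_atTop 0] with s hs
    refine Eventually.of_forall fun t => ?_
    rw [norm_mul]
    exact mul_le_of_le_one_right (norm_nonneg _) (norm_I_mul_div_sub_le hs t)
  · refine Eventually.of_forall fun t => ?_
    simpa using (tendsto_const_nhds (x := f t)).mul (tendsto_I_mul_div_sub t)

theorem tendsto_I_mul_cauchyTransform (μ : ProbabilityMeasure ℝ) :
    Tendsto (fun s : ℝ => I * s * cauchyTransform μ (I * s)) atTop (𝓝 1) := by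
  have := tendsto_integral_mul_resolvent (μ := μ) (integrable_const (1 : ℂ))
  simpa [cauchyTransform, integral_const_mul] using this

/-- The first moment read off from the Cauchy transform. -/
theorem tendsto_first_moment (h1 : Integrable (fun x : ℝ => x) (μ : Measure ℝ)) :
    Tendsto (fun s : ℝ => I * s * (I * s * cauchyTransform μ (I * s) - 1)) atTop
      (𝓝 ((∫ x : ℝ, x ∂(μ : Measure ℝ) : ℝ) : ℂ)) := by
  have := tendsto_integral_mul_resolvent (μ := μ) h1.ofReal
  rw [integral_ofReal] at this
  refine this.congr' ?_
  filter_upwards [eventually_gt_atTop 0] with s hs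
  rw [← integral_mul_resolvent μ (by simpa using hs.ne'), ← integral_const_mul]
  congr 1 with t
  simp only [Complex.coe_algebraMap]
  ring

theorem sq_mul_cauchyTransform_sub (h2 : Integrable (fun x : ℝ => x ^ 2) (μ : Measure ℝ))
    (h0 : ∫ x : ℝ, x ∂(μ : Measure ℝ) = 0) {z : ℂ} (hz : z.im ≠ 0) :
    z ^ 2 * (z * cauchyTransform μ z - 1) =
      ∫ t : ℝ, (t : ℂ) ^ 2 * (z * (1 / (z - (t : ℂ)))) ∂(μ : Measure ℝ) := by
  rw [← integral_mul_resolvent μ hz, ← integral_const_mul]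
  have h3 : ∫ t : ℝ, z * (t : ℂ) ∂(μ : Measure ℝ) = 0 := by
    rw [integral_const_mul, integral_complex_ofReal, h0]
    simp
  have h4 : Integrable (fun t : ℝ => z * (t : ℂ)) (μ : Measure ℝ) :=
    (integrable_ofReal_of_sq h2).const_mul z
  rw [← sub_zero (∫ t : ℝ, z ^ 2 * _ ∂(μ : Measure ℝ)), ← h3,
    ← integral_sub ((integrable_mul_resolvent μ hz).const_mul _) h4]
  congr 1 with t
  have := sub_ofReal_ne_zero hz t
  field_simp
  ring

/-- The variance read off from the self-energy. -/
theorem tendsto_I_mul_selfEnergy (h2 : Integrable (fun x : ℝ => x ^ 2) (μ : Measure ℝ))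
    (h0 : ∫ x : ℝ, x ∂(μ : Measure ℝ) = 0) :
    Tendsto (fun s : ℝ => I * s * selfEnergy μ (I * s)) atTop
      (𝓝 ((∫ x : ℝ, x ^ 2 ∂(μ : Measure ℝ) : ℝ) : ℂ)) := by
  have h3 := tendsto_integral_mul_resolvent (μ := μ) h2.ofReal
  rw [integral_ofReal] at h3
  have h4 := h3.div (tendsto_I_mul_cauchyTransform μ) one_ne_zero
  rw [div_one] at h4
  refine h4.congr' ?_
  filter_upwards [eventually_gt_atTop 0] with s hs
  have hz : (I * (s : ℂ)).im ≠ 0 := by simpa using hs.ne'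
  have hG := cauchyTransform_ne_zero μ hz
  have hs' : (s : ℂ) ≠ 0 := by exact_mod_cast hs.ne'
  have h5 := sq_mul_cauchyTransform_sub h2 h0 hz
  simp only [Complex.coe_algebraMap, Complex.ofReal_pow, Pi.div_apply]
  rw [← h5, selfEnergy]
  field_simp

end FreeCLT

namespace FreeCLT

/-! ### Solving `z - g z = w` by contraction -/

theorem exists_sub_eq_of_contraction {g : ℂ → ℂ} {w : ℂ} {r K : ℝ} (hr : 0 ≤ r) (hK : K < 1)
    (hg : ∀ z ∈ Metric.closedBall w r, ‖g z‖ ≤ r)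
    (hlip : ∀ z ∈ Metric.closedBall w r, ∀ z' ∈ Metric.closedBall w r,
      ‖g z - g z'‖ ≤ K * ‖z - z'‖) :
    ∃ z ∈ Metric.closedBall w r, z - g z = w := by
  have hmaps : MapsTo (fun z => w + g z) (Metric.closedBall w r) (Metric.closedBall w r) := by
    intro z hz
    simpa [mem_closedBall_iff_norm] using hg z hz
  have hcon : ContractingWith K.toNNReal (hmaps.restrict (fun z => w + g z) _ _) := by
    refine ⟨by simpa using hK, LipschitzWith.of_dist_le_mul fun x y => ?_⟩
    have h := hlip x x.2 y y.2
    rw [Subtype.dist_eq, Subtype.dist_eq, dist_eq_norm, dist_eq_norm]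
    simp only [MapsTo.val_restrict_apply, add_sub_add_left_eq_sub]
    exact h.trans (mul_le_mul_of_nonneg_right (Real.le_coe_toNNReal K) (norm_nonneg _))
  obtain ⟨z, hz, hfix, -⟩ := hcon.exists_fixedPoint' Metric.isClosed_closedBall.isComplete hmaps
    (Metric.mem_closedBall_self hr) (edist_ne_top _ _)
  refine ⟨z, hz, ?_⟩
  have : w + g z = z := hfix
  linear_combination -this

theorem eq_of_sub_eq_of_contraction {g : ℂ → ℂ} {z z' : ℂ} {K : ℝ} (hK : K < 1)
    (hlip : ‖g z - g z'‖ ≤ K * ‖z - z'‖) (h : z - g z = z' - g z') : z = z' := by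
  have h1 : g z - g z' = z - z' := by linear_combination -h
  rw [h1] at hlip
  have h2 := norm_nonneg (z - z')
  have h3 : ‖z - z'‖ = 0 := by nlinarith
  exact sub_eq_zero.1 (norm_eq_zero.1 h3)

theorem norm_sub_le_of_contraction {g : ℂ → ℂ} {z z' w w' : ℂ} {K : ℝ} (hK : K < 1)
    (hlip : ‖g z - g z'‖ ≤ K * ‖z - z'‖) (h : z - g z = w) (h' : z' - g z' = w') :
    ‖z - z'‖ ≤ ‖w - w'‖ / (1 - K) := by
  have h1 : z - z' = (w - w') + (g z - g z') := by rw [← h, ← h']; ring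
  have h2 := norm_add_le (w - w') (g z - g z')
  rw [← h1] at h2
  rw [le_div_iff₀ (by linarith)]
  linarith

/-- The Lipschitz bound makes `Z` continuous and forces `|g'| < 1`, hence `1 - g' ≠ 0`; a continuous
right inverse of a map with nonzero derivative is differentiable. -/
theorem differentiableOn_of_contraction {g Z : ℂ → ℂ} {U V : Set ℂ} {K : ℝ} (hK : K < 1)
    (hU : IsOpen U) (hV : IsOpen V) (hg : ∀ z ∈ V, DifferentiableAt ℂ g z)
    (hlip : ∀ z ∈ V, ∀ z' ∈ V, ‖g z - g z'‖ ≤ K * ‖z - z'‖)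
    (hZ : ∀ w ∈ U, Z w ∈ V) (heq : ∀ w ∈ U, Z w - g (Z w) = w) : DifferentiableOn ℂ Z U := by
  intro w hw
  have hcont : ContinuousAt Z w := by
    rw [Metric.continuousAt_iff]
    intro ε hε
    obtain ⟨δ, hδ, hball⟩ := Metric.isOpen_iff.1 hU w hw
    refine ⟨min δ (ε * (1 - K)), lt_min hδ (mul_pos hε (by linarith)), fun x hx => ?_⟩
    have hxU : x ∈ U := hball (lt_of_lt_of_le hx (min_le_left _ _))
    rw [dist_eq_norm] at hx ⊢
    refine (norm_sub_le_of_contraction hK (hlip _ (hZ x hxU) _ (hZ w hw)) (heq x hxU)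
      (heq w hw)).trans_lt ?_
    rw [div_lt_iff₀ (by linarith)]
    exact hx.trans_le (min_le_right _ _)
  have hd := (hg _ (hZ w hw)).hasDerivAt
  -- `K` is not assumed to be nonnegative, hence the maximum.
  have hK0 : ‖deriv g (Z w)‖ ≤ max K 0 := by
    refine norm_deriv_le_of_lip' (le_max_right _ _) ?_
    filter_upwards [hV.mem_nhds (hZ w hw)] with z hz
    exact (hlip z hz _ (hZ w hw)).trans
      (mul_le_mul_of_nonneg_right (le_max_left _ _) (norm_nonneg _))
  have hne : 1 - deriv g (Z w) ≠ 0 := by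
    intro h
    rw [← sub_eq_zero.1 h, norm_one] at hK0
    rcases le_max_iff.1 hK0 with h1 | h1 <;> linarith
  refine (HasDerivAt.of_local_left_inverse hcont ((hasDerivAt_id (Z w)).sub hd) hne
    ?_).differentiableAt.differentiableWithinAt
  filter_upwards [hU.mem_nhds hw] with x hx using heq x hx

/-! ### Self-energies far out in a cone -/

/-- A quantity measuring how far `μ` is from the point mass at `0` at scale `b`. -/
noncomputable def tailFunctional (μ : ProbabilityMeasure ℝ) (b : ℝ) : ℝ :=
  ∫ t : ℝ, |t| / √(t ^ 2 + b ^ 2) ∂(μ : Measure ℝ)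

theorem abs_div_sqrt_le_one (t b : ℝ) : |t| / √(t ^ 2 + b ^ 2) ≤ 1 := by
  refine div_le_one_of_le₀ (Real.abs_le_sqrt ?_) (Real.sqrt_nonneg _)
  nlinarith [sq_nonneg b]

theorem continuous_abs_div_sqrt {b : ℝ} (hb : 0 < b) :
    Continuous fun t : ℝ => |t| / √(t ^ 2 + b ^ 2) :=
  continuous_abs.div (by fun_prop) fun t => (Real.sqrt_pos.2 (by positivity)).ne'

theorem integrable_abs_div_sqrt (μ : ProbabilityMeasure ℝ) {b : ℝ} (hb : 0 < b) :
    Integrable (fun t : ℝ => |t| / √(t ^ 2 + b ^ 2)) (μ : Measure ℝ) :=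
  Integrable.of_bound (continuous_abs_div_sqrt hb).aestronglyMeasurable 1
    (Eventually.of_forall fun t => by
      rw [Real.norm_of_nonneg (by positivity)]
      exact abs_div_sqrt_le_one t b)

theorem tailFunctional_nonneg (μ : ProbabilityMeasure ℝ) (b : ℝ) : 0 ≤ tailFunctional μ b :=
  integral_nonneg fun t => by positivity

theorem tendsto_tailFunctional {ι : Type*} {l : Filter ι} {μs : ι → ProbabilityMeasure ℝ}
    {μ : ProbabilityMeasure ℝ} (h : Tendsto μs l (𝓝 μ)) {b : ℝ} (hb : 0 < b) :
    Tendsto (fun i => tailFunctional (μs i) b) l (𝓝 (tailFunctional μ b)) := by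
  rw [ProbabilityMeasure.tendsto_iff_forall_integral_tendsto] at h
  refine h (BoundedContinuousFunction.ofNormedAddCommGroup _ (continuous_abs_div_sqrt hb) 1
    fun t => ?_)
  rw [Real.norm_of_nonneg (by positivity)]
  exact abs_div_sqrt_le_one t b

theorem tendsto_tailFunctional_atTop (μ : ProbabilityMeasure ℝ) :
    Tendsto (tailFunctional μ) atTop (𝓝 0) := by
  have h0 : (0 : ℝ) = ∫ _ : ℝ, (0 : ℝ) ∂(μ : Measure ℝ) := by simp
  rw [h0]
  refine tendsto_integral_filter_of_dominated_convergence (fun _ => 1) ?_ ?_ (integrable_const _) ?_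
  · filter_upwards [eventually_gt_atTop 0] with b hb
    exact (continuous_abs_div_sqrt hb).aestronglyMeasurable
  · refine Eventually.of_forall fun b => Eventually.of_forall fun t => ?_
    rw [Real.norm_of_nonneg (by positivity)]
    exact abs_div_sqrt_le_one t b
  · refine Eventually.of_forall fun t => ?_
    refine Tendsto.div_atTop tendsto_const_nhds ?_
    refine tendsto_atTop_mono' _ ?_ tendsto_id
    filter_upwards with b
    exact (le_abs_self b).trans (Real.abs_le_sqrt (by nlinarith [sq_nonneg t]))

/-- With `z = x + iy`, `t² ≤ 2(x - t)² + 2x² ≤ 2(x - t)² + 8y²` in the cone, and `b² ≤ y²`; hence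
`t² + b² ≤ 9 |z - t|²`. -/
theorem norm_mul_resolvent_le_of_cone {b : ℝ} (hb : 0 < b) {z : ℂ} (h1 : |z.re| ≤ 2 * z.im)
    (h2 : b ≤ z.im) (t : ℝ) :
    ‖(t : ℂ) * (1 / (z - (t : ℂ)))‖ ≤ 3 * (|t| / √(t ^ 2 + b ^ 2)) := by
  have hz : z.im ≠ 0 := by linarith
  have hpos : 0 < ‖z - (t : ℂ)‖ := norm_pos_iff.2 (sub_ofReal_ne_zero hz t)
  have hsq : √(t ^ 2 + b ^ 2) ≤ 3 * ‖z - (t : ℂ)‖ := by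
    rw [Real.sqrt_le_left (by positivity), mul_pow, ← Complex.normSq_eq_norm_sq,
      Complex.normSq_apply]
    simp only [Complex.sub_re, Complex.ofReal_re, Complex.sub_im, Complex.ofReal_im, sub_zero]
    have h3 : z.re ^ 2 ≤ (2 * z.im) ^ 2 := sq_le_sq' (abs_le.1 h1).1 (abs_le.1 h1).2
    nlinarith [sq_nonneg (t - 2 * z.re), sq_nonneg (z.re - t)]
  have hs : 0 < √(t ^ 2 + b ^ 2) := Real.sqrt_pos.2 (by positivity)
  rw [norm_mul, norm_div, norm_one, Complex.norm_real, Real.norm_eq_abs, mul_div_assoc', mul_one,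
    mul_div_assoc', div_le_div_iff₀ hpos hs]
  nlinarith [abs_nonneg t]

section Cone

variable {μ : ProbabilityMeasure ℝ} {b : ℝ} {z : ℂ}

theorem integral_norm_mul_resolvent_le (hb : 0 < b) (h1 : |z.re| ≤ 2 * z.im) (h2 : b ≤ z.im) :
    ∫ t : ℝ, ‖(t : ℂ) * (1 / (z - (t : ℂ)))‖ ∂(μ : Measure ℝ) ≤ 3 * tailFunctional μ b := by
  have hz : z.im ≠ 0 := by linarith
  unfold tailFunctional
  rw [← integral_const_mul]
  exact integral_mono (integrable_mul_resolvent μ hz).norm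
    ((integrable_abs_div_sqrt μ hb).const_mul 3) (norm_mul_resolvent_le_of_cone hb h1 h2)

theorem norm_mul_cauchyTransform_sub_one_le (hb : 0 < b) (h1 : |z.re| ≤ 2 * z.im)
    (h2 : b ≤ z.im) : ‖z * cauchyTransform μ z - 1‖ ≤ 3 * tailFunctional μ b := by
  have hz : z.im ≠ 0 := by linarith
  rw [← integral_mul_resolvent μ hz]
  exact (norm_integral_le_integral_norm _).trans (integral_norm_mul_resolvent_le hb h1 h2)

/-- The threshold `1/300` makes `|z G(z) - 1| ≤ 3/300 = 1/100`. -/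
theorem le_norm_mul_cauchyTransform (hb : 0 < b) (h1 : |z.re| ≤ 2 * z.im)
    (h2 : b ≤ z.im) (hT : tailFunctional μ b ≤ 1 / 300) :
    99 / 100 ≤ ‖z * cauchyTransform μ z‖ := by
  have h3 := norm_mul_cauchyTransform_sub_one_le (μ := μ) hb h1 h2
  have h4 := norm_sub_norm_le (1 : ℂ) (z * cauchyTransform μ z)
  rw [norm_one, norm_sub_rev] at h4
  linarith

theorem norm_selfEnergy_le_of_cone (hb : 0 < b) (h1 : |z.re| ≤ 2 * z.im) (h2 : b ≤ z.im)
    (hT : tailFunctional μ b ≤ 1 / 300) : ‖selfEnergy μ z‖ ≤ 4 * tailFunctional μ b * ‖z‖ := by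
  have hz : z.im ≠ 0 := by linarith
  have hG := cauchyTransform_ne_zero μ hz
  have hz0 : z ≠ 0 := fun h => hz (by simp [h])
  have h3 := norm_mul_cauchyTransform_sub_one_le (μ := μ) hb h1 h2
  have h4 := le_norm_mul_cauchyTransform hb h1 h2 hT
  have h5 : selfEnergy μ z = z * ((z * cauchyTransform μ z - 1) / (z * cauchyTransform μ z)) := by
    unfold selfEnergy
    field_simp
  rw [h5, norm_mul, norm_div, mul_comm]
  refine mul_le_mul_of_nonneg_right ?_ (norm_nonneg _)
  rw [div_le_iff₀ (by linarith)]
  nlinarith [tailFunctional_nonneg μ b]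

theorem centeredResolvent_eq_of_cone (hb : 0 < b) (h2 : b ≤ z.im) (t : ℝ) :
    centeredResolvent μ z t = ((t : ℂ) * (1 / (z - (t : ℂ))) - (z * cauchyTransform μ z - 1)) /
      (z * cauchyTransform μ z) := by
  have hz : z.im ≠ 0 := by linarith
  have hG := cauchyTransform_ne_zero μ hz
  have hz0 : z ≠ 0 := fun h => hz (by simp [h])
  have := sub_ofReal_ne_zero hz t
  unfold centeredResolvent
  field_simp
  ring

theorem norm_centeredResolvent_le_of_cone (hb : 0 < b) (h1 : |z.re| ≤ 2 * z.im) (h2 : b ≤ z.im)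
    (hT : tailFunctional μ b ≤ 1 / 300) (t : ℝ) : ‖centeredResolvent μ z t‖ ≤ 4 := by
  have h3 := norm_mul_cauchyTransform_sub_one_le (μ := μ) hb h1 h2
  have h4 := le_norm_mul_cauchyTransform hb h1 h2 hT
  have h5 := norm_mul_resolvent_le_of_cone hb h1 h2 t
  have h6 := abs_div_sqrt_le_one t b
  rw [centeredResolvent_eq_of_cone hb h2, norm_div, div_le_iff₀ (by linarith)]
  refine (norm_sub_le _ _).trans ?_
  linarith

/-- Both `t/(z - t)` in `L¹` and its mean are at most `1/100`, and the denominator is at least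
`99/100`: the total is `2/99`. -/
theorem integral_norm_centeredResolvent_le_of_cone (hb : 0 < b) (h1 : |z.re| ≤ 2 * z.im)
    (h2 : b ≤ z.im) (hT : tailFunctional μ b ≤ 1 / 300) :
    ∫ t, ‖centeredResolvent μ z t‖ ∂(μ : Measure ℝ) ≤ 1 / 40 := by
  have hz : z.im ≠ 0 := by linarith
  have h3 := norm_mul_cauchyTransform_sub_one_le (μ := μ) hb h1 h2
  have h4 := le_norm_mul_cauchyTransform hb h1 h2 hT
  have h5 := integral_norm_mul_resolvent_le (μ := μ) hb h1 h2
  have h6 : ∀ t : ℝ, ‖centeredResolvent μ z t‖ ≤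
      (‖(t : ℂ) * (1 / (z - (t : ℂ)))‖ + 1 / 100) * (100 / 99) := by
    intro t
    rw [centeredResolvent_eq_of_cone hb h2, norm_div, div_le_iff₀ (by linarith)]
    refine (norm_sub_le _ _).trans ?_
    nlinarith [norm_nonneg ((t : ℂ) * (1 / (z - (t : ℂ))))]
  have hi := (integrable_mul_resolvent μ hz).norm
  have hi' : Integrable (fun t : ℝ => ‖(t : ℂ) * (1 / (z - (t : ℂ)))‖ + 1 / 100)
    (μ : Measure ℝ) := hi.add (integrable_const _)
  refine (integral_mono ((memLp_centeredResolvent μ hz).integrable (by norm_num)).norm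
    (hi'.mul_const _) h6).trans ?_
  rw [integral_mul_const, integral_add hi (integrable_const _)]
  simp only [integral_const, probReal_univ, one_smul]
  linarith

/-- Without a variance, Cauchy–Schwarz in the bilinear identity is replaced by the pairing of `L∞`
(bound `4`) with `L¹` (bound `1/40`). -/
theorem norm_selfEnergy_sub_le_of_cone (hb : 0 < b) (h1 : |z.re| ≤ 2 * z.im) (h2 : b ≤ z.im)
    {z' : ℂ} (h1' : |z'.re| ≤ 2 * z'.im) (h2' : b ≤ z'.im) (hT : tailFunctional μ b ≤ 1 / 300) :
    ‖selfEnergy μ z - selfEnergy μ z'‖ ≤ 1 / 2 * ‖z - z'‖ := by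
  have hz : z.im ≠ 0 := by linarith
  have hz' : z'.im ≠ 0 := by linarith
  rw [norm_sub_rev, ← sub_mul_integral_centeredResolvent μ hz hz', norm_mul, mul_comm]
  refine mul_le_mul_of_nonneg_right ?_ (norm_nonneg _)
  have h3 : ∀ t : ℝ, ‖centeredResolvent μ z t * centeredResolvent μ z' t‖ ≤
      4 * ‖centeredResolvent μ z' t‖ := fun t => by
    rw [norm_mul]
    exact mul_le_mul_of_nonneg_right (norm_centeredResolvent_le_of_cone hb h1 h2 hT t)
      (norm_nonneg _)
  have hi := ((memLp_centeredResolvent μ hz').integrable (by norm_num)).norm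
  refine (norm_integral_le_of_norm_le (hi.const_mul 4) (Eventually.of_forall h3)).trans ?_
  rw [integral_const_mul]
  linarith [integral_norm_centeredResolvent_le_of_cone (μ := μ) hb h1' h2' hT]

end Cone

/-- A truncated cone of the upper half plane. -/
def truncatedCone (b : ℝ) : Set ℂ := {w | |w.re| < w.im ∧ 2 * b < w.im}

theorem isOpen_truncatedCone (b : ℝ) : IsOpen (truncatedCone b) :=
  IsOpen.and (isOpen_lt (continuous_abs.comp Complex.continuous_re) Complex.continuous_im)
    (isOpen_lt continuous_const Complex.continuous_im)

theorem isPreconnected_truncatedCone (b : ℝ) : IsPreconnected (truncatedCone b) := by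
  refine Convex.isPreconnected fun x hx y hy p q hp hq hpq => ?_
  obtain ⟨hx1, hx2⟩ := hx
  obtain ⟨hy1, hy2⟩ := hy
  rw [abs_lt] at hx1 hy1
  have hp' : p = 1 - q := by linarith
  simp only [truncatedCone, Set.mem_ofPred_eq, Complex.add_re, Complex.add_im, Complex.real_smul,
    Complex.re_ofReal_mul, Complex.im_ofReal_mul, abs_lt]
  rcases hp.eq_or_lt with h | h
  · have : q = 1 := by linarith
    subst this
    rw [← h]
    refine ⟨⟨?_, ?_⟩, ?_⟩ <;> linarith
  · refine ⟨⟨?_, ?_⟩, ?_⟩ <;> nlinarith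

/-- The truncated cone has smaller aperture and starts higher than the region of the estimates, so
that balls of radius `Im w / 4` about its points stay inside that region. -/
theorem mem_cone_of_mem_closedBall {b : ℝ} {w z : ℂ} (hb : 0 < b) (hw : w ∈ truncatedCone b)
    (hz : z ∈ Metric.closedBall w (w.im / 4)) :
    |z.re| ≤ 2 * z.im ∧ b ≤ z.im ∧ 3 / 4 * w.im ≤ z.im ∧ ‖z‖ ≤ 3 * w.im := by
  obtain ⟨h1, h2⟩ := hw
  rw [mem_closedBall_iff_norm] at hz
  have h3 := (Complex.abs_re_le_norm (z - w)).trans hz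
  have h4 := (Complex.abs_im_le_norm (z - w)).trans hz
  rw [Complex.sub_re] at h3
  rw [Complex.sub_im] at h4
  rw [abs_le] at h3 h4
  rw [abs_lt] at h1
  have h5 := Complex.norm_le_abs_re_add_abs_im w
  rw [abs_of_pos (by linarith : 0 < w.im)] at h5
  have h6 : |w.re| ≤ w.im := abs_le.2 ⟨h1.1.le, h1.2.le⟩
  have h7 : ‖z‖ ≤ ‖w‖ + ‖z - w‖ := by
    simpa using norm_add_le w (z - w)
  refine ⟨abs_le.2 ⟨?_, ?_⟩, ?_, ?_, ?_⟩ <;> linarith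

/-- Inversion of `z ↦ z - selfEnergy μ z` on a truncated cone. -/
theorem exists_inverse_of_cone {μ : ProbabilityMeasure ℝ} {b : ℝ} (hb : 0 < b)
    (hT : tailFunctional μ b ≤ 1 / 300) :
    ∃ Z : ℂ → ℂ, DifferentiableOn ℂ Z (truncatedCone b) ∧ ∀ w ∈ truncatedCone b,
      Z w ∈ Metric.closedBall w (w.im / 4) ∧ Z w - selfEnergy μ (Z w) = w := by
  have hex : ∀ w ∈ truncatedCone b, ∃ z ∈ Metric.closedBall w (w.im / 4),
      z - selfEnergy μ z = w := by
    intro w hw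
    have hwim : 0 < w.im := by linarith [hw.2]
    refine exists_sub_eq_of_contraction (K := 1 / 2) (by linarith) (by norm_num)
      (fun z hz => ?_) fun z hz z' hz' => ?_
    · obtain ⟨h1, h2, -, h3⟩ := mem_cone_of_mem_closedBall hb hw hz
      refine (norm_selfEnergy_le_of_cone hb h1 h2 hT).trans ?_
      -- The bound is `4 · (1/300) · 3 Im w = Im w / 25`.
      nlinarith [tailFunctional_nonneg μ b, norm_nonneg z]
    · obtain ⟨h1, h2, -, -⟩ := mem_cone_of_mem_closedBall hb hw hz
      obtain ⟨h1', h2', -, -⟩ := mem_cone_of_mem_closedBall hb hw hz'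
      exact norm_selfEnergy_sub_le_of_cone hb h1 h2 h1' h2' hT
  choose! Z hZ using hex
  refine ⟨Z, ?_, hZ⟩
  refine differentiableOn_of_contraction (K := 1 / 2) (g := selfEnergy μ)
    (V := {z : ℂ | |z.re| < 2 * z.im ∧ b < z.im}) (by norm_num)
    (isOpen_truncatedCone b) (IsOpen.and (isOpen_lt (continuous_abs.comp Complex.continuous_re)
      (continuous_const.mul Complex.continuous_im)) (isOpen_lt continuous_const
      Complex.continuous_im)) (fun z hz => ?_) (fun z hz z' hz' => ?_)
    (fun w hw => ?_) fun w hw => (hZ w hw).2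
  · exact differentiableAt_selfEnergy μ (by linarith [hz.2])
  · exact norm_selfEnergy_sub_le_of_cone hb hz.1.le hz.2.le hz'.1.le hz'.2.le hT
  · have h := (hZ w hw).1
    obtain ⟨h1, h2⟩ := hw
    rw [mem_closedBall_iff_norm] at h
    have h3 := (Complex.abs_re_le_norm (Z w - w)).trans h
    have h4 := (Complex.abs_im_le_norm (Z w - w)).trans h
    rw [Complex.sub_re] at h3
    rw [Complex.sub_im] at h4
    rw [abs_le] at h3 h4
    rw [abs_lt] at h1
    refine ⟨abs_lt.2 ⟨?_, ?_⟩, ?_⟩ <;> linarith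

end FreeCLT

namespace FreeCLT

/-! ### States on C*-algebras and laws of self-adjoint elements -/

section State

variable {A : Type*} [CStarAlgebra A] {φ : A →ₗ[ℂ] ℂ}

theorem IsState.nontrivial (hφ : IsState φ) : Nontrivial A := by
  refine ⟨⟨1, 0, fun h => ?_⟩⟩
  have := hφ.map_one
  rw [h, map_zero] at this
  exact zero_ne_one this

/-- Positive functionals on a C*-algebra are automatically bounded. The algebra carries no order
here, so the spectral order is installed locally. The optimal constant `1` is never needed. -/
theorem IsState.exists_bound (hφ : IsState φ) : ∃ C : ℝ, 0 ≤ C ∧ ∀ x, ‖φ x‖ ≤ C * ‖x‖ := by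
  let _ := CStarAlgebra.spectralOrder A
  let _ := CStarAlgebra.spectralOrderedRing A
  have hpos : ∀ x : A, 0 ≤ x → 0 ≤ φ x := by
    intro x hx
    obtain ⟨y, rfl⟩ := CStarAlgebra.nonneg_iff_eq_star_mul_self.1 hx
    exact hφ.nonneg y
  obtain ⟨C, hC⟩ := PositiveLinearMap.exists_norm_apply_le (PositiveLinearMap.mk₀ φ hpos)
  exact ⟨C, C.2, hC⟩

theorem IsState.continuous (hφ : IsState φ) : Continuous φ := by
  obtain ⟨C, -, hC⟩ := hφ.exists_bound
  exact (φ.mkContinuous C hC).continuous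

theorem pow_mul_measureReal_le {μ : Measure ℝ} [IsFiniteMeasure μ] {n : ℕ} {r : ℝ}
    (hi : Integrable (fun x : ℝ => x ^ (2 * n)) μ) (hr : 0 ≤ r) :
    r ^ (2 * n) * μ.real {x | r ≤ |x|} ≤ ∫ x, x ^ (2 * n) ∂μ := by
  have hnn : ∀ x : ℝ, 0 ≤ x ^ (2 * n) := fun x => (even_two_mul n).pow_nonneg x
  refine le_trans ?_ (mul_meas_ge_le_integral_of_nonneg (Eventually.of_forall hnn) hi (r ^ (2 * n)))
  refine mul_le_mul_of_nonneg_left (measureReal_mono fun x hx => ?_) (by positivity)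
  have : r ^ (2 * n) ≤ |x| ^ (2 * n) := pow_le_pow_left₀ hr hx _
  rwa [(even_two_mul n).pow_abs] at this

/-- Markov's inequality for the even moments bounds the mass by `C (‖a‖/r)^(2n)` for every `n`. Thus
prescribing the moments already confines the law to `[-‖a‖, ‖a‖]`. -/
theorem IsLawOf.measure_eq_zero (hφ : IsState φ) {a : A} {μ : ProbabilityMeasure ℝ}
    (h : IsLawOf φ a μ) {r : ℝ} (hr : ‖a‖ < r) : (μ : Measure ℝ) {x | r ≤ |x|} = 0 := by
  have := hφ.nontrivial
  obtain ⟨C, hC0, hC⟩ := hφ.exists_bound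
  have hr0 : 0 < r := (norm_nonneg a).trans_lt hr
  have key : ∀ n : ℕ, (μ : Measure ℝ).real {x | r ≤ |x|} ≤ C * ((‖a‖ / r) ^ 2) ^ n := by
    intro n
    have h1 := pow_mul_measureReal_le (h (2 * n)).1 hr0.le
    have h2 : ∫ x : ℝ, x ^ (2 * n) ∂(μ : Measure ℝ) ≤ C * ‖a‖ ^ (2 * n) := by
      refine (le_abs_self _).trans ?_
      rw [← Real.norm_eq_abs, ← Complex.norm_real, ← (h (2 * n)).2]
      refine (hC _).trans ?_
      gcongr
      exact norm_pow_le _ _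
    rw [← pow_mul, div_pow, mul_div_assoc', le_div_iff₀ (by positivity)]
    linarith
  have hlim : Tendsto (fun n : ℕ => C * ((‖a‖ / r) ^ 2) ^ n) atTop (𝓝 (C * 0)) := by
    refine (tendsto_pow_atTop_nhds_zero_of_lt_one (by positivity) ?_).const_mul C
    have : ‖a‖ / r < 1 := (div_lt_one hr0).2 hr
    exact pow_lt_one₀ (by positivity) this two_ne_zero
  have h0 := ge_of_tendsto' hlim key
  rw [mul_zero] at h0
  exact (measureReal_eq_zero_iff (measure_ne_top _ _)).1 (le_antisymm h0 measureReal_nonneg)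

theorem IsLawOf.ae_abs_lt (hφ : IsState φ) {a : A} {μ : ProbabilityMeasure ℝ}
    (h : IsLawOf φ a μ) {r : ℝ} (hr : ‖a‖ < r) : ∀ᵐ x ∂(μ : Measure ℝ), |x| < r := by
  rw [ae_iff]
  simpa using h.measure_eq_zero hφ hr

theorem one_sub_mul_inverse {x : A} (hx : ‖x‖ < 1) : (1 - x) * Ring.inverse (1 - x) = 1 :=
  Ring.mul_inverse_cancel _ (isUnit_one_sub_of_norm_lt_one hx)

theorem inverse_mul_one_sub {x : A} (hx : ‖x‖ < 1) : Ring.inverse (1 - x) * (1 - x) = 1 :=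
  Ring.inverse_mul_cancel _ (isUnit_one_sub_of_norm_lt_one hx)

/-- The Cauchy transform of the law of `a` is the expected resolvent of `a` far from the origin. -/
theorem IsLawOf.map_inverse (hφ : IsState φ) {a : A} {μ : ProbabilityMeasure ℝ}
    (h : IsLawOf φ a μ) {z : ℂ} (hz : ‖a‖ < ‖z‖) :
    φ (Ring.inverse (1 - z⁻¹ • a)) = z * cauchyTransform μ z := by
  obtain ⟨r, har, hrz⟩ := exists_between hz
  have hr0 : 0 < r := (norm_nonneg a).trans_lt har
  have hz0 : z ≠ 0 := norm_pos_iff.1 (hr0.trans hrz)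
  have hq : r / ‖z‖ < 1 := (div_lt_one (hr0.trans hrz)).2 hrz
  have hu : ‖z⁻¹ • a‖ < 1 := by
    rw [norm_smul, norm_inv, inv_mul_eq_div]
    exact (div_lt_one (hr0.trans hrz)).2 hz
  have hlt := h.ae_abs_lt hφ har
  have h1 : HasSum (fun n : ℕ => φ ((z⁻¹ • a) ^ n)) (φ (Ring.inverse (1 - z⁻¹ • a))) :=
    (hasSum_geom_series_inverse _ hu).map φ hφ.continuous
  have hterm : ∀ {t : ℝ}, |t| < r → ‖(t : ℂ) / z‖ ≤ r / ‖z‖ := by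
    intro t ht
    rw [norm_div, Complex.norm_real, Real.norm_eq_abs]
    gcongr
  have h2 : HasSum (fun n : ℕ => ∫ t : ℝ, ((t : ℂ) / z) ^ n ∂(μ : Measure ℝ))
      (∫ t : ℝ, (1 - (t : ℂ) / z)⁻¹ ∂(μ : Measure ℝ)) := by
    refine hasSum_integral_of_dominated_convergence (fun n _ => (r / ‖z‖) ^ n)
      (fun n => (by fun_prop : Continuous fun t : ℝ => ((t : ℂ) / z) ^ n).aestronglyMeasurable)
      (fun n => ?_) (Eventually.of_forall fun _ =>
        summable_geometric_of_lt_one (by positivity) hq) (integrable_const _) ?_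
    · filter_upwards [hlt] with t ht
      rw [norm_pow]
      exact pow_le_pow_left₀ (norm_nonneg _) (hterm ht) n
    · filter_upwards [hlt] with t ht
      exact hasSum_geometric_of_norm_lt_one ((hterm ht).trans_lt hq)
  have h3 : (fun n : ℕ => φ ((z⁻¹ • a) ^ n)) =
      fun n : ℕ => ∫ t : ℝ, ((t : ℂ) / z) ^ n ∂(μ : Measure ℝ) := by
    ext n
    rw [smul_pow, map_smul, (h n).2, smul_eq_mul, ← integral_complex_ofReal,
      ← integral_const_mul]
    congr 1 with t
    rw [div_pow, inv_pow, Complex.ofReal_pow]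
    field_simp
  rw [h3] at h1
  rw [h1.unique h2, cauchyTransform, ← integral_const_mul]
  refine integral_congr_ae ?_
  filter_upwards [hlt] with t ht
  have h4 : z - (t : ℂ) ≠ 0 := by
    intro h5
    have h6 : z = (t : ℂ) := sub_eq_zero.1 h5
    rw [h6, Complex.norm_real, Real.norm_eq_abs] at hrz
    linarith
  have h7 : 1 - (t : ℂ) / z = (z - t) / z := by field_simp
  rw [h7, inv_div, mul_one_div]

/-- Every self-adjoint element of a C*-probability space has a law. -/
theorem IsState.exists_isLawOf (hφ : IsState φ) {c : A} (hc : IsSelfAdjoint c) :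
    ∃ ρ : ProbabilityMeasure ℝ, IsLawOf φ c ρ := by
  set Φ : C(spectrum ℝ c, ℝ) →⋆ₐ[ℝ] A := cfcHom hc with hΦ
  -- A nonnegative continuous function is the square of its root, so positivity of the state passes
  -- through the functional calculus and the Riesz–Markov–Kakutani theorem provides the measure.
  have hsq : ∀ f : C(spectrum ℝ c, ℝ), 0 ≤ f → 0 ≤ φ (Φ f) := by
    intro f hf
    let g : C(spectrum ℝ c, ℝ) := ⟨fun x => √(f x), by fun_prop⟩
    have hg : f = star g * g := by
      ext x
      exact (Real.mul_self_sqrt (hf x)).symm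
    rw [hg, map_mul, map_star]
    exact hφ.nonneg _
  let Λ₀ : CompactlySupportedContinuousMap (spectrum ℝ c) ℝ →ₗ[ℝ] ℝ :=
    { toFun := fun f => (φ (Φ f.toContinuousMap)).re
      map_add' := fun f g => by
        have : (f + g).toContinuousMap = f.toContinuousMap + g.toContinuousMap := rfl
        rw [this, map_add, map_add, Complex.add_re]
      map_smul' := fun r f => by
        have : (r • f).toContinuousMap = r • f.toContinuousMap := rfl
        rw [this, map_smul, ← Complex.coe_smul, map_smul]
        simp }
  let Λ : CompactlySupportedContinuousMap (spectrum ℝ c) ℝ →ₚ[ℝ] ℝ :=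
    PositiveLinearMap.mk₀ Λ₀ fun f hf => (Complex.nonneg_iff.1 (hsq _ hf)).1
  let m := RealRMK.rieszMeasure Λ
  have hint : ∀ f : C(spectrum ℝ c, ℝ), ∫ x, f x ∂m = (φ (Φ f)).re := fun f =>
    RealRMK.integral_rieszMeasure Λ (CompactlySupportedContinuousMap.continuousMapEquiv f)
  -- A real function becomes nonnegative after adding a real constant, which does not change the
  -- imaginary part.
  have hreal : ∀ f : C(spectrum ℝ c, ℝ), (φ (Φ f)).im = 0 := by
    intro f
    obtain ⟨M, hM⟩ : ∃ M : ℝ, ∀ x, ‖f x‖ ≤ M := ⟨‖f‖, f.norm_coe_le_norm⟩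
    have h1 : 0 ≤ f + algebraMap ℝ _ M := fun x => by
      have := neg_le_of_abs_le (hM x)
      change (0 : ℝ) ≤ f x + M
      linarith
    have h2 := (Complex.nonneg_iff.1 (hsq _ h1)).2
    rw [map_add, map_add, AlgHomClass.commutes, Algebra.algebraMap_eq_smul_one,
      ← Complex.coe_smul, map_smul, hφ.map_one] at h2
    simpa using h2.symm
  have hfin : IsFiniteMeasure m := by
    refine ⟨isCompact_univ.measure_lt_top⟩
  have hprob : IsProbabilityMeasure m := by
    have h1 := hint 1
    rw [_root_.map_one Φ, hφ.map_one] at h1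
    simp only [ContinuousMap.one_apply, integral_const, smul_eq_mul, mul_one, Complex.one_re] at h1
    exact isProbabilityMeasure_iff_real.2 h1
  have hme : MeasurableEmbedding (Subtype.val : spectrum ℝ c → ℝ) :=
    MeasurableEmbedding.subtype_coe (spectrum.isClosed c).measurableSet
  refine ⟨⟨m.map Subtype.val, Measure.isProbabilityMeasure_map hme.measurable.aemeasurable⟩,
    fun n => ?_⟩
  let p : C(spectrum ℝ c, ℝ) := ⟨fun x => (x : ℝ) ^ n, by fun_prop⟩
  have hp : Φ p = c ^ n := by
    have : p = ((ContinuousMap.id ℝ).restrict (spectrum ℝ c)) ^ n := by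
      ext x
      rfl
    rw [this, map_pow, hΦ, cfcHom_id hc]
  have hpi : Integrable (fun x : spectrum ℝ c => p x) m :=
    Integrable.of_bound p.continuous.aestronglyMeasurable ‖p‖
      (Eventually.of_forall p.norm_coe_le_norm)
  constructor
  · exact (hme.integrable_map_iff (μ := m)).2 hpi
  · change _ = ((∫ x : ℝ, x ^ n ∂(m.map Subtype.val) : ℝ) : ℂ)
    rw [hme.integral_map, ← hp]
    have h3 := hint p
    change _ = ((∫ x, p x ∂m : ℝ) : ℂ)
    rw [h3]
    apply Complex.ext
    · simp
    · simpa using hreal p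

end State

/-! ### Additivity for free elements -/

section FreeAdd

variable {A : Type*} [CStarAlgebra A] {φ : A →ₗ[ℂ] ℂ}

theorem prod_ofFn_alternate_even {M : Type*} [Monoid M] (p q : M) (n : ℕ) :
    (List.ofFn fun i : Fin (2 * n) => if Even (i : ℕ) then p else q).prod = (p * q) ^ n := by
  induction n with
  | zero => simp
  | succ n ih =>
    have : (fun i : Fin (2 * n) => if Even ((i.succ.succ : Fin (2 * n + 1 + 1)) : ℕ) then p else q)
        = fun i : Fin (2 * n) => if Even (i : ℕ) then p else q := by
      ext i
      simp [Nat.even_add_one]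
    change (List.ofFn fun i : Fin (2 * n + 1 + 1) => if Even (i : ℕ) then p else q).prod = _
    rw [List.ofFn_succ, List.ofFn_succ, this, List.prod_cons, List.prod_cons, ih, pow_succ']
    simp [mul_assoc]

theorem prod_ofFn_alternate_odd {M : Type*} [Monoid M] (p q : M) (n : ℕ) :
    (List.ofFn fun i : Fin (2 * n + 1) => if Even (i : ℕ) then p else q).prod =
      p * (q * p) ^ n := by
  have : (fun i : Fin (2 * n) => if Even ((i.succ : Fin (2 * n + 1)) : ℕ) then p else q)
      = fun i : Fin (2 * n) => if Even (i : ℕ) then q else p := by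
    ext i
    simp only [Fin.val_succ, Nat.even_add_one]
    split_ifs <;> rfl
  rw [List.ofFn_succ, this, List.prod_cons, prod_ofFn_alternate_even]
  simp

theorem FreeSubalgebras.map_alternate {ι : Type*} {S : ι → Subalgebra ℂ A}
    (h : FreeSubalgebras φ S) {i j : ι} (hij : i ≠ j) {p q : A} (hp : p ∈ S i) (hq : q ∈ S j)
    (hp0 : φ p = 0) (hq0 : φ q = 0) (n : ℕ) :
    φ ((p * q) ^ (n + 1)) = 0 ∧ φ (p * (q * p) ^ n) = 0 := by
  have key : ∀ r : ℕ, 2 ≤ r →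
      φ (List.ofFn fun k : Fin r => if Even (k : ℕ) then p else q).prod = 0 := by
    intro r hr
    refine h r (fun k => if Even (k : ℕ) then i else j) _ hr (fun k => ?_) (fun k => ?_)
      fun k l hkl => ?_
    · split_ifs <;> assumption
    · split_ifs <;> assumption
    · rw [hkl]
      simp only [Nat.even_add_one]
      split_ifs with h1 <;> first | exact hij | exact hij.symm
  refine ⟨?_, ?_⟩
  · rw [← prod_ofFn_alternate_even]
    exact key _ (by omega)
  -- A single letter is not covered by freeness, which starts at length two; it is centered by
  -- hypothesis.
  · rcases n with _ | n
    · simpa using hp0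
    · rw [← prod_ofFn_alternate_odd]
      exact key _ (by omega)

/-- Resolvents lie only in the norm closure of the generated subalgebra, while freeness concerns the
subalgebra itself. Subtracting the expectations keeps approximants centered without changing the
limit. -/
theorem exists_centered_approx (hφ : IsState φ) {S : Subalgebra ℂ A} {x : A}
    (hx : x ∈ S.topologicalClosure) (hx0 : φ x = 0) :
    ∃ p : ℕ → A, (∀ n, p n ∈ S) ∧ (∀ n, φ (p n) = 0) ∧ Tendsto p atTop (𝓝 x) := by
  obtain ⟨p, hp, hlim⟩ := mem_closure_iff_seq_limit.1
    (show x ∈ closure (S : Set A) from by simpa [← Subalgebra.topologicalClosure_coe] using hx)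
  refine ⟨fun n => p n - φ (p n) • 1, fun n => S.sub_mem (hp n) (S.smul_mem S.one_mem _),
    fun n => ?_, ?_⟩
  · simp [hφ.map_one]
  · have h1 := (hφ.continuous.tendsto x).comp hlim
    rw [hx0] at h1
    simpa using hlim.sub (h1.smul_const (1 : A))

theorem FreeSubalgebras.map_alternate_closure {ι : Type*} {S : ι → Subalgebra ℂ A}
    (hφ : IsState φ) (h : FreeSubalgebras φ S) {i j : ι} (hij : i ≠ j) {x y : A}
    (hx : x ∈ (S i).topologicalClosure) (hy : y ∈ (S j).topologicalClosure)
    (hx0 : φ x = 0) (hy0 : φ y = 0) (n : ℕ) :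
    φ ((x * y) ^ (n + 1)) = 0 ∧ φ (x * (y * x) ^ n) = 0 := by
  obtain ⟨p, hp, hp0, hpx⟩ := exists_centered_approx hφ hx hx0
  obtain ⟨q, hq, hq0, hqy⟩ := exists_centered_approx hφ hy hy0
  have key := fun k => h.map_alternate hij (hp k) (hq k) (hp0 k) (hq0 k) n
  constructor
  · refine tendsto_nhds_unique ((hφ.continuous.tendsto _).comp ((hpx.mul hqy).pow (n + 1))) ?_
    exact tendsto_const_nhds.congr fun k => (key k).1.symm
  · refine tendsto_nhds_unique
      ((hφ.continuous.tendsto _).comp (hpx.mul ((hqy.mul hpx).pow n))) ?_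
    exact tendsto_const_nhds.congr fun k => (key k).2.symm

theorem inverse_mem_topologicalClosure (a : A) {z : ℂ} (hu : ‖z⁻¹ • a‖ < 1) :
    Ring.inverse (1 - z⁻¹ • a) ∈ (Algebra.adjoin ℂ {a}).topologicalClosure := by
  have h := (hasSum_geom_series_inverse _ hu).tendsto_sum_nat
  refine (Algebra.adjoin ℂ {a}).isClosed_topologicalClosure.mem_of_tendsto h
    (Eventually.of_forall fun n => ?_)
  refine (Algebra.adjoin ℂ {a}).le_topologicalClosure ?_
  refine Subalgebra.sum_mem _ fun k _ => Subalgebra.pow_mem _ (Subalgebra.smul_mem _ ?_ _) _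
  exact Algebra.subset_adjoin rfl

/-- If `P (1 + x) = 1 / s` and `Q (1 + y) = 1 / s` then `P + Q - 1 / s` is inverted by
`s (1 + y) (1 - x y)⁻¹ (1 + x)`. -/
theorem mul_eq_one_of_centered_resolvents {P Q x y N : A} {s : ℂ} (hs : s ≠ 0)
    (hP : (1 + x) * P = s⁻¹ • 1) (hQ : (1 + y) * Q = s⁻¹ • 1)
    (hQ' : Q * (1 + y) = s⁻¹ • 1) (hN : N * (1 - x * y) = 1) :
    (s • ((1 + y) * N * (1 + x))) * (P + Q - s⁻¹ • 1) = 1 := by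
  -- The algebraic core: the left side equals `s⁻¹ ((1 + y) + (1 + x) - (1 + x)(1 + y))`.
  have h1 : (1 + x) * (P + Q - s⁻¹ • 1) * (1 + y) = s⁻¹ • (1 - x * y) := by
    have : (1 + x) * (P + Q - s⁻¹ • 1) * (1 + y) =
        ((1 + x) * P) * (1 + y) + (1 + x) * (Q * (1 + y)) - s⁻¹ • ((1 + x) * (1 + y)) := by
      simp only [mul_add, add_mul, mul_sub, sub_mul, smul_mul_assoc, mul_smul_comm, mul_one,
        one_mul, mul_assoc, smul_add]
      abel
    rw [this, hP, hQ', smul_mul_assoc, mul_smul_comm, one_mul, mul_one, ← smul_add, ← smul_sub]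
    congr 1
    noncomm_ring
  have h2 : (1 + x) * (P + Q - s⁻¹ • 1) = (1 - x * y) * Q := by
    have h3 : (1 + x) * (P + Q - s⁻¹ • 1) * ((1 + y) * Q) = (s⁻¹ • (1 - x * y)) * Q := by
      rw [← h1, mul_assoc, mul_assoc, mul_assoc]
    rw [hQ, mul_smul_comm, mul_one, smul_mul_assoc] at h3
    exact smul_right_injective A (inv_ne_zero hs) h3
  calc (s • ((1 + y) * N * (1 + x))) * (P + Q - s⁻¹ • 1)
      = s • ((1 + y) * (N * ((1 + x) * (P + Q - s⁻¹ • 1)))) := by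
        rw [smul_mul_assoc]; simp only [mul_assoc]
    _ = s • ((1 + y) * ((N * (1 - x * y)) * Q)) := by rw [h2, mul_assoc N]
    _ = 1 := by rw [hN, one_mul, hQ, smul_smul, mul_inv_cancel₀ hs, one_smul]

/-- Expanding the Neumann series writes the element as a sum of alternating words in `x` and `y`;
all of them have expectation zero except the empty word, which occurs once, at `n = 0`. -/
theorem map_alternate_resolvent (hφ : IsState φ) {x y : A} (hxy : ‖x * y‖ < 1)
    (h1 : ∀ n, φ ((x * y) ^ (n + 1)) = 0 ∧ φ (x * (y * x) ^ n) = 0)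
    (h2 : ∀ n, φ ((y * x) ^ (n + 1)) = 0 ∧ φ (y * (x * y) ^ n) = 0) :
    φ ((1 + y) * Ring.inverse (1 - x * y) * (1 + x)) = 1 := by
  have hs := (((hasSum_geom_series_inverse _ hxy).mul_left (1 + y)).mul_right (1 + x)).map φ
    hφ.continuous
  have hterm : ∀ n : ℕ, φ ((1 + y) * (x * y) ^ n * (1 + x)) = if n = 0 then 1 else 0 := by
    intro n
    have hc : ∀ n, (x * y) ^ n * x = x * (y * x) ^ n := by
      intro n
      induction n with
      | zero => simp
      | succ n ih => rw [pow_succ', pow_succ', mul_assoc, ih]; simp only [mul_assoc]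
    have hd : y * (x * y) ^ n * x = (y * x) ^ (n + 1) := by
      rw [mul_assoc, hc, ← mul_assoc, pow_succ']
    have he : (1 + y) * (x * y) ^ n * (1 + x) = (x * y) ^ n + x * (y * x) ^ n + y * (x * y) ^ n +
        (y * x) ^ (n + 1) := by
      rw [← hd, ← hc]
      noncomm_ring
    rw [he, map_add, map_add, map_add, (h1 n).2, (h2 n).2, (h2 n).1]
    rcases n with _ | n
    · simp [hφ.map_one]
    · simp [(h1 n).1]
  have hs' : HasSum (fun n : ℕ => φ ((1 + y) * (x * y) ^ n * (1 + x))) 1 := by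
    simp_rw [hterm]
    exact hasSum_ite_eq 0 1
  exact hs.unique hs'

/-- The resolvent of `a`, normalized and centered with respect to the state. -/
theorem exists_centered_resolvent (hφ : IsState φ) {a : A} {μ : ProbabilityMeasure ℝ}
    (h : IsLawOf φ a μ) {C : ℝ} (hC0 : 0 ≤ C) (hC : ∀ x, ‖φ x‖ ≤ C * ‖x‖) {z : ℂ}
    (hz : 10 * (1 + C) * ‖a‖ < ‖z‖) :
    cauchyTransform μ z ≠ 0 ∧ ‖z - (cauchyTransform μ z)⁻¹‖ ≤ 2 * C * ‖a‖ ∧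
    ∃ x ∈ (Algebra.adjoin ℂ {a}).topologicalClosure, φ x = 0 ∧ ‖x‖ < 1 ∧
      (1 + x) * (z • 1 - a) = (cauchyTransform μ z)⁻¹ • 1 ∧
      (z • 1 - a) * (1 + x) = (cauchyTransform μ z)⁻¹ • 1 := by
  have := hφ.nontrivial
  have ha0 := norm_nonneg a
  have hCa : 0 ≤ C * ‖a‖ := by positivity
  have hzpos : 0 < ‖z‖ := lt_of_le_of_lt (by positivity) hz
  have hz0 : z ≠ 0 := norm_pos_iff.1 hzpos
  set u := z⁻¹ • a with hu
  have hun : ‖u‖ = ‖a‖ / ‖z‖ := by rw [hu, norm_smul, norm_inv, inv_mul_eq_div]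
  have hzu : ‖z‖ * ‖u‖ = ‖a‖ := by rw [hun]; field_simp
  -- This smallness fixes the later constants: `‖r‖ ≤ 10/9`, `|c - 1| ≤ 1/9`, and the centered
  -- resolvent has norm at most `(1/9)/(8/9)`.
  have hu10 : (1 + C) * ‖u‖ ≤ 1 / 10 := by
    rw [hun, mul_div_assoc', div_le_iff₀ hzpos]
    linarith
  have hCu : 0 ≤ C * ‖u‖ := by positivity
  have hu0 := norm_nonneg u
  have hu1 : ‖u‖ < 1 := by linarith
  set r := Ring.inverse (1 - u) with hr
  have hr1 : (1 - u) * r = 1 := one_sub_mul_inverse hu1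
  have hr2 : r * (1 - u) = 1 := inverse_mul_one_sub hu1
  have hrsub : r - 1 = u * r := by
    rw [sub_mul, one_mul] at hr1
    rw [← hr1]
    abel
  have hrn : ‖r‖ ≤ 10 / 9 := by
    have h1 := norm_add_le (r - 1) 1
    rw [sub_add_cancel, norm_one, hrsub] at h1
    have h2 := norm_mul_le u r
    nlinarith [norm_nonneg r]
  have hrs : ‖r - 1‖ ≤ 10 / 9 * ‖u‖ := by
    rw [hrsub]
    refine (norm_mul_le _ _).trans ?_
    nlinarith
  have hφr : φ r = z * cauchyTransform μ z := h.map_inverse hφ (by nlinarith)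
  set c := z * cauchyTransform μ z with hc
  have hc1 : ‖c - 1‖ ≤ C * (10 / 9 * ‖u‖) := by
    have : c - 1 = φ (r - 1) := by rw [map_sub, hφr, hφ.map_one]
    rw [this]
    exact (hC _).trans (mul_le_mul_of_nonneg_left hrs hC0)
  have hcn : 8 / 9 ≤ ‖c‖ := by
    have h1 := norm_sub_norm_le (1 : ℂ) c
    rw [norm_one, norm_sub_rev] at h1
    linarith
  have hc0 : c ≠ 0 := norm_pos_iff.1 (by linarith)
  have hG : cauchyTransform μ z ≠ 0 := right_ne_zero_of_mul hc0
  have hzc : (cauchyTransform μ z)⁻¹ = z * c⁻¹ := by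
    rw [hc]
    field_simp
  refine ⟨hG, ?_, c⁻¹ • r - 1, ?_, ?_, ?_, ?_, ?_⟩
  · have h1 : z - (cauchyTransform μ z)⁻¹ = z * ((c - 1) / c) := by
      rw [hzc]
      field_simp
    rw [h1, norm_mul, norm_div]
    have h2 : ‖c - 1‖ / ‖c‖ ≤ 2 * (C * ‖u‖) := by
      rw [div_le_iff₀ (by linarith)]
      nlinarith
    calc ‖z‖ * (‖c - 1‖ / ‖c‖) ≤ ‖z‖ * (2 * (C * ‖u‖)) := by gcongr
      _ = 2 * C * (‖z‖ * ‖u‖) := by ring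
      _ = 2 * C * ‖a‖ := by rw [hzu]
  · exact Subalgebra.sub_mem _ (Subalgebra.smul_mem _ (inverse_mem_topologicalClosure a hu1) _)
      (Subalgebra.one_mem _)
  · rw [map_sub, map_smul, hφr, hφ.map_one, smul_eq_mul, inv_mul_cancel₀ hc0, sub_self]
  · have h1 : c⁻¹ • r - 1 = c⁻¹ • ((r - 1) - (c - 1) • 1) := by
      rw [sub_smul, one_smul, sub_sub_sub_cancel_right, smul_sub, smul_smul,
        inv_mul_cancel₀ hc0, one_smul]
    rw [h1, norm_smul, norm_inv, inv_mul_eq_div, div_lt_one (by linarith)]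
    refine (norm_sub_le _ _).trans_lt ?_
    rw [norm_smul, norm_one, mul_one]
    linarith
  · rw [add_sub_cancel, hzc]
    have h1 : z • (1 : A) - a = z • (1 - u) := by
      rw [smul_sub, hu, smul_smul, mul_inv_cancel₀ hz0, one_smul]
    rw [h1, smul_mul_smul_comm, hr2, mul_comm]
  · rw [add_sub_cancel, hzc]
    have h1 : z • (1 : A) - a = z • (1 - u) := by
      rw [smul_sub, hu, smul_smul, mul_inv_cancel₀ hz0, one_smul]
    rw [h1, smul_mul_smul_comm, hr1]

end FreeAdd

/-- Additivity of the inverse Cauchy transforms of free bounded variables near infinity. -/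
theorem IsBoundedFreeConv.exists_cauchyTransform_add {μ ν ρ : ProbabilityMeasure ℝ}
    (h : IsBoundedFreeConv μ ν ρ) :
    ∃ M : ℝ, ∀ α β : ℂ, M < ‖α‖ → M < ‖β‖ → cauchyTransform μ α = cauchyTransform ν β →
      cauchyTransform ρ (α + β - (cauchyTransform μ α)⁻¹) = cauchyTransform μ α := by
  obtain ⟨A, _, φ, a, b, hφ, -, -, hfree, hμ, hν, hρ⟩ := h
  obtain ⟨C, hC0, hC⟩ := hφ.exists_bound
  have := hφ.nontrivial
  have ha0 := norm_nonneg a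
  have hb0 := norm_nonneg b
  refine ⟨10 * (1 + C) * (‖a‖ + ‖b‖), fun α β hα hβ hαβ => ?_⟩
  have hCb : 0 ≤ (1 + C) * ‖b‖ := by positivity
  have hCa : 0 ≤ (1 + C) * ‖a‖ := by positivity
  obtain ⟨hG, hdist, x, hx, hx0, hx1, hxP, -⟩ :=
    exists_centered_resolvent hφ hμ hC0 hC (z := α) (by linarith)
  obtain ⟨-, -, y, hy, hy0, hy1, hyQ, hyQ'⟩ :=
    exists_centered_resolvent hφ hν hC0 hC (z := β) (by linarith)
  rw [← hαβ] at hyQ hyQ'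
  set s := cauchyTransform μ α with hs
  set ζ := α + β - s⁻¹ with hζ
  have hxy : ‖x * y‖ < 1 := (norm_mul_le _ _).trans_lt
    (mul_lt_one_of_nonneg_of_lt_one_left (norm_nonneg _) hx1 hy1.le)
  have hinv := mul_eq_one_of_centered_resolvents hG hxP hyQ hyQ' (inverse_mul_one_sub hxy)
  have hsum : (α • 1 - a) + (β • 1 - b) - s⁻¹ • 1 = ζ • 1 - (a + b) := by
    rw [hζ, sub_smul, add_smul]
    abel
  rw [hsum] at hinv
  have hval : φ (s • ((1 + y) * Ring.inverse (1 - x * y) * (1 + x))) = s := by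
    rw [map_smul, map_alternate_resolvent hφ hxy, smul_eq_mul, mul_one]
    · exact hfree.map_alternate_closure hφ (i := 0) (j := 1) (by decide) (by simpa using hx)
        (by simpa using hy) hx0 hy0
    · exact hfree.map_alternate_closure hφ (i := 1) (j := 0) (by decide) (by simpa using hy)
        (by simpa using hx) hy0 hx0
  -- `ζ` differs from `β` only by `α - s⁻¹`, of norm at most `2C‖a‖`, so it is still outside the
  -- ball that contains the spectrum of `a + b`.
  have hζn : ‖a + b‖ < ‖ζ‖ := by
    have h1 : ‖β‖ ≤ ‖ζ‖ + ‖α - s⁻¹‖ := by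
      have : β = ζ - (α - s⁻¹) := by rw [hζ]; ring
      rw [this]
      exact norm_sub_le _ _
    have h2 := norm_add_le a b
    nlinarith
  have hζ0 : ζ ≠ 0 := norm_pos_iff.1 ((norm_nonneg _).trans_lt hζn)
  have hu : ‖ζ⁻¹ • (a + b)‖ < 1 := by
    rw [norm_smul, norm_inv, inv_mul_eq_div]
    exact (div_lt_one (norm_pos_iff.2 hζ0)).2 hζn
  have h3 : ζ • (1 : A) - (a + b) = ζ • (1 - ζ⁻¹ • (a + b)) := by
    rw [smul_sub, smul_smul, mul_inv_cancel₀ hζ0, one_smul]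
  rw [h3] at hinv
  -- A left inverse of an invertible element is the inverse, here the Neumann resolvent of `a + b`.
  have h4 : s • ((1 + y) * Ring.inverse (1 - x * y) * (1 + x)) =
      ζ⁻¹ • Ring.inverse (1 - ζ⁻¹ • (a + b)) := by
    set B := s • ((1 + y) * Ring.inverse (1 - x * y) * (1 + x)) with hB
    calc B = B * ((ζ • (1 - ζ⁻¹ • (a + b))) * (ζ⁻¹ • Ring.inverse (1 - ζ⁻¹ • (a + b)))) := by
          rw [smul_mul_smul_comm, one_sub_mul_inverse hu, mul_inv_cancel₀ hζ0, one_smul, mul_one]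
      _ = ζ⁻¹ • Ring.inverse (1 - ζ⁻¹ • (a + b)) := by rw [← mul_assoc, hinv, one_mul]
  rw [h4, map_smul, hρ.map_inverse hφ hζn, smul_eq_mul, inv_mul_cancel_left₀ hζ0] at hval
  exact hval

end FreeCLT

namespace FreeCLT

/-! ### The left regular representation of a group -/

section Regular

variable (G : Type)

/-- The Hilbert space `ℓ²(G)`. -/
abbrev EllTwo : Type := lp (fun _ : G => ℂ) 2

variable {G}

/-- The canonical Hilbert basis of `ℓ²(G)`. -/
noncomputable def ellTwoBasis : HilbertBasis G ℂ (EllTwo G) :=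
  HilbertBasis.ofRepr (LinearIsometryEquiv.refl ℂ _)

theorem ext_ellTwoBasis {S T : EllTwo G →L[ℂ] EllTwo G}
    (h : ∀ g, S (ellTwoBasis g) = T (ellTwoBasis g)) : S = T := by
  refine ContinuousLinearMap.ext_on (s := range (ellTwoBasis : G → EllTwo G)) ?_ ?_
  · exact Submodule.dense_iff_topologicalClosure_eq_top.2 ellTwoBasis.dense_span
  · rintro _ ⟨g, rfl⟩
    exact h g

variable [Group G]

/-- The canonical Hilbert basis of `ℓ²(G)`, translated by `g`. -/
noncomputable def ellTwoBasisTranslate (g : G) : HilbertBasis G ℂ (EllTwo G) :=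
  HilbertBasis.mk (v := fun h => ellTwoBasis (g * h))
    (ellTwoBasis.orthonormal.comp _ (mul_right_injective g)) (by
      have : range (fun h : G => ellTwoBasis (g * h)) = range (ellTwoBasis : G → EllTwo G) :=
        (Group.mulLeft_bijective g).surjective.range_comp (ellTwoBasis : G → EllTwo G)
      rw [this, ellTwoBasis.dense_span])

theorem ellTwoBasisTranslate_apply (g h : G) :
    ellTwoBasisTranslate g h = ellTwoBasis (g * h) := by
  simp [ellTwoBasisTranslate]

/-- Left translation by `g` on `ℓ²(G)`. -/
noncomputable def leftTranslation (g : G) : EllTwo G ≃ₗᵢ[ℂ] EllTwo G :=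
  ellTwoBasis.repr.trans (ellTwoBasisTranslate g).repr.symm

theorem leftTranslation_basis (g h : G) :
    leftTranslation g (ellTwoBasis h) = ellTwoBasis (g * h) := by
  classical
  simp only [leftTranslation, LinearIsometryEquiv.trans_apply, HilbertBasis.repr_self,
    HilbertBasis.repr_symm_single, ellTwoBasisTranslate_apply]

/-- The left regular representation. -/
noncomputable def leftRegular : G →* (EllTwo G →L[ℂ] EllTwo G) where
  toFun g := (leftTranslation g).toContinuousLinearEquiv
  map_one' := ext_ellTwoBasis fun g => by simp [leftTranslation_basis]
  map_mul' g g' := ext_ellTwoBasis fun h => by simp [leftTranslation_basis, mul_assoc]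

theorem leftRegular_basis (g h : G) :
    leftRegular g (ellTwoBasis h) = ellTwoBasis (g * h) :=
  leftTranslation_basis g h

theorem star_leftRegular (g : G) : star (leftRegular g) = leftRegular g⁻¹ := by
  have h1 : star (leftRegular g) * leftRegular g = 1 := by
    rw [ContinuousLinearMap.star_eq_adjoint]
    exact (ContinuousLinearMap.norm_map_iff_adjoint_comp_self _).1 (leftTranslation g).norm_map
  calc star (leftRegular g) = star (leftRegular g) * (leftRegular g * leftRegular g⁻¹) := by
        rw [← map_mul, mul_inv_cancel, map_one, mul_one]
    _ = leftRegular g⁻¹ := by rw [← mul_assoc, h1, one_mul]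

/-- The vector state at the unit element of `G`. -/
noncomputable def vacuumState : (EllTwo G →L[ℂ] EllTwo G) →ₗ[ℂ] ℂ where
  toFun T := inner ℂ (ellTwoBasis (1 : G)) (T (ellTwoBasis 1))
  map_add' S T := by simp
  map_smul' c T := by simp

theorem isState_vacuumState : IsState (vacuumState (G := G)) where
  map_one := by
    change inner ℂ (ellTwoBasis (1 : G)) (ellTwoBasis (1 : G)) = 1
    rw [inner_self_eq_norm_sq_to_K, ellTwoBasis.orthonormal.1 1]
    simp
  nonneg x := by
    change (0 : ℂ) ≤ inner ℂ (ellTwoBasis (1 : G))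
      (ContinuousLinearMap.adjoint x (x (ellTwoBasis 1)))
    rw [ContinuousLinearMap.adjoint_inner_right, inner_self_eq_norm_sq_to_K]
    rw [← RCLike.ofReal_pow]
    exact Complex.zero_le_real.2 (sq_nonneg ‖x (ellTwoBasis 1)‖)

theorem vacuumState_leftRegular [DecidableEq G] (g : G) :
    vacuumState (leftRegular g) = if g = 1 then 1 else 0 := by
  change inner ℂ (ellTwoBasis (1 : G)) (leftRegular g (ellTwoBasis 1)) = _
  rw [leftRegular_basis, mul_one, orthonormal_iff_ite.1 ellTwoBasis.orthonormal]
  simp only [eq_comm]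

end Regular

/-! ### Free copies of a trigonometric polynomial -/

/-- The free product of two copies of `ℤ`. -/
abbrev FreeProductInt : Type := Monoid.CoprodI fun _ : Fin 2 => Multiplicative ℤ

/-- The two copies of the Laurent polynomials in the regular representation of the free product. -/
noncomputable def freeCopy (i : Fin 2) :
    MonoidAlgebra ℂ (Multiplicative ℤ) →ₐ[ℂ] (EllTwo FreeProductInt →L[ℂ] EllTwo FreeProductInt) :=
  MonoidAlgebra.lift ℂ _ _ (leftRegular.comp
    (Monoid.CoprodI.of (M := fun _ : Fin 2 => Multiplicative ℤ) (i := i)))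

/-- Laurent polynomials as functions on the circle. -/
noncomputable def trigPolynomial : MonoidAlgebra ℂ (Multiplicative ℤ) →ₐ[ℂ] C(UnitAddCircle, ℂ) :=
  MonoidAlgebra.lift ℂ _ _
    { toFun := fun n => fourier n.toAdd
      map_one' := by ext; simp
      map_mul' := fun m n => by ext; simp }

/-- Uniqueness of normal forms in a free product. -/
theorem neWord_prod_ne_one {i j : Fin 2}
    (w : Monoid.CoprodI.NeWord (fun _ : Fin 2 => Multiplicative ℤ) i j) : w.prod ≠ 1 := by
  intro h
  have h1 : w.toWord = Monoid.CoprodI.Word.empty :=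
    Monoid.CoprodI.Word.equiv.symm.injective (h.trans Monoid.CoprodI.Word.prod_empty.symm)
  exact w.toList_ne_nil (congrArg Monoid.CoprodI.Word.toList h1)

/-- Span of the nontrivial group elements of the `i`-th copy. -/
noncomputable def letterSpan (i : Fin 2) :
    Submodule ℂ (EllTwo FreeProductInt →L[ℂ] EllTwo FreeProductInt) :=
  Submodule.span ℂ {T | ∃ g : Multiplicative ℤ, g ≠ 1 ∧
    T = leftRegular (Monoid.CoprodI.of (i := i) g : FreeProductInt)}

/-- Span of the reduced words whose first letter is in the `i`-th copy. -/
noncomputable def wordSpan (i : Fin 2) :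
    Submodule ℂ (EllTwo FreeProductInt →L[ℂ] EllTwo FreeProductInt) :=
  Submodule.span ℂ {T | ∃ (j : Fin 2)
    (w : Monoid.CoprodI.NeWord (fun _ : Fin 2 => Multiplicative ℤ) i j), T = leftRegular w.prod}

theorem letterSpan_le_wordSpan (i : Fin 2) : letterSpan i ≤ wordSpan i := by
  refine Submodule.span_mono ?_
  rintro _ ⟨g, hg, rfl⟩
  exact ⟨i, Monoid.CoprodI.NeWord.singleton g hg, by rw [Monoid.CoprodI.NeWord.prod_singleton]⟩

/-- A nontrivial letter put in front of a reduced word starting in the other copy gives a reduced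
word: no cancellation occurs. -/
theorem mul_mem_wordSpan {i k : Fin 2} (hik : i ≠ k)
    {S T : EllTwo FreeProductInt →L[ℂ] EllTwo FreeProductInt} (hS : S ∈ letterSpan i)
    (hT : T ∈ wordSpan k) : S * T ∈ wordSpan i := by
  have h := Submodule.mul_mem_mul hS hT
  unfold letterSpan wordSpan at h
  rw [Submodule.span_mul_span] at h
  refine Submodule.span_mono ?_ h
  rintro _ ⟨_, ⟨g, hg, rfl⟩, _, ⟨j, w, rfl⟩, rfl⟩
  refine ⟨j, Monoid.CoprodI.NeWord.append (Monoid.CoprodI.NeWord.singleton g hg) hik w, ?_⟩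
  simp only [Monoid.CoprodI.NeWord.append_prod, Monoid.CoprodI.NeWord.prod_singleton, map_mul]

theorem prod_mem_wordSpan {r : ℕ} : ∀ (j : Fin (r + 1) → Fin 2)
    (x : Fin (r + 1) → EllTwo FreeProductInt →L[ℂ] EllTwo FreeProductInt),
    (∀ i, x i ∈ letterSpan (j i)) → (∀ i k : Fin (r + 1), (k : ℕ) = i + 1 → j i ≠ j k) →
    (List.ofFn x).prod ∈ wordSpan (j 0) := by
  induction r with
  | zero =>
    intro j x hx _
    simpa using letterSpan_le_wordSpan _ (hx 0)
  | succ r ih =>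
    intro j x hx hj
    rw [List.ofFn_succ, List.prod_cons]
    refine mul_mem_wordSpan (k := j 1) (hj 0 1 (by simp)) (hx 0) ?_
    exact ih (fun i => j i.succ) (fun i => x i.succ) (fun i => hx i.succ)
      fun i k hik => hj _ _ (by simpa using hik)

theorem vacuumState_eq_zero_of_mem_wordSpan {i : Fin 2}
    {T : EllTwo FreeProductInt →L[ℂ] EllTwo FreeProductInt} (hT : T ∈ wordSpan i) :
    vacuumState T = 0 := by
  classical
  have : wordSpan i ≤ LinearMap.ker vacuumState := by
    refine Submodule.span_le.2 ?_
    rintro _ ⟨j, w, rfl⟩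
    change vacuumState _ = 0
    rw [vacuumState_leftRegular, if_neg (neWord_prod_ne_one w)]
  exact this hT

/-- The vacuum expectation is the coefficient of the unit element, so subtracting it leaves only
nontrivial letters. Consequently products of centered elements from alternating copies are
combinations of nonempty reduced words. -/
theorem freeCopy_sub_mem_letterSpan (i : Fin 2) (p : MonoidAlgebra ℂ (Multiplicative ℤ)) :
    freeCopy i p - vacuumState (freeCopy i p) • 1 ∈ letterSpan i := by
  classical
  induction p using MonoidAlgebra.induction_on with
  | of g =>
    have h1 : freeCopy i (MonoidAlgebra.of ℂ _ g) =
        leftRegular (Monoid.CoprodI.of (i := i) g : FreeProductInt) := by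
      simp [freeCopy]
    rw [h1, vacuumState_leftRegular]
    by_cases hg : g = 1
    · simp [hg]
    · have hne : (Monoid.CoprodI.of (i := i) g : FreeProductInt) ≠ 1 := fun h =>
        hg (Monoid.CoprodI.of_injective i (h.trans (map_one _).symm))
      rw [if_neg hne, zero_smul, sub_zero]
      exact Submodule.subset_span ⟨g, hg, rfl⟩
  | add p q hp hq =>
    have := Submodule.add_mem _ hp hq
    rw [map_add, map_add, add_smul]
    convert this using 1
    abel
  | smul c p hp =>
    have := Submodule.smul_mem _ c hp
    rw [map_smul, map_smul, smul_eq_mul, mul_smul, ← smul_sub]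
    exact this

theorem freeElements_freeCopy (p q : MonoidAlgebra ℂ (Multiplicative ℤ)) :
    FreeElements vacuumState (freeCopy 0 p) (freeCopy 1 q) := by
  intro r j x hr hx0 hx hj
  obtain ⟨r, rfl⟩ : ∃ s, r = s + 1 := ⟨r - 1, by omega⟩
  refine vacuumState_eq_zero_of_mem_wordSpan (prod_mem_wordSpan j x (fun i => ?_) hj)
  have h1 : Algebra.adjoin ℂ {![freeCopy 0 p, freeCopy 1 q] (j i)} ≤ (freeCopy (j i)).range := by
    refine Algebra.adjoin_le ?_
    rw [Set.singleton_subset_iff]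
    generalize j i = k
    fin_cases k
    · exact ⟨p, rfl⟩
    · exact ⟨q, rfl⟩
  obtain ⟨y, hy⟩ := h1 (hx i)
  have h2 := freeCopy_sub_mem_letterSpan (j i) y
  have h3 : freeCopy (j i) y = x i := hy
  rwa [h3, hx0 i, zero_smul, sub_zero] at h2

theorem integral_fourier (n : ℤ) :
    ∫ t : UnitAddCircle, fourier n t ∂AddCircle.haarAddCircle = if n = 0 then 1 else 0 := by
  have h := congrFun (fourierCoeff_fourier (T := 1) n) 0
  unfold fourierCoeff at h
  simp only [neg_zero, fourier_zero, one_smul] at h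
  rw [h, Pi.single_apply]
  simp only [eq_comm]

/-- Both sides pick out the constant coefficient. This makes the law of a self-adjoint Laurent
polynomial in either copy the distribution of the corresponding function on the circle. -/
theorem vacuumState_freeCopy (i : Fin 2) (p : MonoidAlgebra ℂ (Multiplicative ℤ)) :
    vacuumState (freeCopy i p) = ∫ t, trigPolynomial p t ∂AddCircle.haarAddCircle := by
  classical
  have hint : ∀ f : C(UnitAddCircle, ℂ), Integrable (fun t => f t) AddCircle.haarAddCircle :=
    fun f => Integrable.of_bound f.continuous.aestronglyMeasurable ‖f‖
      (Eventually.of_forall f.norm_coe_le_norm)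
  induction p using MonoidAlgebra.induction_on with
  | of g =>
    have h1 : freeCopy i (MonoidAlgebra.of ℂ _ g) =
        leftRegular (Monoid.CoprodI.of (i := i) g : FreeProductInt) := by
      simp [freeCopy]
    have h2 : trigPolynomial (MonoidAlgebra.of ℂ _ g) = fourier g.toAdd := by
      simp [trigPolynomial]
    rw [h1, h2, vacuumState_leftRegular, integral_fourier]
    refine if_congr ?_ rfl rfl
    rw [← map_one (Monoid.CoprodI.of (i := i)), (Monoid.CoprodI.of_injective i).eq_iff,
      toAdd_eq_zero]
  | add p q hp hq =>
    rw [map_add, map_add, hp, hq, map_add, ← integral_add (hint _) (hint _)]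
    rfl
  | smul c p hp =>
    rw [map_smul, map_smul, hp, map_smul, smul_eq_mul, ← integral_const_mul]
    rfl

theorem exists_star_freeCopy (p : MonoidAlgebra ℂ (Multiplicative ℤ)) :
    ∃ q, (∀ i, freeCopy i q = star (freeCopy i p)) ∧ trigPolynomial q = star (trigPolynomial p) := by
  induction p using MonoidAlgebra.induction_on with
  | of g =>
    refine ⟨MonoidAlgebra.of ℂ _ g⁻¹, fun i => ?_, ?_⟩
    · simp [freeCopy, star_leftRegular]
    · ext t
      simp [trigPolynomial]
  | add p q hp hq =>
    obtain ⟨p', hp1, hp2⟩ := hp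
    obtain ⟨q', hq1, hq2⟩ := hq
    exact ⟨p' + q', fun i => by rw [map_add, map_add, star_add, hp1, hq1],
      by rw [map_add, map_add, star_add, hp2, hq2]⟩
  | smul c p hp =>
    obtain ⟨p', hp1, hp2⟩ := hp
    exact ⟨star c • p', fun i => by rw [map_smul, map_smul, star_smul, hp1],
      by rw [map_smul, map_smul, star_smul, hp2]⟩

/-- The real part of a trigonometric polynomial is the law of an element with a free copy. -/
theorem exists_isBoundedFreeConv_trigPolynomial (p : MonoidAlgebra ℂ (Multiplicative ℤ))
    {μ : ProbabilityMeasure ℝ} (hμ : (μ : Measure ℝ) =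
      Measure.map (fun t => (trigPolynomial p t).re) AddCircle.haarAddCircle) :
    ∃ ρ, IsBoundedFreeConv μ μ ρ := by
  obtain ⟨p', hp1, hp2⟩ := exists_star_freeCopy p
  set q := (1 / 2 : ℂ) • (p + p') with hq
  have hsa : ∀ i, IsSelfAdjoint (freeCopy i q) := by
    intro i
    rw [hq, map_smul, map_add, hp1, isSelfAdjoint_iff, star_smul, star_add, star_star, add_comm]
    congr 1
    simp
  have hre : ∀ t, trigPolynomial q t = ((trigPolynomial p t).re : ℂ) := by
    intro t
    rw [hq, map_smul, map_add, hp2, Complex.re_eq_add_conj]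
    simp
    ring
  have hlaw : ∀ i, IsLawOf vacuumState (freeCopy i q) μ := by
    intro i n
    have hc : Continuous fun t => (trigPolynomial p t).re := by fun_prop
    constructor
    · rw [hμ]
      refine (integrable_map_measure (by fun_prop) hc.aemeasurable).2 ?_
      have hc' : Continuous fun t => (trigPolynomial p t).re ^ n := by fun_prop
      exact hc'.integrable_of_hasCompactSupport (HasCompactSupport.of_compactSpace _)
    · rw [← map_pow, vacuumState_freeCopy, hμ, integral_map hc.aemeasurable (by fun_prop),
        ← integral_complex_ofReal]
      congr 1 with t
      rw [map_pow, ContinuousMap.pow_apply, hre]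
      push_cast
      rfl
  obtain ⟨ρ, hρ⟩ := isState_vacuumState.exists_isLawOf ((hsa 0).add (hsa 1))
  exact ⟨ρ, _, inferInstance, vacuumState, freeCopy 0 q, freeCopy 1 q, isState_vacuumState, hsa 0,
    hsa 1, freeElements_freeCopy q q, hlaw 0, hlaw 1, hρ⟩

/-! ### Approximation of measures of finite variance -/

theorem exists_map_haarAddCircle_eq (μ : ProbabilityMeasure ℝ) :
    ∃ f : UnitAddCircle → ℝ, Measurable f ∧
      Measure.map f AddCircle.haarAddCircle = (μ : Measure ℝ) := by
  obtain ⟨f, hf, hfμ⟩ := (μ : Measure ℝ).exists_measurable_map_eq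
  have hhaar : (AddCircle.haarAddCircle : Measure UnitAddCircle) = volume := by
    rw [AddCircle.volume_eq_smul_haarAddCircle]
    simp
  have h1 := AddCircle.measurePreserving_equivIoc (T := 1) (a := 0)
  have hsub : Measurable (Subtype.val : Ioc (0 : ℝ) (0 + 1) → ℝ) := measurable_subtype_coe
  have hproj : Measurable (projIcc (0 : ℝ) 1 zero_le_one) := continuous_projIcc.measurable
  -- `projIcc` only serves to regard a point of `(0, 1]` as a point of the unit interval, where `f`
  -- is defined.
  refine ⟨fun t => f (projIcc 0 1 zero_le_one (AddCircle.equivIoc (1 : ℝ) 0 t : ℝ)),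
    hf.comp (hproj.comp (hsub.comp h1.measurable)), ?_⟩
  have h2 : Measure.map (fun t : UnitAddCircle => ((AddCircle.equivIoc (1 : ℝ) 0 t : ℝ)))
      AddCircle.haarAddCircle = volume.restrict (Ioc 0 1) := by
    rw [hhaar]
    change Measure.map (Subtype.val ∘ _) _ = _
    rw [← Measure.map_map hsub h1.measurable, h1.map_eq,
      (MeasurableEmbedding.subtype_coe measurableSet_Ioc).map_comap, Subtype.range_coe, zero_add]
  have h3 : Measure.map (Subtype.val : unitInterval → ℝ) volume = volume.restrict (Ioc 0 1) := by
    rw [unitInterval.volume_def, (MeasurableEmbedding.subtype_coe measurableSet_Icc).map_comap,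
      Subtype.range_coe]
    exact restrict_Ioc_eq_restrict_Icc.symm
  have h4 : (fun t => f (projIcc 0 1 zero_le_one (AddCircle.equivIoc (1 : ℝ) 0 t : ℝ))) =
      (f ∘ projIcc 0 1 zero_le_one) ∘
        fun t : UnitAddCircle => ((AddCircle.equivIoc (1 : ℝ) 0 t : ℝ)) := rfl
  rw [h4, ← Measure.map_map (hf.comp hproj) (by exact hsub.comp h1.measurable), h2, ← h3,
    Measure.map_map (hf.comp hproj) measurable_subtype_coe, ← hfμ]
  congr 1
  ext x
  simp

theorem exists_tendsto_trigPolynomial (F : Lp ℂ 2 (AddCircle.haarAddCircle (T := 1))) :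
    ∃ p : ℕ → MonoidAlgebra ℂ (Multiplicative ℤ),
      Tendsto (fun n => ContinuousMap.toLp (E := ℂ) 2 AddCircle.haarAddCircle ℂ
        (trigPolynomial (p n))) atTop (𝓝 F) := by
  have hle : Submodule.span ℂ (range (fourierLp (T := 1) 2)) ≤ LinearMap.range
      ((ContinuousMap.toLp (E := ℂ) 2 (AddCircle.haarAddCircle (T := 1)) ℂ).toLinearMap ∘ₗ
        trigPolynomial.toLinearMap) := by
    refine Submodule.span_le.2 ?_
    rintro _ ⟨n, rfl⟩
    refine ⟨MonoidAlgebra.of ℂ _ (Multiplicative.ofAdd n), ?_⟩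
    simp [trigPolynomial, fourierLp]
  have hF : F ∈ closure (Submodule.span ℂ (range (fourierLp (T := 1) 2)) : Set _) := by
    have h := span_fourierLp_closure_eq_top (T := 1) (p := 2) (by norm_num)
    have hF' : F ∈ (Submodule.span ℂ (range (fourierLp (T := 1) 2))).topologicalClosure := by
      rw [h]
      trivial
    exact hF'
  obtain ⟨u, hu, hlim⟩ := mem_closure_iff_seq_limit.1 hF
  choose p hp using fun n => hle (hu n)
  refine ⟨p, ?_⟩
  have : u = fun n => ContinuousMap.toLp (E := ℂ) 2 AddCircle.haarAddCircle ℂ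
      (trigPolynomial (p n)) := funext fun n => (hp n).symm
  rwa [this] at hlim

/-- Finite variance puts the function representing `μ` on the circle into `L²`, where Fourier
polynomials are dense. Convergence in `L²` gives convergence in measure, hence in distribution, and
this survives taking real parts. -/
theorem exists_isBoundedFreeConv_tendsto {μ : ProbabilityMeasure ℝ}
    (h2 : Integrable (fun x : ℝ => x ^ 2) (μ : Measure ℝ)) :
    ∃ μs ρs : ℕ → ProbabilityMeasure ℝ, (∀ n, IsBoundedFreeConv (μs n) (μs n) (ρs n)) ∧
      Tendsto μs atTop (𝓝 μ) := by
  obtain ⟨f, hf, hfμ⟩ := exists_map_haarAddCircle_eq μ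
  have hmem : MemLp (fun t => (f t : ℂ)) 2 AddCircle.haarAddCircle := by
    have h3 : MemLp (fun x : ℝ => x) 2 (Measure.map f AddCircle.haarAddCircle) := by
      rw [hfμ]
      exact (memLp_two_iff_integrable_sq (by fun_prop)).2 h2
    exact ((memLp_map_measure_iff (by fun_prop) hf.aemeasurable).1 h3).ofReal
  obtain ⟨p, hp⟩ := exists_tendsto_trigPolynomial hmem.toLp
  have hmeas : TendstoInMeasure AddCircle.haarAddCircle
      (fun n t => trigPolynomial (p n) t) atTop (fun t => (f t : ℂ)) := by
    refine (tendstoInMeasure_of_tendsto_Lp hp).congr (fun n => ?_) hmem.coeFn_toLp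
    exact ContinuousMap.coeFn_toLp _ _
  have hdist := (hmeas.tendstoInDistribution fun n =>
    (trigPolynomial (p n)).continuous.aemeasurable).continuous_comp Complex.continuous_re
  have hlim := hdist.tendsto
  have hμ : μ = ⟨Measure.map (Complex.re ∘ fun t => (f t : ℂ)) AddCircle.haarAddCircle,
      Measure.isProbabilityMeasure_map hdist.aemeasurable_limit⟩ := by
    apply Subtype.ext
    exact hfμ.symm
  rw [← hμ] at hlim
  choose ρs hρ using fun n => exists_isBoundedFreeConv_trigPolynomial (p n)
    (μ := ⟨Measure.map (Complex.re ∘ fun t => trigPolynomial (p n) t) AddCircle.haarAddCircle,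
      Measure.isProbabilityMeasure_map (hdist.forall_aemeasurable n)⟩) rfl
  exact ⟨_, ρs, hρ, hlim⟩

end FreeCLT

namespace FreeCLT

/-! ### Existence and continuity of the free additive convolution -/

/-- `Z` inverts `z ↦ z - selfEnergy μ z` on a truncated cone. -/
structure IsConeInverse (μ : ProbabilityMeasure ℝ) (b : ℝ) (Z : ℂ → ℂ) : Prop where
  pos : 0 < b
  tail_le : tailFunctional μ b ≤ 1 / 300
  differentiableOn : DifferentiableOn ℂ Z (truncatedCone b)
  mem_closedBall : ∀ w ∈ truncatedCone b, Z w ∈ Metric.closedBall w (w.im / 4)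
  sub_selfEnergy_eq : ∀ w ∈ truncatedCone b, Z w - selfEnergy μ (Z w) = w

theorem exists_isConeInverse {μ : ProbabilityMeasure ℝ} {b : ℝ} (hb : 0 < b)
    (hT : tailFunctional μ b ≤ 1 / 300) : ∃ Z, IsConeInverse μ b Z := by
  obtain ⟨Z, h1, h2⟩ := exists_inverse_of_cone hb hT
  exact ⟨Z, hb, hT, h1, fun w hw => (h2 w hw).1, fun w hw => (h2 w hw).2⟩

namespace IsConeInverse

variable {μ : ProbabilityMeasure ℝ} {b : ℝ} {Z : ℂ → ℂ}

theorem bounds (h : IsConeInverse μ b Z) {w : ℂ} (hw : w ∈ truncatedCone b) :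
    |(Z w).re| ≤ 2 * (Z w).im ∧ b ≤ (Z w).im ∧ 3 / 4 * w.im ≤ (Z w).im ∧ ‖Z w‖ ≤ 3 * w.im :=
  mem_cone_of_mem_closedBall h.pos hw (h.mem_closedBall w hw)

theorem eq_of_mem (h : IsConeInverse μ b Z) {w z : ℂ} (hw : w ∈ truncatedCone b)
    (hz : z ∈ Metric.closedBall w (w.im / 4)) (hzw : z - selfEnergy μ z = w) : z = Z w := by
  obtain ⟨h1, h2, -, -⟩ := mem_cone_of_mem_closedBall h.pos hw hz
  obtain ⟨h1', h2', -, -⟩ := h.bounds hw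
  exact eq_of_sub_eq_of_contraction (K := 1 / 2) (by norm_num)
    (norm_selfEnergy_sub_le_of_cone h.pos h1 h2 h1' h2' h.tail_le)
    (hzw.trans (h.sub_selfEnergy_eq w hw).symm)

end IsConeInverse

theorem im_pos_of_mem_truncatedCone {b : ℝ} (hb : 0 < b) {w : ℂ} (hw : w ∈ truncatedCone b) :
    0 < w.im := by linarith [hw.2]

section Pair

variable {μ ν ρ : ProbabilityMeasure ℝ} {b : ℝ} {Z₁ Z₂ : ℂ → ℂ}

theorem im_add_sub_ge (h₁ : IsConeInverse μ b Z₁) (h₂ : IsConeInverse ν b Z₂) {w : ℂ}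
    (hw : w ∈ truncatedCone b) : w.im / 2 ≤ (Z₁ w + Z₂ w - w).im := by
  have := (h₁.bounds hw).2.2.1
  have := (h₂.bounds hw).2.2.1
  simp only [Complex.sub_im, Complex.add_im]
  linarith

theorem im_add_sub_pos (h₁ : IsConeInverse μ b Z₁) (h₂ : IsConeInverse ν b Z₂) {w : ℂ}
    (hw : w ∈ truncatedCone b) : 0 < (Z₁ w + Z₂ w - w).im := by
  linarith [im_add_sub_ge h₁ h₂ hw, im_pos_of_mem_truncatedCone h₁.pos hw]

theorem exists_I_mul_mem_truncatedCone {b : ℝ} (hb : 0 < b) (M : ℝ) :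
    ∃ w ∈ truncatedCone b, M < w.im := by
  refine ⟨I * ((max (2 * b) M + 1 : ℝ) : ℂ), ⟨?_, ?_⟩, ?_⟩
  · simp
    positivity
  · simp only [Complex.mul_im, Complex.I_re, Complex.ofReal_im, Complex.I_im, Complex.ofReal_re]
    linarith [le_max_left (2 * b) M]
  · simp only [Complex.mul_im, Complex.I_re, Complex.ofReal_im, Complex.I_im, Complex.ofReal_re]
    linarith [le_max_right (2 * b) M]

/-- The algebraic computation applies only beyond a radius depending on the norms of the operators.
Analytic continuation extends it to a cone controlled by tails alone, which is what permits weak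
limits. -/
theorem IsBoundedFreeConv.cauchyTransform_eq (h : IsBoundedFreeConv μ ν ρ)
    (h₁ : IsConeInverse μ b Z₁) (h₂ : IsConeInverse ν b Z₂) {w : ℂ} (hw : w ∈ truncatedCone b) :
    cauchyTransform ρ (Z₁ w + Z₂ w - w) = 1 / w := by
  obtain ⟨M, hM⟩ := h.exists_cauchyTransform_add
  have hopen := isOpen_truncatedCone b
  have hne : ∀ w ∈ truncatedCone b, w ≠ 0 := fun w hw h0 => by
    have := im_pos_of_mem_truncatedCone h₁.pos hw
    simp [h0] at this
  have hf : AnalyticOnNhd ℂ (fun w => cauchyTransform ρ (Z₁ w + Z₂ w - w)) (truncatedCone b) := by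
    refine DifferentiableOn.analyticOnNhd (fun w hw => ?_) hopen
    have hd : DifferentiableWithinAt ℂ (fun w => Z₁ w + Z₂ w - w) (truncatedCone b) w :=
      ((h₁.differentiableOn w hw).add (h₂.differentiableOn w hw)).sub differentiableWithinAt_id
    exact (differentiableAt_cauchyTransform ρ
      (im_add_sub_pos h₁ h₂ hw).ne').comp_differentiableWithinAt
        (f := fun w => Z₁ w + Z₂ w - w) w hd
  have hg : AnalyticOnNhd ℂ (fun w : ℂ => 1 / w) (truncatedCone b) :=
    DifferentiableOn.analyticOnNhd (fun w hw => ((differentiableAt_const _).div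
      differentiableAt_id (hne w hw)).differentiableWithinAt) hopen
  obtain ⟨w₀, hw₀, hw₀M⟩ := exists_I_mul_mem_truncatedCone h₁.pos (2 * max M 0)
  refine hf.eqOn_of_preconnected_of_eventuallyEq hg (isPreconnected_truncatedCone b) hw₀ ?_ hw
  filter_upwards [hopen.mem_nhds hw₀,
    (isOpen_lt continuous_const Complex.continuous_im).mem_nhds hw₀M] with v hv hvM
  have hvM' : 2 * max M 0 < v.im := hvM
  have hlarge : ∀ z : ℂ, 3 / 4 * v.im ≤ z.im → M < ‖z‖ := fun z hz => by
    have := (le_abs_self z.im).trans (Complex.abs_im_le_norm z)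
    linarith [le_max_left M 0, le_max_right M 0]
  have e₁ := cauchyTransform_eq_of_sub_selfEnergy (h₁.sub_selfEnergy_eq v hv)
  have e₂ := cauchyTransform_eq_of_sub_selfEnergy (h₂.sub_selfEnergy_eq v hv)
  have := hM (Z₁ v) (Z₂ v) (hlarge _ (h₁.bounds hv).2.2.1) (hlarge _ (h₂.bounds hv).2.2.1)
    (e₁.trans e₂.symm)
  rw [e₁] at this
  simpa using this

theorem eq_of_cauchyTransform_comp_eq {ρ' : ProbabilityMeasure ℝ} (h₁ : IsConeInverse μ b Z₁)
    (h₂ : IsConeInverse ν b Z₂)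
    (h : ∀ w ∈ truncatedCone b, cauchyTransform ρ (Z₁ w + Z₂ w - w) = 1 / w)
    (h' : ∀ w ∈ truncatedCone b, cauchyTransform ρ' (Z₁ w + Z₂ w - w) = 1 / w) : ρ = ρ' := by
  obtain ⟨w₀, hw₀, -⟩ := exists_I_mul_mem_truncatedCone h₁.pos 0
  have hopen := isOpen_truncatedCone b
  have hmem := hopen.mem_nhds hw₀
  have hcont : ContinuousAt (fun w => Z₁ w + Z₂ w - w) w₀ :=
    ((h₁.differentiableOn.differentiableAt hmem).continuousAt.add
      (h₂.differentiableOn.differentiableAt hmem).continuousAt).sub continuousAt_id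
  refine eq_of_frequently_cauchyTransform_eq (im_add_sub_pos h₁ h₂ hw₀) ?_
  -- The image point determines `1/w` through the Cauchy transform, so the map is injective and its
  -- values accumulate at the value of `w₀`, as the identity theorem requires.
  have htend : Tendsto (fun w => Z₁ w + Z₂ w - w) (𝓝[≠] w₀) (𝓝[≠] (Z₁ w₀ + Z₂ w₀ - w₀)) := by
    refine tendsto_nhdsWithin_iff.2 ⟨hcont.tendsto.mono_left nhdsWithin_le_nhds, ?_⟩
    filter_upwards [nhdsWithin_le_nhds hmem, self_mem_nhdsWithin] with w hw hne heq
    apply hne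
    have e1 := h w hw
    rw [show Z₁ w + Z₂ w - w = Z₁ w₀ + Z₂ w₀ - w₀ from heq, h w₀ hw₀] at e1
    simpa using e1.symm
  refine htend.frequently (Eventually.frequently ?_)
  filter_upwards [nhdsWithin_le_nhds hmem] with w hw
  rw [h w hw, h' w hw]

/-! Tightness. -/

theorem integral_sq_div_eq (ρ : ProbabilityMeasure ℝ) {s : ℝ} (hs : 0 < s) :
    ∫ t : ℝ, t ^ 2 / (t ^ 2 + s ^ 2) ∂(ρ : Measure ℝ) =
      (1 - I * s * cauchyTransform ρ (I * s)).re := by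
  have hz : (I * (s : ℂ)).im ≠ 0 := by simpa using hs.ne'
  have h1 : 1 - I * s * cauchyTransform ρ (I * s) =
      ∫ t : ℝ, -((t : ℂ) * (1 / (I * s - (t : ℂ)))) ∂(ρ : Measure ℝ) := by
    rw [integral_neg, integral_mul_resolvent ρ hz, neg_sub]
  rw [h1]
  have h2 := integral_re (integrable_mul_resolvent ρ hz).neg
  refine Eq.trans ?_ h2
  congr 1 with t
  have h3 : (t : ℝ) ^ 2 + s ^ 2 ≠ 0 := by positivity
  have h4 := sub_ofReal_ne_zero hz t
  have h5 : -((t : ℂ) * (1 / (I * s - (t : ℂ)))) =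
      ((t ^ 2 / (t ^ 2 + s ^ 2) : ℝ) : ℂ) + ((t * s / (t ^ 2 + s ^ 2) : ℝ) : ℂ) * I := by
    have h6 : ((t : ℂ) ^ 2 + (s : ℂ) ^ 2) ≠ 0 := by exact_mod_cast h3
    push_cast
    field_simp
    linear_combination (-(t : ℂ) * s ^ 2) * Complex.I_sq
  simp only [Pi.neg_apply]
  rw [h5, RCLike.re_to_complex, Complex.add_re, Complex.ofReal_re, Complex.re_ofReal_mul,
    Complex.I_re, mul_zero, add_zero]

/-- The function `t²/(t² + s²)` is at least `1/2` for `|t| > s`, and its integral is the real part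
of `1 - is G(is)`. -/
theorem measureReal_abs_gt_le (ρ : ProbabilityMeasure ℝ) {s : ℝ} (hs : 0 < s) :
    (ρ : Measure ℝ).real {x | s < ‖x‖} ≤ 2 * ‖1 - I * s * cauchyTransform ρ (I * s)‖ := by
  have hi : Integrable (fun t : ℝ => t ^ 2 / (t ^ 2 + s ^ 2)) (ρ : Measure ℝ) := by
    have hc : Continuous fun t : ℝ => t ^ 2 / (t ^ 2 + s ^ 2) :=
      Continuous.div (by fun_prop) (by fun_prop) fun t => by positivity
    refine Integrable.of_bound hc.aestronglyMeasurable 1 (Eventually.of_forall fun t => ?_)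
    rw [Real.norm_of_nonneg (by positivity)]
    exact div_le_one_of_le₀ (by nlinarith [sq_nonneg s]) (by positivity)
  have h1 := mul_meas_ge_le_integral_of_nonneg (μ := (ρ : Measure ℝ))
    (f := fun t : ℝ => t ^ 2 / (t ^ 2 + s ^ 2)) (Eventually.of_forall fun t => by positivity) hi
    (1 / 2)
  rw [integral_sq_div_eq ρ hs] at h1
  have h2 : (ρ : Measure ℝ).real {x | s < ‖x‖} ≤
      (ρ : Measure ℝ).real {t : ℝ | 1 / 2 ≤ t ^ 2 / (t ^ 2 + s ^ 2)} := by
    refine measureReal_mono fun t ht => ?_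
    have ht' : s < |t| := ht
    have h3 : s ^ 2 < t ^ 2 := by
      rw [← sq_abs t]
      exact pow_lt_pow_left₀ ht' hs.le two_ne_zero
    change 1 / 2 ≤ t ^ 2 / (t ^ 2 + s ^ 2)
    rw [div_le_div_iff₀ two_pos (by positivity)]
    linarith
  have h4 := Complex.re_le_norm (1 - I * s * cauchyTransform ρ (I * s))
  linarith

theorem IsBoundedFreeConv.measureReal_abs_gt_le (h : IsBoundedFreeConv μ ν ρ) {s : ℝ}
    (hs : 0 < s) (hμ : tailFunctional μ s ≤ 1 / 300) (hν : tailFunctional ν s ≤ 1 / 300) :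
    (ρ : Measure ℝ).real {x | 3 * s < ‖x‖} ≤
      48 * (tailFunctional μ s + tailFunctional ν s) := by
  obtain ⟨Z₁, h₁⟩ := exists_isConeInverse hs hμ
  obtain ⟨Z₂, h₂⟩ := exists_isConeInverse hs hν
  have h3s : 0 < 3 * s := by linarith
  refine (FreeCLT.measureReal_abs_gt_le ρ h3s).trans ?_
  -- The truncated cone requires height above `2s`, whence `3s`. Each inverse moves `w` by at most
  -- `4 T · 3 · 3s`, with `T` the tail functional of its measure; as `Im ζ ≥ 3s/2`, the sum
  -- contributes the factor `24`, and the tail bound doubles it.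
  set w : ℂ := I * ((3 * s : ℝ) : ℂ) with hw
  have hwim : w.im = 3 * s := by simp [hw]
  have hwre : w.re = 0 := by simp [hw]
  have hwn : ‖w‖ = 3 * s := by
    rw [hw, norm_mul, norm_I, one_mul, Complex.norm_real, Real.norm_of_nonneg h3s.le]
  have hwc : w ∈ truncatedCone s := by
    refine ⟨?_, ?_⟩
    · rw [hwre, hwim, abs_zero]; exact h3s
    · rw [hwim]; linarith
  have hw0 : w ≠ 0 := fun h0 => by rw [h0] at hwn; simp at hwn; linarith
  have hclose : ∀ {κ : ProbabilityMeasure ℝ} {Z : ℂ → ℂ}, IsConeInverse κ s Z →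
      ‖Z w - w‖ ≤ 12 * tailFunctional κ s * (3 * s) := by
    intro κ Z hZ
    obtain ⟨g1, g2, -, g3⟩ := hZ.bounds hwc
    have e : Z w - w = selfEnergy κ (Z w) := by
      linear_combination hZ.sub_selfEnergy_eq w hwc
    rw [e]
    refine (norm_selfEnergy_le_of_cone hs g1 g2 hZ.tail_le).trans ?_
    rw [hwim] at g3
    nlinarith [tailFunctional_nonneg κ s]
  have hH := im_add_sub_ge h₁ h₂ hwc
  have hHpos := im_add_sub_pos h₁ h₂ hwc
  have heq := h.cauchyTransform_eq h₁ h₂ hwc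
  set ζ := Z₁ w + Z₂ w - w with hζ
  have hζw : ‖ζ - w‖ ≤ 12 * (tailFunctional μ s + tailFunctional ν s) * (3 * s) := by
    have : ζ - w = (Z₁ w - w) + (Z₂ w - w) := by rw [hζ]; ring
    rw [this]
    refine (norm_add_le _ _).trans ?_
    linarith [hclose h₁, hclose h₂]
  have h5 : 1 - w * cauchyTransform ρ w =
      w * (cauchyTransform ρ ζ - cauchyTransform ρ w) := by
    rw [heq, mul_sub, mul_one_div_cancel hw0]
  have h6 := norm_cauchyTransform_sub_le ρ (z := ζ) (w := w) hHpos.ne' (by rw [hwim]; exact h3s.ne')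
  rw [hwim] at h6 hH
  rw [h5, norm_mul, hwn]
  rw [abs_of_pos hHpos, abs_of_pos h3s] at h6
  have h7 : 3 * s * ‖cauchyTransform ρ ζ - cauchyTransform ρ w‖ ≤ ‖ζ - w‖ / ζ.im := by
    calc _ ≤ 3 * s * (‖ζ - w‖ / (ζ.im * (3 * s))) := by gcongr
      _ = _ := by field_simp
  have h8 : ‖ζ - w‖ / ζ.im ≤ 24 * (tailFunctional μ s + tailFunctional ν s) := by
    rw [div_le_iff₀ hHpos]
    have := tailFunctional_nonneg μ s
    have := tailFunctional_nonneg ν s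
    nlinarith
  linarith

end Pair

/-! ### Weak limits of bounded free convolutions -/

section Sequences

variable {μ ν : ProbabilityMeasure ℝ} {μs νs ρs : ℕ → ProbabilityMeasure ℝ}

theorem isTightMeasureSet_of_isBoundedFreeConv
    (h : ∀ n, IsBoundedFreeConv (μs n) (νs n) (ρs n)) (hμ : Tendsto μs atTop (𝓝 μ))
    (hν : Tendsto νs atTop (𝓝 ν)) :
    IsTightMeasureSet (Set.range fun n => (ρs n : Measure ℝ)) := by
  refine isTightMeasureSet_range_of_tendsto_limsup_measure_norm_gt ?_
  have hT : Tendsto (fun r : ℝ => ENNReal.ofReal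
      (48 * (tailFunctional μ (r / 3) + tailFunctional ν (r / 3)))) atTop (𝓝 0) := by
    have h1 : Tendsto (fun r : ℝ => r / 3) atTop atTop := tendsto_id.atTop_div_const (by norm_num)
    have h2 := (((tendsto_tailFunctional_atTop μ).comp h1).add
      ((tendsto_tailFunctional_atTop ν).comp h1)).const_mul 48
    have h3 := ENNReal.tendsto_ofReal h2
    simpa using h3
  refine tendsto_of_tendsto_of_tendsto_of_le_of_le' tendsto_const_nhds hT
    (Eventually.of_forall fun _ => zero_le) ?_
  have h1 : Tendsto (fun r : ℝ => r / 3) atTop atTop := tendsto_id.atTop_div_const (by norm_num)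
  filter_upwards [eventually_gt_atTop 0,
    ((tendsto_tailFunctional_atTop μ).comp h1).eventually_lt_const
      (show (0 : ℝ) < 1 / 300 by norm_num),
    ((tendsto_tailFunctional_atTop ν).comp h1).eventually_lt_const
      (show (0 : ℝ) < 1 / 300 by norm_num)] with r hr hr1 hr2
  have hr3 : 0 < r / 3 := by linarith
  have l1 := tendsto_tailFunctional hμ hr3
  have l2 := tendsto_tailFunctional hν hr3
  have hle : ∀ᶠ n in atTop, (ρs n : Measure ℝ) {x | r < ‖x‖} ≤
      ENNReal.ofReal (48 * (tailFunctional (μs n) (r / 3) + tailFunctional (νs n) (r / 3))) := by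
    filter_upwards [l1.eventually_lt_const hr1, l2.eventually_lt_const hr2] with n hn1 hn2
    have := (h n).measureReal_abs_gt_le hr3 hn1.le hn2.le
    rw [show 3 * (r / 3) = r by ring] at this
    rw [← ofReal_measureReal (measure_ne_top _ _)]
    exact ENNReal.ofReal_le_ofReal this
  refine (limsup_le_limsup hle).trans_eq ?_
  exact (ENNReal.tendsto_ofReal ((l1.add l2).const_mul 48)).limsup_eq

/-- Stability of fixed points: the distance of the inverses is at most twice the difference of the
self-energies at the single point `Z w`, where pointwise convergence is known. -/
theorem IsConeInverse.tendsto {b : ℝ} {Z : ℂ → ℂ} {Zs : ℕ → ℂ → ℂ} (hZ : IsConeInverse μ b Z)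
    (hμ : Tendsto μs atTop (𝓝 μ)) (hZs : ∀ᶠ n in atTop, IsConeInverse (μs n) b (Zs n)) {w : ℂ}
    (hw : w ∈ truncatedCone b) : Tendsto (fun n => Zs n w) atTop (𝓝 (Z w)) := by
  obtain ⟨h1, h2, -, -⟩ := hZ.bounds hw
  have him : (Z w).im ≠ 0 := by linarith [hZ.pos]
  have hlim := tendsto_selfEnergy hμ him
  rw [tendsto_iff_norm_sub_tendsto_zero] at hlim ⊢
  refine squeeze_zero' (Eventually.of_forall fun _ => norm_nonneg _) ?_
    (by simpa using hlim.mul_const (2 : ℝ))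
  filter_upwards [hZs] with n hn
  obtain ⟨h1', h2', -, -⟩ := hn.bounds hw
  have h3 := norm_sub_le_of_contraction (K := 1 / 2) (by norm_num)
    (norm_selfEnergy_sub_le_of_cone hn.pos h1' h2' h1 h2 hn.tail_le)
    (hn.sub_selfEnergy_eq w hw) (rfl : Z w - selfEnergy (μs n) (Z w) = _)
  refine h3.trans_eq ?_
  have h4 := hZ.sub_selfEnergy_eq w hw
  have h5 : w - (Z w - selfEnergy (μs n) (Z w)) =
      selfEnergy (μs n) (Z w) - selfEnergy μ (Z w) := by
    linear_combination -h4
  rw [h5]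
  ring

theorem cauchyTransform_eq_of_tendsto {ρ : ProbabilityMeasure ℝ} {b : ℝ} {Z₁ Z₂ : ℂ → ℂ}
    (h₁ : IsConeInverse μ b Z₁) (h₂ : IsConeInverse ν b Z₂) (hb₁ : tailFunctional μ b < 1 / 300)
    (hb₂ : tailFunctional ν b < 1 / 300)
    (h : ∀ n, IsBoundedFreeConv (μs n) (νs n) (ρs n)) (hμ : Tendsto μs atTop (𝓝 μ))
    (hν : Tendsto νs atTop (𝓝 ν)) (hρ : Tendsto ρs atTop (𝓝 ρ)) {w : ℂ}
    (hw : w ∈ truncatedCone b) : cauchyTransform ρ (Z₁ w + Z₂ w - w) = 1 / w := by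
  have hex : ∀ {κs : ℕ → ProbabilityMeasure ℝ} {κ : ProbabilityMeasure ℝ},
      Tendsto κs atTop (𝓝 κ) → tailFunctional κ b < 1 / 300 →
      ∃ Zs : ℕ → ℂ → ℂ, ∀ᶠ n in atTop, IsConeInverse (κs n) b (Zs n) := by
    intro κs κ hκ hb
    have : ∀ n, ∃ Z, tailFunctional (κs n) b < 1 / 300 → IsConeInverse (κs n) b Z := by
      intro n
      by_cases hn : tailFunctional (κs n) b < 1 / 300
      · obtain ⟨Z, hZ⟩ := exists_isConeInverse h₁.pos hn.le
        exact ⟨Z, fun _ => hZ⟩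
      · exact ⟨id, fun h => absurd h hn⟩
    choose Zs hZs using this
    refine ⟨Zs, ?_⟩
    filter_upwards [(tendsto_tailFunctional hκ h₁.pos).eventually_lt_const hb] with n hn
      using hZs n hn
  obtain ⟨Zs₁, hs₁⟩ := hex hμ hb₁
  obtain ⟨Zs₂, hs₂⟩ := hex hν hb₂
  have hlim := ((h₁.tendsto hμ hs₁ hw).add (h₂.tendsto hν hs₂ hw)).sub_const w
  have hpos := im_add_sub_pos h₁ h₂ hw
  have hwpos := im_pos_of_mem_truncatedCone h₁.pos hw
  have hG := tendsto_cauchyTransform hρ hpos.ne'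
  have hdiff : Tendsto (fun n => cauchyTransform (ρs n) (Z₁ w + Z₂ w - w) - 1 / w) atTop
      (𝓝 0) := by
    rw [tendsto_iff_norm_sub_tendsto_zero] at hlim
    have hlim' := hlim.div_const ((w.im / 2) * (w.im / 2))
    rw [zero_div] at hlim'
    refine squeeze_zero_norm' ?_ hlim'
    filter_upwards [hs₁, hs₂] with n hn₁ hn₂
    rw [← (h n).cauchyTransform_eq hn₁ hn₂ hw]
    refine (norm_cauchyTransform_sub_le _ hpos.ne' (im_add_sub_pos hn₁ hn₂ hw).ne').trans ?_
    rw [norm_sub_rev]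
    refine div_le_div₀ (norm_nonneg _) le_rfl (by positivity) (mul_le_mul ?_ ?_ (by positivity)
      (abs_nonneg _))
    · exact (im_add_sub_ge h₁ h₂ hw).trans (le_abs_self _)
    · exact (im_add_sub_ge hn₁ hn₂ hw).trans (le_abs_self _)
  have h0 := tendsto_nhds_unique (hG.sub_const (1 / w)) hdiff
  exact sub_eq_zero.1 h0

/-- Prokhorov's theorem applied to the tightness bound. -/
theorem exists_subseq_of_isBoundedFreeConv
    (h : ∀ n, IsBoundedFreeConv (μs n) (νs n) (ρs n)) (hμ : Tendsto μs atTop (𝓝 μ))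
    (hν : Tendsto νs atTop (𝓝 ν)) :
    ∃ (ρ : ProbabilityMeasure ℝ) (ms : ℕ → ℕ), StrictMono ms ∧
      Tendsto (ρs ∘ ms) atTop (𝓝 ρ) := by
  have ht := isTightMeasureSet_of_isBoundedFreeConv h hμ hν
  have hc : IsCompact (closure (range ρs)) := by
    refine isCompact_closure_of_isTightMeasureSet ?_
    convert ht using 1
    ext κ
    simp
  obtain ⟨ρ, -, ms, hms, hlim⟩ := hc.tendsto_subseq fun n => subset_closure (mem_range_self n)
  exact ⟨ρ, ms, hms, hlim⟩

end Sequences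

/-- The free additive convolution exists as soon as the measures can be approximated, and it is
determined by the additivity of the inverses of the reciprocal Cauchy transforms. -/
theorem exists_isFreeConv_of_approx {μ ν : ProbabilityMeasure ℝ}
    (happ : ∃ μs νs ρs : ℕ → ProbabilityMeasure ℝ,
      (∀ n, IsBoundedFreeConv (μs n) (νs n) (ρs n)) ∧
      Tendsto μs atTop (𝓝 μ) ∧ Tendsto νs atTop (𝓝 ν)) :
    ∃ ρ, IsFreeConv μ ν ρ ∧ ∃ (b : ℝ) (Z₁ Z₂ : ℂ → ℂ), IsConeInverse μ b Z₁ ∧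
      IsConeInverse ν b Z₂ ∧
      ∀ w ∈ truncatedCone b, cauchyTransform ρ (Z₁ w + Z₂ w - w) = 1 / w := by
  obtain ⟨b, hb, hb₁, hb₂⟩ : ∃ b : ℝ, 0 < b ∧ tailFunctional μ b < 1 / 300 ∧
      tailFunctional ν b < 1 / 300 :=
    ((eventually_gt_atTop 0).and
      (((tendsto_tailFunctional_atTop μ).eventually_lt_const (by norm_num)).and
      ((tendsto_tailFunctional_atTop ν).eventually_lt_const (by norm_num)))).exists
  obtain ⟨Z₁, h₁⟩ := exists_isConeInverse hb hb₁.le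
  obtain ⟨Z₂, h₂⟩ := exists_isConeInverse hb hb₂.le
  have key : ∀ μs νs ρs : ℕ → ProbabilityMeasure ℝ,
      (∀ n, IsBoundedFreeConv (μs n) (νs n) (ρs n)) → Tendsto μs atTop (𝓝 μ) →
      Tendsto νs atTop (𝓝 ν) → ∃ (ρ : ProbabilityMeasure ℝ) (ms : ℕ → ℕ),
        Tendsto (fun n => ρs (ms n)) atTop (𝓝 ρ) ∧
        ∀ w ∈ truncatedCone b, cauchyTransform ρ (Z₁ w + Z₂ w - w) = 1 / w := by
    intro μs νs ρs h hμ hν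
    obtain ⟨ρ, ms, hms, hlim⟩ := exists_subseq_of_isBoundedFreeConv h hμ hν
    exact ⟨ρ, ms, hlim, fun w hw => cauchyTransform_eq_of_tendsto h₁ h₂ hb₁ hb₂
      (fun n => h (ms n)) (hμ.comp hms.tendsto_atTop) (hν.comp hms.tendsto_atTop) hlim hw⟩
  obtain ⟨μs, νs, ρs, h, hμ, hν⟩ := happ
  obtain ⟨ρ, -, -, hρ⟩ := key μs νs ρs h hμ hν
  refine ⟨ρ, ⟨⟨μs, νs, ρs, h, hμ, hν⟩, ?_⟩, b, Z₁, Z₂, h₁, h₂, hρ⟩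
  intro μs νs ρs h hμ hν
  -- Every subsequence has a further subsequence converging to some limit, and the functional
  -- equation forces that limit to be `ρ`.
  refine tendsto_of_subseq_tendsto fun ns hns => ?_
  obtain ⟨ρ', ms, hlim, hρ'⟩ := key (fun n => μs (ns n)) (fun n => νs (ns n))
    (fun n => ρs (ns n)) (fun n => h (ns n)) (hμ.comp hns) (hν.comp hns)
  rw [eq_of_cauchyTransform_comp_eq h₁ h₂ hρ hρ']
  exact ⟨ms, hlim⟩

theorem IsFreeConv.unique {μ ν ρ ρ' : ProbabilityMeasure ℝ} (h : IsFreeConv μ ν ρ)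
    (h' : IsFreeConv μ ν ρ') : ρ = ρ' := by
  obtain ⟨μs, νs, ρs, hb, hμ, hν⟩ := h.exists_approx
  exact tendsto_nhds_unique (h.tendsto μs νs ρs hb hμ hν) (h'.tendsto μs νs ρs hb hμ hν)

theorem isFreeConv_freeConv {μ : ProbabilityMeasure ℝ}
    (h2 : Integrable (fun x : ℝ => x ^ 2) (μ : Measure ℝ)) : IsFreeConv μ μ (freeConv μ μ) := by
  obtain ⟨μs, ρs, h, hμ⟩ := exists_isBoundedFreeConv_tendsto h2
  obtain ⟨ρ, hρ, -⟩ := exists_isFreeConv_of_approx ⟨μs, μs, ρs, h, hμ, hμ⟩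
  exact Classical.epsilon_spec (p := IsFreeConv μ μ) ⟨ρ, hρ⟩

theorem cauchyTransform_freeConv_of_cone {μ : ProbabilityMeasure ℝ}
    (h2 : Integrable (fun x : ℝ => x ^ 2) (μ : Measure ℝ)) :
    ∃ (b : ℝ) (Z : ℂ → ℂ), IsConeInverse μ b Z ∧
      ∀ w ∈ truncatedCone b, cauchyTransform (freeConv μ μ) (Z w + Z w - w) = 1 / w := by
  obtain ⟨μs, ρs, h, hμ⟩ := exists_isBoundedFreeConv_tendsto h2
  obtain ⟨ρ, hρ, b, Z₁, Z₂, h₁, h₂, heq⟩ := exists_isFreeConv_of_approx ⟨μs, μs, ρs, h, hμ, hμ⟩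
  rw [hρ.unique (isFreeConv_freeConv h2)] at heq
  refine ⟨b, Z₁, h₁, fun w hw => ?_⟩
  -- The two inverses were chosen independently, but both solve the same contraction equation in the
  -- same ball.
  have : Z₂ w = Z₁ w := h₁.eq_of_mem hw (h₂.mem_closedBall w hw) (h₂.sub_selfEnergy_eq w hw)
  have h3 := heq w hw
  rwa [this] at h3

/-- If `a` and `a'` are free with law `μ`, then `(a + a') / √2` has law `renorm μ`. -/
theorem isLawOf_renorm {μ : ProbabilityMeasure ℝ}
    (h2 : Integrable (fun x : ℝ => x ^ 2) (μ : Measure ℝ)) {A : Type} [CStarAlgebra A]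
    {φ : A →ₗ[ℂ] ℂ} {a a' : A} (hφ : IsState φ) (ha : IsSelfAdjoint a) (ha' : IsSelfAdjoint a')
    (hfree : FreeElements φ a a') (hμ : IsLawOf φ a μ) (hμ' : IsLawOf φ a' μ) :
    IsLawOf φ (((1 / √2 : ℝ) : ℂ) • (a + a')) (renorm μ) := by
  obtain ⟨ρ, hρ⟩ := hφ.exists_isLawOf (ha.add ha')
  -- Continuity along constant sequences shows that the extension agrees with the bounded
  -- convolution.
  have hlim := (isFreeConv_freeConv h2).tendsto (fun _ => μ) (fun _ => μ) (fun _ => ρ)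
    (fun _ => ⟨A, _, φ, a, a', hφ, ha, ha', hfree, hμ, hμ', hρ⟩) tendsto_const_nhds
    tendsto_const_nhds
  have hρeq : ρ = freeConv μ μ := tendsto_nhds_unique tendsto_const_nhds hlim
  rw [hρeq] at hρ
  intro n
  obtain ⟨h3, h4⟩ := hρ n
  have hm : AEMeasurable (fun x : ℝ => x / √2) (freeConv μ μ : Measure ℝ) := by fun_prop
  have he : (renorm μ : Measure ℝ) = Measure.map (fun x : ℝ => x / √2) (freeConv μ μ) := rfl
  have h5 : (fun x : ℝ => (x / √2) ^ n) = fun x : ℝ => (1 / √2) ^ n * x ^ n := by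
    ext x
    rw [div_eq_mul_one_div, mul_pow, mul_comm]
  constructor
  · rw [he]
    refine (integrable_map_measure (by fun_prop) hm).2 ?_
    change Integrable (fun x : ℝ => (x / √2) ^ n) _
    rw [h5]
    exact h3.const_mul _
  · rw [he, integral_map hm (by fun_prop), h5, integral_const_mul, smul_pow, map_smul, h4]
    push_cast
    rfl

end FreeCLT

namespace FreeCLT

/-! ### The `R`-transform of a measure in `Q3` -/

section Q3

variable {μ ν : ProbabilityMeasure ℝ}

theorem integrable_sq_of_abs_pow_three
    (h3 : Integrable (fun x : ℝ => |x| ^ 3) (μ : Measure ℝ)) :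
    Integrable (fun x : ℝ => x ^ 2) (μ : Measure ℝ) := by
  refine ((integrable_const (1 : ℝ)).add h3).mono' (by fun_prop) (Eventually.of_forall fun x => ?_)
  rw [Real.norm_of_nonneg (by positivity), ← sq_abs]
  change _ ≤ 1 + |x| ^ 3
  nlinarith [mul_nonneg (abs_nonneg x) (sq_nonneg (|x| - 1)), sq_nonneg (|x| - 1), abs_nonneg x]

theorem integrable_sq_of_mem_Q3 (hμ : μ ∈ Q3) :
    Integrable (fun x : ℝ => x ^ 2) (μ : Measure ℝ) :=
  integrable_sq_of_abs_pow_three hμ.1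

theorem stdDev_of_mem_Q3 (hμ : μ ∈ Q3) : stdDev μ = 1 := by
  rw [stdDev, variance_eq_integral (by fun_prop), hμ.2.1]
  simp [hμ.2.2]

/-- Inversion maps a disc tangent to the real axis at `0` onto a half plane. The convention `1 / 0 =
0` makes the statement correct at `z = 0`, which lies on the boundary circle. -/
theorem mem_ball_iff_two_lt {z : ℂ} :
    z ∈ Metric.ball (I / 4) (1 / 4) ↔ 2 < -(1 / z).im := by
  rw [mem_ball_iff_norm, ← sq_lt_sq₀ (norm_nonneg _) (by norm_num), ← Complex.normSq_eq_norm_sq,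
    one_div z, Complex.inv_im, Complex.normSq_apply]
  have h1 : (z - I / 4).re = z.re := by simp
  have h2 : (z - I / 4).im = z.im - 1 / 4 := by simp
  rw [h1, h2]
  rcases eq_or_ne z 0 with rfl | hz
  · norm_num
  · rw [neg_div, neg_neg, lt_div_iff₀ (Complex.normSq_pos.2 hz), Complex.normSq_apply]
    constructor <;> intro h <;> nlinarith

theorem mem_ball_neg_iff_two_lt {z : ℂ} :
    z ∈ Metric.ball (-I / 4) (1 / 4) ↔ 2 < (1 / z).im := by
  have h := mem_ball_iff_two_lt (z := -z)
  rw [one_div_neg_eq_neg_one_div, Complex.neg_im, neg_neg] at h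
  rw [← h, mem_ball_iff_norm, mem_ball_iff_norm, ← norm_neg]
  ring_nf

theorem rDomain_one : rDomain 1 = {z : ℂ | 2 < |(1 / z).im|} := by
  ext z
  have h := mem_ball_iff_two_lt (z := z)
  have h' := mem_ball_neg_iff_two_lt (z := z)
  simp only [rDomain, Complex.ofReal_one, mul_one, mem_union, h, h']
  exact lt_abs.symm

theorem one_div_mem_rDomain {w : ℂ} : 1 / w ∈ rDomain 1 ↔ 2 < |w.im| := by
  rw [rDomain_one]
  change 2 < |(1 / (1 / w)).im| ↔ _
  rw [one_div_one_div]

theorem norm_selfEnergy_le_of_mem_Q3 (hμ : μ ∈ Q3) {z : ℂ} (hz : z.im ≠ 0) :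
    ‖selfEnergy μ z‖ ≤ 1 / |z.im| := by
  simpa [hμ.2.2] using norm_selfEnergy_le (integrable_sq_of_mem_Q3 hμ) hμ.2.1 hz

theorem norm_selfEnergy_sub_le_of_mem_Q3 (hμ : μ ∈ Q3) {c : ℝ} (hc : 0 < c) {z w : ℂ}
    (hz : c ≤ |z.im|) (hw : c ≤ |w.im|) :
    ‖selfEnergy μ z - selfEnergy μ w‖ ≤ 1 / c ^ 2 * ‖z - w‖ := by
  have hz' : z.im ≠ 0 := abs_pos.1 (hc.trans_le hz)
  have hw' : w.im ≠ 0 := abs_pos.1 (hc.trans_le hw)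
  refine (norm_selfEnergy_sub_le (integrable_sq_of_mem_Q3 hμ) hμ.2.1 hz' hw').trans ?_
  rw [hμ.2.2, sq]
  gcongr

theorem abs_im_sub_le_norm (z w : ℂ) : |w.im| - ‖z - w‖ ≤ |z.im| := by
  have h1 := Complex.abs_im_le_norm (w - z)
  rw [norm_sub_rev, Complex.sub_im] at h1
  linarith [abs_sub_abs_le_abs_sub w.im z.im]

/-- On the unit ball about `w` one has `|Im z| ≥ |Im w| - 1 > 1`, so the self-energy has norm at
most `1` and Lipschitz constant below `1`. -/
theorem exists_sub_selfEnergy_eq (hμ : μ ∈ Q3) {w : ℂ} (hw : 2 < |w.im|) :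
    ∃ z, ‖z - w‖ ≤ 1 ∧ z - selfEnergy μ z = w := by
  have him : ∀ z ∈ Metric.closedBall w 1, |w.im| - 1 ≤ |z.im| := fun z hz => by
    have := mem_closedBall_iff_norm.1 hz
    linarith [abs_im_sub_le_norm z w]
  have hK : 1 / (|w.im| - 1) ^ 2 < 1 := by
    rw [div_lt_one (by nlinarith)]
    nlinarith
  have hg : ∀ z ∈ Metric.closedBall w 1, ‖selfEnergy μ z‖ ≤ 1 := by
    intro z hz
    have h1 := him z hz
    have h2 : 0 < |z.im| := by linarith
    refine (norm_selfEnergy_le_of_mem_Q3 hμ (abs_pos.1 h2)).trans ?_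
    rw [div_le_one h2]
    linarith
  obtain ⟨z, hz, h⟩ := exists_sub_eq_of_contraction zero_le_one hK hg fun z hz z' hz' =>
    norm_selfEnergy_sub_le_of_mem_Q3 hμ (by linarith) (him z hz) (him z' hz')
  exact ⟨z, mem_closedBall_iff_norm.1 hz, h⟩

/-- The branch at infinity of the inverse of `z ↦ 1 / G_μ(z)`. -/
noncomputable def invRecipCauchy (μ : ProbabilityMeasure ℝ) (w : ℂ) : ℂ :=
  Classical.epsilon fun z => ‖z - w‖ ≤ 1 ∧ z - selfEnergy μ z = w

theorem norm_invRecipCauchy_sub_le_one (hμ : μ ∈ Q3) {w : ℂ} (hw : 2 < |w.im|) :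
    ‖invRecipCauchy μ w - w‖ ≤ 1 :=
  (Classical.epsilon_spec (exists_sub_selfEnergy_eq hμ hw)).1

theorem invRecipCauchy_sub_selfEnergy (hμ : μ ∈ Q3) {w : ℂ} (hw : 2 < |w.im|) :
    invRecipCauchy μ w - selfEnergy μ (invRecipCauchy μ w) = w :=
  (Classical.epsilon_spec (exists_sub_selfEnergy_eq hμ hw)).2

theorem selfEnergy_invRecipCauchy (hμ : μ ∈ Q3) {w : ℂ} (hw : 2 < |w.im|) :
    selfEnergy μ (invRecipCauchy μ w) = invRecipCauchy μ w - w := by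
  linear_combination -invRecipCauchy_sub_selfEnergy hμ hw

theorem abs_im_sub_one_le (hμ : μ ∈ Q3) {w : ℂ} (hw : 2 < |w.im|) :
    |w.im| - 1 ≤ |(invRecipCauchy μ w).im| := by
  linarith [abs_im_sub_le_norm (invRecipCauchy μ w) w, norm_invRecipCauchy_sub_le_one hμ hw]

theorem one_lt_abs_im_invRecipCauchy (hμ : μ ∈ Q3) {w : ℂ} (hw : 2 < |w.im|) :
    1 < |(invRecipCauchy μ w).im| := by
  linarith [abs_im_sub_one_le hμ hw]

theorem im_invRecipCauchy_ne_zero (hμ : μ ∈ Q3) {w : ℂ} (hw : 2 < |w.im|) :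
    (invRecipCauchy μ w).im ≠ 0 :=
  abs_pos.1 (zero_lt_one.trans (one_lt_abs_im_invRecipCauchy hμ hw))

theorem norm_invRecipCauchy_sub_le (hμ : μ ∈ Q3) {w : ℂ} (hw : 2 < |w.im|) :
    ‖invRecipCauchy μ w - w‖ ≤ 1 / (|w.im| - 1) := by
  rw [← selfEnergy_invRecipCauchy hμ hw]
  refine (norm_selfEnergy_le_of_mem_Q3 hμ (im_invRecipCauchy_ne_zero hμ hw)).trans ?_
  exact one_div_le_one_div_of_le (by linarith) (abs_im_sub_one_le hμ hw)

theorem cauchyTransform_invRecipCauchy (hμ : μ ∈ Q3) {w : ℂ} (hw : 2 < |w.im|) :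
    cauchyTransform μ (invRecipCauchy μ w) = 1 / w :=
  cauchyTransform_eq_of_sub_selfEnergy (invRecipCauchy_sub_selfEnergy hμ hw)

/-- The self-energy is a strict contraction between any two points with `|Im| > 1`, so solutions at
that height are unique even without closeness to `w`. -/
theorem eq_invRecipCauchy (hμ : μ ∈ Q3) {w z : ℂ} (hw : 2 < |w.im|) (hz : 1 < |z.im|)
    (h : cauchyTransform μ z = 1 / w) : z = invRecipCauchy μ w := by
  have h1 := one_lt_abs_im_invRecipCauchy hμ hw
  set c := min |z.im| |(invRecipCauchy μ w).im| with hc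
  have hc1 : 1 < c := lt_min hz h1
  refine eq_of_sub_eq_of_contraction (g := selfEnergy μ) (K := 1 / c ^ 2) ?_
    (norm_selfEnergy_sub_le_of_mem_Q3 hμ (by linarith) (min_le_left _ _) (min_le_right _ _)) ?_
  · rw [div_lt_one (by positivity)]
    nlinarith
  · rw [invRecipCauchy_sub_selfEnergy hμ hw, sub_selfEnergy, h, one_div_one_div]

theorem differentiableAt_invRecipCauchy (hμ : μ ∈ Q3) {w : ℂ} (hw : 2 < |w.im|) :
    DifferentiableAt ℂ (invRecipCauchy μ) w := by
  have hopen : ∀ c : ℝ, IsOpen {z : ℂ | c < |z.im|} := fun c =>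
    isOpen_lt continuous_const Complex.continuous_im.abs
  -- Then `c > 1` gives a contraction on `|Im| > c`, and `|Im w| = 2c > c + 1` leaves room for the
  -- displacement by at most `1`.
  set c := |w.im| / 2 with hc
  have hd : DifferentiableOn ℂ (invRecipCauchy μ) {z : ℂ | c + 1 < |z.im|} := by
    refine differentiableOn_of_contraction (g := selfEnergy μ) (V := {z : ℂ | c < |z.im|})
      (K := 1 / c ^ 2) ?_ (hopen _) (hopen _) (fun z hz => ?_) (fun z hz z' hz' => ?_)
      (fun v hv => ?_) (fun v hv => ?_)
    · rw [div_lt_one (by nlinarith)]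
      nlinarith
    · have hz' : c < |z.im| := hz
      exact differentiableAt_selfEnergy μ (abs_pos.1 (by linarith))
    · exact norm_selfEnergy_sub_le_of_mem_Q3 hμ (by linarith) (le_of_lt hz) (le_of_lt hz')
    · have hv' : c + 1 < |v.im| := hv
      have := abs_im_sub_one_le hμ (w := v) (by linarith)
      change c < _
      linarith
    · have hv' : c + 1 < |v.im| := hv
      exact invRecipCauchy_sub_selfEnergy hμ (by linarith)
  refine hd.differentiableAt ((hopen _).mem_nhds ?_)
  change c + 1 < |w.im|
  linarith

theorem ne_zero_of_mem_rDomain_one {z : ℂ} (hz : z ∈ rDomain 1) : z ≠ 0 := by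
  rintro rfl
  rw [rDomain_one] at hz
  have : (2 : ℝ) < |(1 / (0 : ℂ)).im| := hz
  norm_num at this

theorem isRTransform_invRecipCauchy (hμ : μ ∈ Q3) :
    IsRTransform μ (fun z => invRecipCauchy μ (1 / z) - 1 / z) := by
  have hdom : ∀ z ∈ rDomain 1, 2 < |(1 / z).im| := fun z hz => by rwa [rDomain_one] at hz
  refine ⟨?_, ?_, ?_, ?_⟩ <;> rw [stdDev_of_mem_Q3 hμ]
  · refine DifferentiableOn.analyticOnNhd (fun z hz => ?_)
      (Metric.isOpen_ball.union Metric.isOpen_ball)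
    have hz0 := ne_zero_of_mem_rDomain_one hz
    have h1 : DifferentiableAt ℂ (fun z : ℂ => 1 / z) z :=
      (differentiableAt_const _).div differentiableAt_id hz0
    exact (((differentiableAt_invRecipCauchy hμ (hdom z hz)).comp z h1).sub
      h1).differentiableWithinAt
  · intro z hz
    rw [sub_add_cancel]
    exact im_invRecipCauchy_ne_zero hμ (hdom z hz)
  · intro z hz
    rw [sub_add_cancel, cauchyTransform_invRecipCauchy hμ (hdom z hz), one_div_one_div]
  · refine squeeze_zero_norm' (a := fun z : ℂ => ‖z‖) ?_ ?_
    · filter_upwards [self_mem_nhdsWithin] with z hz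
      rw [norm_mul]
      exact mul_le_of_le_one_right (norm_nonneg _) (norm_invRecipCauchy_sub_le_one hμ (hdom z hz))
    · exact (continuous_norm.tendsto' (0 : ℂ) 0 norm_zero).mono_left nhdsWithin_le_nhds

/-- On a preconnected part of the domain having `0` as a limit point, a solution stays on the
branch at infinity. -/
theorem IsRTransform.one_lt_abs_im {R : ℂ → ℂ} (hμ : μ ∈ Q3) (hR : IsRTransform μ R) {B : Set ℂ}
    (hB : IsPreconnected B) (hsub : B ⊆ rDomain 1) {u : ℕ → ℝ}
    (hu0 : Tendsto (fun n => I * u n) atTop (𝓝 0)) (hu : ∀ n, I * u n ∈ B) {z : ℂ}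
    (hz : z ∈ B) : 1 < |(R z + 1 / z).im| := by
  obtain ⟨ha, hi, hG, h0⟩ := hR
  rw [stdDev_of_mem_Q3 hμ] at ha hi hG h0
  -- Height `1` is a barrier: there the self-energy has norm at most `1`, so `|Im (1/z)| ≤ 2`, which
  -- is false on the domain. By connectedness a solution stays on one side.
  have hne : ∀ z ∈ B, |(R z + 1 / z).im| ≠ 1 := by
    intro z hz h1
    have hw : 2 < |(1 / z).im| := by have := hsub hz; rwa [rDomain_one] at this
    have h2 := norm_selfEnergy_le_of_mem_Q3 hμ (hi z (hsub hz))
    have h3 := sub_selfEnergy μ (R z + 1 / z)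
    rw [hG z (hsub hz)] at h3
    rw [h1, div_one] at h2
    have h4 := abs_im_sub_le_norm (R z + 1 / z) (1 / z)
    have h5 : R z + 1 / z - 1 / z = selfEnergy μ (R z + 1 / z) := by linear_combination h3
    rw [h5] at h4
    linarith
  have hcont : ContinuousOn (fun z => |(R z + 1 / z).im|) B := by
    intro z hz
    have hz0 := ne_zero_of_mem_rDomain_one (hsub hz)
    have h1 : ContinuousAt (fun z => R z + 1 / z) z :=
      (ha z (hsub hz)).continuousAt.add (continuousAt_const.div continuousAt_id hz0)
    exact (Complex.continuous_im.continuousAt.comp h1).abs.continuousWithinAt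
  have himg := (hB.image _ hcont).ordConnected
  by_contra! hle
  have hu' : Tendsto (fun n => I * (u n : ℂ)) atTop (𝓝[rDomain 1] 0) :=
    tendsto_nhdsWithin_iff.2 ⟨hu0, Eventually.of_forall fun n => hsub (hu n)⟩
  have hR0 := (h0.comp hu').norm
  rw [norm_zero] at hR0
  -- The normalization `z R(z) → 0` decides the side: for small `z` on the imaginary axis `|R(z)| <
  -- 1/(2|z|)`, so the height exceeds `1/(2|z|) > 1`.
  obtain ⟨n, hn⟩ := (hR0.eventually_lt_const (show (0 : ℝ) < 1 / 2 by norm_num)).exists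
  simp only [Function.comp_apply] at hn
  have hne0 := ne_zero_of_mem_rDomain_one (hsub (hu n))
  have hun : 0 < ‖I * (u n : ℂ)‖ := norm_pos_iff.2 hne0
  have h2 : 2 < |(1 / (I * (u n : ℂ))).im| := by
    have := hsub (hu n); rwa [rDomain_one] at this
  have h4 := abs_im_sub_le_norm (R (I * u n) + 1 / (I * u n)) (1 / (I * u n))
  have h5 : |(1 / (I * (u n : ℂ))).im| = 1 / ‖I * (u n : ℂ)‖ := by
    have : (1 / (I * (u n : ℂ))) = ((-(1 / u n) : ℝ) : ℂ) * I := by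
      have hu1 : (u n : ℂ) ≠ 0 := right_ne_zero_of_mul hne0
      push_cast
      field_simp
      simp
    rw [this, Complex.im_ofReal_mul, Complex.I_im, mul_one, norm_mul, norm_I, one_mul, abs_neg,
      abs_div, abs_one, Complex.norm_real, Real.norm_eq_abs]
  rw [h5] at h2 h4
  rw [add_sub_cancel_right] at h4
  rw [norm_mul] at hn
  have h6 : ‖R (I * u n)‖ < 1 / 2 * (1 / ‖I * (u n : ℂ)‖) := by
    rw [mul_one_div, lt_div_iff₀ hun]
    linarith
  have h7 : 1 < |(R (I * u n) + 1 / (I * u n)).im| := by linarith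
  obtain ⟨x, hx, hx1⟩ := himg.out (mem_image_of_mem _ hz) (mem_image_of_mem _ (hu n)) ⟨hle, h7.le⟩
  exact hne x hx hx1

theorem tendsto_I_mul_natCast_inv (c : ℝ) :
    Tendsto (fun n : ℕ => I * ((c / (n + 3) : ℝ) : ℂ)) atTop (𝓝 0) := by
  have h : Tendsto (fun n : ℕ => c / ((n : ℝ) + 3)) atTop (𝓝 0) :=
    tendsto_const_nhds.div_atTop
      (tendsto_atTop_add_const_right _ _ tendsto_natCast_atTop_atTop)
  have h2 := ((Complex.continuous_ofReal.tendsto _).comp h).const_mul I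
  simpa [Function.comp_def] using h2

theorem one_div_I_mul_im (y : ℝ) : (1 / (I * (y : ℂ))).im = -(1 / y) := by
  rw [one_div, mul_inv, Complex.inv_I, ← Complex.ofReal_inv, Complex.im_mul_ofReal]
  simp

theorem IsRTransform.eqOn {R : ℂ → ℂ} (hμ : μ ∈ Q3) (hR : IsRTransform μ R) :
    EqOn R (fun z => invRecipCauchy μ (1 / z) - 1 / z) (rDomain 1) := by
  intro z hz
  have h1 : 1 < |(R z + 1 / z).im| := by
    have hz' := hz
    rcases hz' with h | h <;> simp only [Complex.ofReal_one, mul_one] at h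
    · refine hR.one_lt_abs_im hμ (convex_ball _ _).isPreconnected
        (fun v hv => Or.inl (by simpa using hv)) (tendsto_I_mul_natCast_inv (-1)) (fun n => ?_) h
      rw [mem_ball_neg_iff_two_lt, one_div_I_mul_im, neg_div, one_div_neg_eq_neg_one_div, neg_neg,
        one_div_one_div]
      linarith [n.cast_nonneg (α := ℝ)]
    · refine hR.one_lt_abs_im hμ (convex_ball _ _).isPreconnected
        (fun v hv => Or.inr (by simpa using hv)) (tendsto_I_mul_natCast_inv 1) (fun n => ?_) h
      rw [mem_ball_iff_two_lt, one_div_I_mul_im, neg_neg, one_div_one_div]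
      linarith [n.cast_nonneg (α := ℝ)]
  have h2 : 2 < |(1 / z).im| := by rwa [rDomain_one] at hz
  have h3 := hR.cauchy_eq z (by rwa [stdDev_of_mem_Q3 hμ])
  have h4 := eq_invRecipCauchy hμ h2 h1 (by rw [h3, one_div_one_div])
  change _ = invRecipCauchy μ (1 / z) - 1 / z
  rw [← h4, add_sub_cancel_right]

theorem isRTransform_rTransform (hμ : μ ∈ Q3) : IsRTransform μ (rTransform μ) :=
  Classical.epsilon_spec (p := IsRTransform μ) ⟨_, isRTransform_invRecipCauchy hμ⟩

theorem IsRTransform.eqOn_rTransform {R : ℂ → ℂ} (hμ : μ ∈ Q3) (hR : IsRTransform μ R) :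
    EqOn R (rTransform μ) (rDomain (stdDev μ)) := by
  rw [stdDev_of_mem_Q3 hμ]
  exact (hR.eqOn hμ).trans ((isRTransform_rTransform hμ).eqOn hμ).symm

theorem rTransform_one_div (hμ : μ ∈ Q3) {w : ℂ} (hw : 2 < |w.im|) :
    rTransform μ (1 / w) = invRecipCauchy μ w - w := by
  have := (isRTransform_rTransform hμ).eqOn hμ (one_div_mem_rDomain.2 hw)
  simpa using this

/-! ### The metric -/

theorem add_sq_mul_one_sub_eq (h3 : Integrable (fun x : ℝ => |x| ^ 3) (μ : Measure ℝ))
    (h0 : ∫ x : ℝ, x ∂(μ : Measure ℝ) = 0) {z : ℂ} (hz : z.im ≠ 0) :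
    ((∫ x : ℝ, x ^ 2 ∂(μ : Measure ℝ) : ℝ) : ℂ) + z ^ 2 * (1 - z * cauchyTransform μ z) =
      -∫ t : ℝ, (t : ℂ) ^ 3 * (1 / (z - (t : ℂ))) ∂(μ : Measure ℝ) := by
  have h2 := integrable_sq_of_abs_pow_three h3
  have h4 := sq_mul_cauchyTransform_sub h2 h0 hz
  have hi : Integrable (fun t : ℝ => (t : ℂ) ^ 3 * (1 / (z - (t : ℂ)))) (μ : Measure ℝ) := by
    refine (h3.mul_const (1 / |z.im|)).mono' (Continuous.aestronglyMeasurable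
      ((Complex.continuous_ofReal.pow 3).mul (continuous_resolvent hz)))
      (Eventually.of_forall fun t => ?_)
    rw [norm_mul, norm_pow, Complex.norm_real, Real.norm_eq_abs]
    exact mul_le_mul_of_nonneg_left (norm_resolvent_le hz t) (by positivity)
  have h5 : ∫ t : ℝ, (t : ℂ) ^ 2 * (z * (1 / (z - (t : ℂ)))) ∂(μ : Measure ℝ) =
      ((∫ x : ℝ, x ^ 2 ∂(μ : Measure ℝ) : ℝ) : ℂ) +
        ∫ t : ℝ, (t : ℂ) ^ 3 * (1 / (z - (t : ℂ))) ∂(μ : Measure ℝ) := by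
    rw [← integral_complex_ofReal, ← integral_add (by exact h2.ofReal) hi]
    congr 1 with t
    have := sub_ofReal_ne_zero hz t
    push_cast
    field_simp
    ring
  linear_combination -h4 - h5

theorem norm_add_sq_mul_one_sub_le (h3 : Integrable (fun x : ℝ => |x| ^ 3) (μ : Measure ℝ))
    (h0 : ∫ x : ℝ, x ∂(μ : Measure ℝ) = 0) {z : ℂ} (hz : z.im ≠ 0) :
    ‖((∫ x : ℝ, x ^ 2 ∂(μ : Measure ℝ) : ℝ) : ℂ) + z ^ 2 * (1 - z * cauchyTransform μ z)‖ ≤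
      (∫ x : ℝ, |x| ^ 3 ∂(μ : Measure ℝ)) / |z.im| := by
  rw [add_sq_mul_one_sub_eq h3 h0 hz, norm_neg, div_eq_mul_one_div, ← integral_mul_const]
  refine norm_integral_le_of_norm_le (h3.mul_const _) (Eventually.of_forall fun t => ?_)
  rw [norm_mul, norm_pow, Complex.norm_real, Real.norm_eq_abs]
  exact mul_le_mul_of_nonneg_left (norm_resolvent_le hz t) (by positivity)

/-- The second-order expansion `R(1/w) = 1/w + O(|w|⁻²)` on the imaginary axis. At the solution `z`
the third-moment remainder is `Q = 1 + z²(1 - z/w)`, of size `O(1/|s|)`; solving this relation for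
`z - w` leaves only quadratically small errors. -/
theorem norm_invRecipCauchy_sub_sub_le (hμ : μ ∈ Q3) :
    ∃ C : ℝ, 0 ≤ C ∧ ∀ s : ℝ, 4 ≤ |s| →
      ‖invRecipCauchy μ (I * s) - I * s - 1 / (I * s)‖ ≤ C / s ^ 2 := by
  set m := ∫ x : ℝ, |x| ^ 3 ∂(μ : Measure ℝ) with hm
  have hm0 : 0 ≤ m := integral_nonneg fun x => by positivity
  refine ⟨16 / 9 * (3 + 4 / 3 * m), by positivity, fun s hs => ?_⟩
  have him : (I * (s : ℂ)).im = s := by simp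
  have hnorm : ‖I * (s : ℂ)‖ = |s| := by simp
  have hw : 2 < |(I * (s : ℂ)).im| := by rw [him]; linarith
  have hs0 : s ≠ 0 := abs_pos.1 (by linarith)
  set w := I * (s : ℂ) with hwdef
  have hw0 : w ≠ 0 := by rw [← norm_pos_iff, hnorm]; linarith
  set z := invRecipCauchy μ w with hz
  have hzim : 3 / 4 * |s| ≤ |z.im| := by
    have := abs_im_sub_one_le hμ hw
    rw [him] at this
    linarith
  have hzn : 3 / 4 * |s| ≤ ‖z‖ := hzim.trans (Complex.abs_im_le_norm z)
  have hz0 : z ≠ 0 := by rw [← norm_pos_iff]; linarith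
  have hR : ‖z - w‖ ≤ 4 / 3 / |s| := by
    have := norm_invRecipCauchy_sub_le hμ hw
    rw [him] at this
    refine this.trans ?_
    rw [div_le_div_iff₀ (by linarith) (by linarith)]
    linarith
  have hQ := norm_add_sq_mul_one_sub_le hμ.1 hμ.2.1 (im_invRecipCauchy_ne_zero hμ hw)
  rw [hμ.2.2, Complex.ofReal_one, cauchyTransform_invRecipCauchy hμ hw] at hQ
  rw [← hz] at hQ
  set Q := 1 + z ^ 2 * (1 - z * (1 / w)) with hQdef
  have hQ' : ‖Q‖ ≤ 4 / 3 * m / |s| := by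
    refine hQ.trans ?_
    rw [div_le_div_iff₀ (by linarith) (by linarith)]
    nlinarith
  have hid : z - w - 1 / w = -((z - w) * (z - w + 2 * w) + Q * w ^ 2) / (w * z ^ 2) := by
    rw [hQdef]
    field_simp
    ring
  rw [hid, norm_div, norm_neg, norm_mul w, norm_pow, hnorm, ← sq_abs s]
  have h1 : ‖(z - w) * (z - w + 2 * w) + Q * w ^ 2‖ ≤ (3 + 4 / 3 * m) * |s| := by
    refine (norm_add_le _ _).trans ?_
    rw [norm_mul, norm_mul, norm_pow, hnorm]
    have h2 : ‖z - w + 2 * w‖ ≤ 9 / 4 * |s| := by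
      refine (norm_add_le _ _).trans ?_
      rw [norm_mul, hnorm, Complex.norm_ofNat]
      have := norm_invRecipCauchy_sub_le_one hμ hw
      linarith
    have h3 : ‖z - w‖ * ‖z - w + 2 * w‖ ≤ 4 / 3 / |s| * (9 / 4 * |s|) := by gcongr
    have h4 : 4 / 3 / |s| * (9 / 4 * |s|) = 3 := by field_simp; norm_num
    have h5 : ‖Q‖ * |s| ^ 2 ≤ 4 / 3 * m / |s| * |s| ^ 2 := by gcongr
    have h6 : 4 / 3 * m / |s| * |s| ^ 2 = 4 / 3 * m * |s| := by
      have : |s| ≠ 0 := abs_ne_zero.2 hs0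
      field_simp
    linarith
  have hsp : 0 < |s| := by linarith
  have h2 : 9 / 16 * |s| ^ 3 ≤ |s| * ‖z‖ ^ 2 := by
    have : (3 / 4 * |s|) ^ 2 ≤ ‖z‖ ^ 2 := by gcongr
    nlinarith
  rw [div_le_div_iff₀ (by positivity) (by positivity)]
  calc _ ≤ (3 + 4 / 3 * m) * |s| * |s| ^ 2 := by gcongr
    _ = 16 / 9 * (3 + 4 / 3 * m) * (9 / 16 * |s| ^ 3) := by ring
    _ ≤ _ := by gcongr

/-- For `y > 0` the point `iy` corresponds to `w = -i/y` in the lower half plane. -/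
theorem I_mul_eq_one_div (y : ℝ) : I * (y : ℂ) = 1 / (I * ((-(1 / y) : ℝ) : ℂ)) := by
  push_cast
  rw [one_div, mul_inv, Complex.inv_I, one_div, inv_neg, inv_inv]
  ring

theorem two_lt_abs_im_I_mul {y : ℝ} (hy : y ∈ Ioc (0 : ℝ) (1 / 4)) :
    4 ≤ |(-(1 / y) : ℝ)| ∧ 2 < |(I * ((-(1 / y) : ℝ) : ℂ)).im| := by
  have h1 : (4 : ℝ) ≤ 1 / y := by
    rw [le_div_iff₀ hy.1]
    linarith [hy.2]
  have h2 : (I * ((-(1 / y) : ℝ) : ℂ)).im = -(1 / y) := by simp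
  rw [h2, abs_neg, abs_of_nonneg (by linarith)]
  exact ⟨h1, by linarith⟩

theorem rTransform_I_mul (hμ : μ ∈ Q3) {y : ℝ} (hy : y ∈ Ioc (0 : ℝ) (1 / 4)) :
    rTransform μ (I * y) =
      invRecipCauchy μ (I * ((-(1 / y) : ℝ) : ℂ)) - I * ((-(1 / y) : ℝ) : ℂ) := by
  rw [I_mul_eq_one_div, rTransform_one_div hμ (two_lt_abs_im_I_mul hy).2]

theorem norm_rTransform_I_mul_sub_le (hμ : μ ∈ Q3) :
    ∃ C : ℝ, 0 ≤ C ∧ ∀ y ∈ Ioc (0 : ℝ) (1 / 4), ‖rTransform μ (I * y) - I * y‖ ≤ C * y ^ 2 := by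
  obtain ⟨C, hC, h⟩ := norm_invRecipCauchy_sub_sub_le hμ
  refine ⟨C, hC, fun y hy => ?_⟩
  have := h _ (two_lt_abs_im_I_mul hy).1
  rw [← I_mul_eq_one_div, ← rTransform_I_mul hμ hy] at this
  refine this.trans_eq ?_
  rw [neg_sq, div_pow, one_pow, div_div_eq_mul_div, div_one]

theorem rDist_ne_top (hμ : μ ∈ Q3) (hν : ν ∈ Q3) : rDist μ ν ≠ ⊤ := by
  obtain ⟨C, hC, h⟩ := norm_rTransform_I_mul_sub_le hμ
  obtain ⟨D, hD, h'⟩ := norm_rTransform_I_mul_sub_le hν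
  refine ne_top_of_le_ne_top (ENNReal.ofReal_ne_top (r := C + D)) ?_
  refine iSup₂_le fun y hy => ENNReal.ofReal_le_ofReal ?_
  have hy0 := hy.1
  rw [div_le_iff₀ (by positivity)]
  have h1 := norm_sub_le_norm_sub_add_norm_sub (rTransform ν (I * y)) (I * y) (rTransform μ (I * y))
  rw [norm_sub_rev (I * (y : ℂ))] at h1
  linarith [h y hy, h' y hy]

theorem rDist_comm (μ ν : ProbabilityMeasure ℝ) : rDist μ ν = rDist ν μ := by
  unfold rDist
  simp_rw [norm_sub_rev]

theorem rDist_triangle (μ ν κ : ProbabilityMeasure ℝ) : rDist μ κ ≤ rDist μ ν + rDist ν κ := by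
  refine iSup₂_le fun y hy => ?_
  have hy0 := hy.1
  have h1 := norm_sub_le_norm_sub_add_norm_sub (rTransform κ (I * y)) (rTransform ν (I * y))
    (rTransform μ (I * y))
  calc _ ≤ ENNReal.ofReal (‖rTransform ν (I * y) - rTransform μ (I * y)‖ / y ^ 2 +
        ‖rTransform κ (I * y) - rTransform ν (I * y)‖ / y ^ 2) := by
        rw [← add_div]
        refine ENNReal.ofReal_le_ofReal ?_
        gcongr
        linarith
    _ = ENNReal.ofReal (‖rTransform ν (I * y) - rTransform μ (I * y)‖ / y ^ 2) +
        ENNReal.ofReal (‖rTransform κ (I * y) - rTransform ν (I * y)‖ / y ^ 2) :=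
        ENNReal.ofReal_add (by positivity) (by positivity)
    _ ≤ _ := add_le_add
      (le_iSup₂ (f := fun (y : ℝ) (_ : y ∈ Ioc (0 : ℝ) (1 / 4)) =>
        ENNReal.ofReal (‖rTransform ν (I * y) - rTransform μ (I * y)‖ / y ^ 2)) y hy)
      (le_iSup₂ (f := fun (y : ℝ) (_ : y ∈ Ioc (0 : ℝ) (1 / 4)) =>
        ENNReal.ofReal (‖rTransform κ (I * y) - rTransform ν (I * y)‖ / y ^ 2)) y hy)

theorem rDist_self (μ : ProbabilityMeasure ℝ) : rDist μ μ = 0 := by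
  simp [rDist]

theorem rTransform_eq_of_rDist_eq_zero (h : rDist μ ν = 0) {y : ℝ} (hy : y ∈ Ioc (0 : ℝ) (1 / 4)) :
    rTransform μ (I * y) = rTransform ν (I * y) := by
  have h1 := ENNReal.iSup_eq_zero.1 (ENNReal.iSup_eq_zero.1 h y) hy
  rw [ENNReal.ofReal_eq_zero] at h1
  have hy0 := hy.1
  have h2 : ‖rTransform ν (I * y) - rTransform μ (I * y)‖ ≤ 0 := by
    by_contra! hc
    have : 0 < ‖rTransform ν (I * y) - rTransform μ (I * y)‖ / y ^ 2 := by positivity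
    linarith
  exact (sub_eq_zero.1 (norm_le_zero_iff.1 h2)).symm

theorem eq_of_rDist_eq_zero (hμ : μ ∈ Q3) (hν : ν ∈ Q3) (h : rDist μ ν = 0) : μ = ν := by
  -- The metric sees the branch in the lower half plane; conjugation moves it to the upper one,
  -- where the identity theorem is stated. Equal `R`-transforms make both Cauchy transforms equal to
  -- `1/(is)` along the curve `Z`.
  set Z : ℝ → ℂ := fun s => starRingEnd ℂ (invRecipCauchy μ (I * ((-s : ℝ) : ℂ))) with hZ
  have hlt : ∀ s : ℝ, 4 < s → 2 < |(I * ((-s : ℝ) : ℂ)).im| := fun s hs => by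
    have h1 : (I * ((-s : ℝ) : ℂ)).im = -s := by simp
    rw [h1, abs_neg]
    linarith [le_abs_self s]
  have hGμ : ∀ s : ℝ, 4 < s → cauchyTransform μ (Z s) = 1 / (I * s) := fun s hs => by
    rw [hZ]
    simp only
    rw [cauchyTransform_conj, cauchyTransform_invRecipCauchy hμ (hlt s hs)]
    simp
  have hGν : ∀ s : ℝ, 4 < s → cauchyTransform ν (Z s) = 1 / (I * s) := fun s hs => by
    have hy : 1 / s ∈ Ioc (0 : ℝ) (1 / 4) :=
      ⟨by positivity, one_div_le_one_div_of_le (by norm_num) hs.le⟩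
    have h1 := rTransform_eq_of_rDist_eq_zero h hy
    rw [rTransform_I_mul hμ hy, rTransform_I_mul hν hy, sub_left_inj, one_div_one_div] at h1
    rw [hZ]
    simp only
    rw [h1, cauchyTransform_conj, cauchyTransform_invRecipCauchy hν (hlt s hs)]
    simp
  have h8 : (4 : ℝ) < 8 := by norm_num
  have hcont : ContinuousAt Z 8 := by
    have h1 : ContinuousAt (fun s : ℝ => I * ((-s : ℝ) : ℂ)) 8 := by fun_prop
    have h2 := (differentiableAt_invRecipCauchy hμ (hlt 8 h8)).continuousAt
    exact Complex.continuous_conj.continuousAt.comp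
      (ContinuousAt.comp (f := fun s : ℝ => I * ((-s : ℝ) : ℂ)) h2 h1)
  have h4 : ∀ᶠ s : ℝ in 𝓝[≠] 8, 4 < s := nhdsWithin_le_nhds (lt_mem_nhds h8)
  have htend : Tendsto Z (𝓝[≠] 8) (𝓝[≠] (Z 8)) := by
    refine tendsto_nhdsWithin_iff.2 ⟨hcont.tendsto.mono_left nhdsWithin_le_nhds, ?_⟩
    filter_upwards [h4, self_mem_nhdsWithin] with s hs hne heq
    apply hne
    have e1 := hGμ s hs
    rw [show Z s = Z 8 from heq, hGμ 8 h8] at e1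
    have e2 : ((8 : ℝ) : ℂ) = (s : ℂ) := by simpa using e1
    exact_mod_cast e2.symm
  have hpos : 0 < (Z 8).im := by
    have h1 := norm_invRecipCauchy_sub_le_one hμ (hlt 8 h8)
    have h2 := (Complex.abs_im_le_norm _).trans h1
    have h3 := (abs_le.1 h2).2
    have h4 : (I * ((-8 : ℝ) : ℂ)).im = -8 := by simp
    rw [Complex.sub_im, h4] at h3
    rw [hZ, Complex.conj_im]
    linarith
  refine eq_of_frequently_cauchyTransform_eq hpos (htend.frequently (Eventually.frequently ?_))
  filter_upwards [h4] with s hs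
  rw [hGμ s hs, hGν s hs]

end Q3

end FreeCLT

namespace FreeCLT

/-! ### Moments from bounds on regularized moments -/

section Moments

variable {μ ρ : ProbabilityMeasure ℝ}

theorem tendsto_sq_mul_div_add (x c : ℝ) :
    Tendsto (fun n : ℕ => ((n : ℝ) + c) ^ 2 * (x ^ 2 / (x ^ 2 + ((n : ℝ) + c) ^ 2))) atTop
      (𝓝 (x ^ 2)) := by
  have h1 : Tendsto (fun n : ℕ => ((n : ℝ) + c) ^ 2) atTop atTop :=
    (tendsto_pow_atTop two_ne_zero).comp
      (tendsto_atTop_add_const_right _ _ tendsto_natCast_atTop_atTop)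
  have h2 : Tendsto (fun u : ℝ => u * (x ^ 2 / (x ^ 2 + u))) atTop (𝓝 (x ^ 2)) := by
    have h3 : Tendsto (fun u : ℝ => x ^ 2 - x ^ 4 / (x ^ 2 + u)) atTop (𝓝 (x ^ 2 - 0)) :=
      tendsto_const_nhds.sub (tendsto_const_nhds.div_atTop
        (tendsto_atTop_add_const_left _ _ tendsto_id))
    rw [sub_zero] at h3
    refine h3.congr' ?_
    filter_upwards [eventually_gt_atTop 0] with u hu
    have : x ^ 2 + u ≠ 0 := by positivity
    field_simp
    ring
  exact h2.comp h1

theorem integrable_sq_div_add (ρ : ProbabilityMeasure ℝ) {s : ℝ} (hs : 0 < s) :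
    Integrable (fun t : ℝ => t ^ 2 / (t ^ 2 + s ^ 2)) (ρ : Measure ℝ) := by
  refine Integrable.of_bound (Continuous.aestronglyMeasurable
    ((continuous_pow 2).div (by fun_prop) fun t => by positivity)) 1
    (Eventually.of_forall fun t => ?_)
  rw [Real.norm_of_nonneg (by positivity)]
  exact div_le_one_of_le₀ (by nlinarith) (by positivity)

/-- Fatou's lemma: `s² t²/(t² + s²)` tends to `t²` as `s → ∞`, with integrals bounded by `C`. -/
theorem integrable_sq_of_regularized_le {S C : ℝ} (hS : 0 < S)
    (h : ∀ s, S ≤ s → s ^ 2 * (1 - I * s * cauchyTransform ρ (I * s)).re ≤ C) :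
    Integrable (fun x : ℝ => x ^ 2) (ρ : Measure ℝ) := by
  refine integrable_of_tendsto (Eventually.of_forall fun x => tendsto_sq_mul_div_add x S)
    (fun n => (Integrable.const_mul (integrable_sq_div_add ρ (by positivity)) _).1) ?_
  refine ne_top_of_le_ne_top (ENNReal.ofReal_ne_top (r := C)) (liminf_le_of_frequently_le'
    (Frequently.of_forall fun n => ?_))
  have hn : 0 < (n : ℝ) + S := by positivity
  have h1 := h (n + S) (by linarith [n.cast_nonneg (α := ℝ)])
  rw [← integral_sq_div_eq ρ hn, ← integral_const_mul] at h1
  refine le_trans ?_ (ENNReal.ofReal_le_ofReal h1)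
  rw [ofReal_integral_eq_lintegral_ofReal ((integrable_sq_div_add ρ hn).const_mul _)
    (Eventually.of_forall fun x => by positivity)]
  refine lintegral_mono fun x => ?_
  rw [Real.enorm_of_nonneg (by positivity)]

theorem integrable_pow_four_div_add (h2 : Integrable (fun x : ℝ => x ^ 2) (ρ : Measure ℝ)) {s : ℝ}
    (hs : 0 < s) : Integrable (fun t : ℝ => t ^ 4 / (t ^ 2 + s ^ 2)) (ρ : Measure ℝ) := by
  refine h2.mono' (Continuous.aestronglyMeasurable
    ((continuous_pow 4).div (by fun_prop) fun t => by positivity))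
    (Eventually.of_forall fun t => ?_)
  rw [Real.norm_of_nonneg (by positivity), div_le_iff₀ (by positivity)]
  nlinarith [mul_nonneg (sq_nonneg t) (sq_nonneg s)]

theorem integral_pow_four_div_eq (h2 : Integrable (fun x : ℝ => x ^ 2) (ρ : Measure ℝ)) {s : ℝ}
    (hs : 0 < s) :
    ∫ t : ℝ, t ^ 4 / (t ^ 2 + s ^ 2) ∂(ρ : Measure ℝ) = ∫ t : ℝ, t ^ 2 ∂(ρ : Measure ℝ) +
      ((I * s) ^ 2 * (1 - I * s * cauchyTransform ρ (I * s))).re := by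
  have h3 : (I * (s : ℂ)) ^ 2 = ((-s ^ 2 : ℝ) : ℂ) := by
    rw [mul_pow, Complex.I_sq]
    push_cast
    ring
  rw [h3, Complex.re_ofReal_mul, ← integral_sq_div_eq ρ hs, ← integral_const_mul,
    ← integral_add h2 ((integrable_sq_div_add ρ hs).const_mul _)]
  congr 1 with t
  have : t ^ 2 + s ^ 2 ≠ 0 := by positivity
  field_simp
  ring

theorem ofReal_abs_pow_three_le {S : ℝ} (hS : 0 < S) (x : ℝ) :
    ENNReal.ofReal (|x| ^ 3) ≤ ENNReal.ofReal (S ^ 3) +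
      ENNReal.ofReal 5 * ∫⁻ s in Ioi S, ENNReal.ofReal (x ^ 4 / (x ^ 2 + s ^ 2)) := by
  rcases le_or_gt |x| S with hx | hx
  · refine le_add_right (ENNReal.ofReal_le_ofReal ?_)
    gcongr
  · refine le_add_left ?_
    have hx0 : 0 < |x| := hS.trans hx
    -- For `|x| < s ≤ 2|x|` the integrand is at least `x⁴/(5x²)`, on an interval of length `|x|`.
    have h1 : ENNReal.ofReal (x ^ 2 / 5) * volume (Ioc |x| (2 * |x|)) ≤
        ∫⁻ s in Ioi S, ENNReal.ofReal (x ^ 4 / (x ^ 2 + s ^ 2)) := by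
      rw [← setLIntegral_const]
      refine (setLIntegral_mono' measurableSet_Ioc fun s hs => ?_).trans
        (lintegral_mono_set fun s hs => hx.trans hs.1)
      refine ENNReal.ofReal_le_ofReal ?_
      have h2 : s ^ 2 ≤ 4 * x ^ 2 := by
        rw [← sq_abs x]
        nlinarith [hs.1, hs.2]
      have h3 : 0 < x ^ 2 := by rw [← sq_abs]; positivity
      rw [div_le_div_iff₀ (by norm_num) (by positivity)]
      nlinarith
    refine le_trans (le_of_eq ?_) (mul_le_mul_right h1 _)
    rw [Real.volume_Ioc, ← ENNReal.ofReal_mul (by positivity),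
      ← ENNReal.ofReal_mul (by positivity), ← sq_abs x]
    congr 1
    ring

theorem lintegral_pow_four_div_le (S x : ℝ) :
    ∫⁻ s in Ioi S, ENNReal.ofReal (x ^ 4 / (x ^ 2 + s ^ 2)) ≤
      ENNReal.ofReal (Real.pi * |x| ^ 3) := by
  rcases eq_or_ne x 0 with rfl | hx
  · simp
  refine (setLIntegral_le_lintegral _ _).trans ?_
  have h1 : ∀ s : ℝ, x ^ 4 / (x ^ 2 + s ^ 2) = x ^ 2 * (1 + (s / x) ^ 2)⁻¹ := by
    intro s
    have h2 : x ^ 2 + s ^ 2 ≠ 0 := by positivity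
    field_simp
  have hi : Integrable fun s : ℝ => x ^ 2 * (1 + (s / x) ^ 2)⁻¹ :=
    (integrable_inv_one_add_sq.comp_div hx).const_mul _
  simp_rw [h1]
  rw [← ofReal_integral_eq_lintegral_ofReal hi (Eventually.of_forall fun s => by positivity),
    integral_const_mul, Measure.integral_comp_div (fun s : ℝ => (1 + s ^ 2)⁻¹),
    integral_univ_inv_one_add_sq, smul_eq_mul, ← sq_abs]
  refine le_of_eq ?_
  congr 1
  ring

theorem lintegral_pow_four_div_swap (ρ : ProbabilityMeasure ℝ) (S : ℝ) :
    ∫⁻ x : ℝ, (∫⁻ s in Ioi S, ENNReal.ofReal (x ^ 4 / (x ^ 2 + s ^ 2))) ∂(ρ : Measure ℝ) =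
      ∫⁻ s in Ioi S, ∫⁻ x : ℝ, ENNReal.ofReal (x ^ 4 / (x ^ 2 + s ^ 2)) ∂(ρ : Measure ℝ) := by
  refine lintegral_lintegral_swap ?_
  unfold Function.uncurry
  fun_prop

/-- Integrating `t⁴/(t² + s²)` over `s > S` gives at most `π|t|³`, and at least `|t|³/5` when `|t| >
S`. By Tonelli the hypothesis integrated in `s` transfers the third moment from `μ` to `ρ`; the
error `C/s²` is integrable at infinity. -/
theorem integrable_abs_pow_three_of_regularized_le {S C : ℝ} (hS : 0 < S)
    (h2 : Integrable (fun x : ℝ => x ^ 2) (ρ : Measure ℝ))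
    (h3 : Integrable (fun x : ℝ => |x| ^ 3) (μ : Measure ℝ))
    (h : ∀ s, S < s → ∫ t : ℝ, t ^ 4 / (t ^ 2 + s ^ 2) ∂(ρ : Measure ℝ) ≤
      2 * ∫ t : ℝ, t ^ 4 / (t ^ 2 + s ^ 2) ∂(μ : Measure ℝ) + C / s ^ 2) :
    Integrable (fun x : ℝ => |x| ^ 3) (ρ : Measure ℝ) := by
  have hμ2 := integrable_sq_of_abs_pow_three h3
  have hq : ∀ {κ : ProbabilityMeasure ℝ}, Integrable (fun x : ℝ => x ^ 2) (κ : Measure ℝ) →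
      ∀ s, S < s → ∫⁻ x : ℝ, ENNReal.ofReal (x ^ 4 / (x ^ 2 + s ^ 2)) ∂(κ : Measure ℝ) =
        ENNReal.ofReal (∫ t : ℝ, t ^ 4 / (t ^ 2 + s ^ 2) ∂(κ : Measure ℝ)) := fun hκ s hs =>
    (ofReal_integral_eq_lintegral_ofReal (integrable_pow_four_div_add hκ (hS.trans hs))
      (Eventually.of_forall fun x => by positivity)).symm
  have hfin : ∫⁻ s in Ioi S, ENNReal.ofReal (|C| / s ^ 2) < ⊤ := by
    have hi : IntegrableOn (fun s : ℝ => |C| / s ^ 2) (Ioi S) := by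
      refine IntegrableOn.congr_fun
        ((integrableOn_Ioi_rpow_of_lt (a := -2) (by norm_num) hS).const_mul |C|)
        (fun s hs => ?_) measurableSet_Ioi
      have hs0 : 0 < s := hS.trans hs
      change |C| * s ^ (-2 : ℝ) = |C| / s ^ 2
      rw [Real.rpow_neg hs0.le, div_eq_mul_inv]
      norm_cast
    rw [← ofReal_integral_eq_lintegral_ofReal hi (Eventually.of_forall fun s => by positivity)]
    exact ENNReal.ofReal_lt_top
  have hμfin : ∫⁻ s in Ioi S, ∫⁻ x : ℝ, ENNReal.ofReal (x ^ 4 / (x ^ 2 + s ^ 2)) ∂(μ : Measure ℝ)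
      < ⊤ := by
    rw [← lintegral_pow_four_div_swap μ S]
    refine (lintegral_mono fun x => lintegral_pow_four_div_le S x).trans_lt ?_
    rw [← ofReal_integral_eq_lintegral_ofReal (h3.const_mul _)
      (Eventually.of_forall fun s => by positivity)]
    exact ENNReal.ofReal_lt_top
  have hρfin : ∫⁻ s in Ioi S, ∫⁻ x : ℝ, ENNReal.ofReal (x ^ 4 / (x ^ 2 + s ^ 2)) ∂(ρ : Measure ℝ)
      < ⊤ := by
    have hle : ∫⁻ s in Ioi S, ∫⁻ x : ℝ, ENNReal.ofReal (x ^ 4 / (x ^ 2 + s ^ 2)) ∂(ρ : Measure ℝ) ≤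
        ∫⁻ s in Ioi S, (ENNReal.ofReal 2 *
          ∫⁻ x : ℝ, ENNReal.ofReal (x ^ 4 / (x ^ 2 + s ^ 2)) ∂(μ : Measure ℝ) +
            ENNReal.ofReal (|C| / s ^ 2)) := by
      refine setLIntegral_mono' measurableSet_Ioi fun s hs => ?_
      rw [hq h2 s hs, hq hμ2 s hs, ← ENNReal.ofReal_mul (by norm_num),
        ← ENNReal.ofReal_add (mul_nonneg zero_le_two (integral_nonneg fun x => by positivity))
          (by positivity)]
      refine ENNReal.ofReal_le_ofReal ((h s hs).trans ?_)
      gcongr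
      exact le_abs_self C
    refine hle.trans_lt ?_
    rw [lintegral_add_right _ (by fun_prop), lintegral_const_mul' _ _ ENNReal.ofReal_ne_top]
    exact ENNReal.add_lt_top.2 ⟨ENNReal.mul_lt_top ENNReal.ofReal_lt_top hμfin, hfin⟩
  refine ⟨by fun_prop, ?_⟩
  rw [hasFiniteIntegral_iff_ofReal (Eventually.of_forall fun x => by positivity)]
  refine (lintegral_mono fun x => ofReal_abs_pow_three_le hS x).trans_lt ?_
  rw [lintegral_add_left measurable_const, lintegral_const, measure_univ, mul_one,
    lintegral_const_mul' _ _ ENNReal.ofReal_ne_top, lintegral_pow_four_div_swap ρ S]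
  exact ENNReal.add_lt_top.2 ⟨ENNReal.ofReal_lt_top, ENNReal.mul_lt_top ENNReal.ofReal_lt_top hρfin⟩

theorem norm_ofReal_mul_resolvent_le_one {s : ℝ} (hs : 0 < s) (t : ℝ) :
    ‖(t : ℂ) * (1 / (I * s - (t : ℂ)))‖ ≤ 1 := by
  have h1 : I * (s : ℂ) - (t : ℂ) ≠ 0 := sub_ofReal_ne_zero (by simpa using hs.ne') t
  rw [mul_one_div, norm_div, div_le_one (norm_pos_iff.2 h1), Complex.norm_real, Real.norm_eq_abs]
  simpa using Complex.abs_re_le_norm (I * (s : ℂ) - (t : ℂ))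

/-- Replaces the point `is` by a nearby `z` at which the Cauchy transform is known explicitly. The
difference is the integral of `t² · t/(is - t) · (is - z)/(z - t)`, and `|t| ≤ |is - t|`, so the
second moment suffices. -/
theorem norm_sq_mul_one_sub_sub_le (h2 : Integrable (fun x : ℝ => x ^ 2) (ρ : Measure ℝ))
    (h0 : ∫ x : ℝ, x ∂(ρ : Measure ℝ) = 0) {s : ℝ} (hs : 0 < s) {z : ℂ} (hz : z.im ≠ 0) :
    ‖(I * s) ^ 2 * (1 - I * s * cauchyTransform ρ (I * s)) -
        z ^ 2 * (1 - z * cauchyTransform ρ z)‖ ≤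
      (∫ x : ℝ, x ^ 2 ∂(ρ : Measure ℝ)) * (‖I * s - z‖ / |z.im|) := by
  have hw : (I * (s : ℂ)).im ≠ 0 := by simpa using hs.ne'
  have hi : ∀ {w : ℂ}, w.im ≠ 0 →
      Integrable (fun t : ℝ => (t : ℂ) ^ 2 * (w * (1 / (w - (t : ℂ))))) (ρ : Measure ℝ) := by
    intro w hw
    refine (h2.mul_const (‖w‖ * (1 / |w.im|))).mono' (Continuous.aestronglyMeasurable
      ((Complex.continuous_ofReal.pow 2).mul (continuous_const.mul (continuous_resolvent hw))))
      (Eventually.of_forall fun t => ?_)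
    rw [norm_mul, norm_pow, Complex.norm_real, Real.norm_eq_abs, sq_abs, norm_mul]
    gcongr
    exact norm_resolvent_le hw t
  have h3 := sq_mul_cauchyTransform_sub h2 h0 hw
  have h4 := sq_mul_cauchyTransform_sub h2 h0 hz
  have h5 : (I * s) ^ 2 * (1 - I * s * cauchyTransform ρ (I * s)) -
        z ^ 2 * (1 - z * cauchyTransform ρ z) =
      ∫ t : ℝ, (t : ℂ) ^ 2 * ((t : ℂ) * (1 / (I * s - (t : ℂ))) *
        ((I * s - z) * (1 / (z - (t : ℂ))))) ∂(ρ : Measure ℝ) := by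
    have h6 : (I * s) ^ 2 * (1 - I * s * cauchyTransform ρ (I * s)) -
        z ^ 2 * (1 - z * cauchyTransform ρ z) =
      z ^ 2 * (z * cauchyTransform ρ z - 1) -
        (I * s) ^ 2 * (I * s * cauchyTransform ρ (I * s) - 1) := by ring
    rw [h6, h3, h4, ← integral_sub (hi hz) (hi hw)]
    congr 1 with t
    have := sub_ofReal_ne_zero hz t
    have := sub_ofReal_ne_zero hw t
    field_simp
    ring
  rw [h5, ← integral_mul_const]
  refine norm_integral_le_of_norm_le (h2.mul_const _) (Eventually.of_forall fun t => ?_)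
  rw [norm_mul, norm_pow, Complex.norm_real, Real.norm_eq_abs, sq_abs, norm_mul]
  refine mul_le_mul_of_nonneg_left ?_ (sq_nonneg t)
  rw [div_eq_mul_one_div ‖I * (s : ℂ) - z‖, ← one_mul (‖I * (s : ℂ) - z‖ * _),
    norm_mul (I * (s : ℂ) - z)]
  exact mul_le_mul (norm_ofReal_mul_resolvent_le_one hs t)
    (mul_le_mul_of_nonneg_left (norm_resolvent_le hz t) (norm_nonneg _)) (by positivity)
    zero_le_one

end Moments

end FreeCLT

namespace FreeCLT

/-! ### The free convolution square of a measure in `Q3` -/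

section Renorm

variable {μ ν : ProbabilityMeasure ℝ}

theorem invRecipCauchy_conj (hμ : μ ∈ Q3) {w : ℂ} (hw : 2 < |w.im|) :
    invRecipCauchy μ (starRingEnd ℂ w) = starRingEnd ℂ (invRecipCauchy μ w) := by
  refine (eq_invRecipCauchy hμ ?_ ?_ ?_).symm
  · simpa using hw
  · simpa using one_lt_abs_im_invRecipCauchy hμ hw
  · rw [cauchyTransform_conj, cauchyTransform_invRecipCauchy hμ hw]
    simp

theorem abs_im_add_sub_pos (hμ : μ ∈ Q3) {w : ℂ} (hw : 2 < |w.im|) :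
    0 < |(invRecipCauchy μ w + invRecipCauchy μ w - w).im| := by
  have h1 := abs_im_sub_le_norm (invRecipCauchy μ w + invRecipCauchy μ w - w) w
  have h2 : invRecipCauchy μ w + invRecipCauchy μ w - w - w = 2 * (invRecipCauchy μ w - w) := by
    ring
  rw [h2, norm_mul, Complex.norm_ofNat] at h1
  linarith [norm_invRecipCauchy_sub_le_one hμ hw]

/-- High up in the cone both inverses coincide; analytic continuation carries the equation down to
`Im w > 2`, and conjugation to the lower half plane. -/
theorem cauchyTransform_freeConv (hμ : μ ∈ Q3) {w : ℂ} (hw : 2 < |w.im|) :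
    cauchyTransform (freeConv μ μ) (invRecipCauchy μ w + invRecipCauchy μ w - w) = 1 / w := by
  have hup : ∀ w : ℂ, 2 < w.im →
      cauchyTransform (freeConv μ μ) (invRecipCauchy μ w + invRecipCauchy μ w - w) = 1 / w := by
    obtain ⟨b, Z, hZ, hG⟩ := cauchyTransform_freeConv_of_cone (integrable_sq_of_mem_Q3 hμ)
    have ho : IsOpen {w : ℂ | 2 < w.im} := isOpen_lt continuous_const Complex.continuous_im
    have habs : ∀ {w : ℂ}, 2 < w.im → 2 < |w.im| := fun hw => hw.trans_le (le_abs_self _)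
    have hf : AnalyticOnNhd ℂ (fun w => cauchyTransform (freeConv μ μ)
        (invRecipCauchy μ w + invRecipCauchy μ w - w)) {w : ℂ | 2 < w.im} := by
      refine DifferentiableOn.analyticOnNhd (fun w hw => ?_) ho
      have hd := differentiableAt_invRecipCauchy hμ (habs hw)
      have hd' : DifferentiableAt ℂ (fun w => invRecipCauchy μ w + invRecipCauchy μ w - w) w :=
        (hd.add hd).sub differentiableAt_id
      exact ((differentiableAt_cauchyTransform (freeConv μ μ)
        (abs_pos.1 (abs_im_add_sub_pos hμ (habs hw)))).comp
          (f := fun w => invRecipCauchy μ w + invRecipCauchy μ w - w) w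
            hd').differentiableWithinAt
    have hg : AnalyticOnNhd ℂ (fun w : ℂ => 1 / w) {w : ℂ | 2 < w.im} := by
      refine DifferentiableOn.analyticOnNhd (fun w hw => ((differentiableAt_const _).div
        differentiableAt_id fun h0 => ?_).differentiableWithinAt) ho
      have : 2 < w.im := hw
      norm_num [h0] at this
    -- Above height `4` the unit ball about `w` lies in the ball of radius `Im w / 4`, in which the
    -- cone inverse is unique.
    obtain ⟨w₀, hw₀, hw₀4⟩ := exists_I_mul_mem_truncatedCone hZ.pos 4
    have hmem : w₀ ∈ {w : ℂ | 2 < w.im} := by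
      change 2 < w₀.im
      linarith
    refine hf.eqOn_of_preconnected_of_eventuallyEq hg (isPreconnected_im_gt 2) hmem ?_
    filter_upwards [(isOpen_truncatedCone b).mem_nhds hw₀,
      (isOpen_lt continuous_const Complex.continuous_im).mem_nhds hw₀4] with v hv hv4
    have hv4' : 4 < v.im := hv4
    have hv2 : 2 < |v.im| := habs (by linarith)
    have h1 : invRecipCauchy μ v = Z v := by
      refine hZ.eq_of_mem hv ?_ (invRecipCauchy_sub_selfEnergy hμ hv2)
      rw [mem_closedBall_iff_norm]
      linarith [norm_invRecipCauchy_sub_le_one hμ hv2]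
    rw [h1, hG v hv]
  rcases lt_abs.1 hw with h | h
  · exact hup w h
  · have h1 := hup (starRingEnd ℂ w) (by simpa using h)
    rw [invRecipCauchy_conj hμ hw, ← map_add, ← map_sub, cauchyTransform_conj] at h1
    have h2 := congrArg (starRingEnd ℂ) h1
    simpa using h2

/-- Estimates on the imaginary axis for the subordinate point `2 ζ - w`. -/
theorem norm_sub_add_sub_le (hμ : μ ∈ Q3) {s : ℝ} (hs : 4 ≤ s) :
    ‖I * (s : ℂ) - (invRecipCauchy μ (I * s) + invRecipCauchy μ (I * s) - I * s)‖ ≤ 4 / s ∧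
      s / 2 ≤ |(invRecipCauchy μ (I * s) + invRecipCauchy μ (I * s) - I * s).im| ∧
      2 < |(I * (s : ℂ)).im| := by
  have him : |(I * (s : ℂ)).im| = s := by simpa using by linarith
  have hw : 2 < |(I * (s : ℂ)).im| := by rw [him]; linarith
  have h1 := abs_im_sub_le_norm (invRecipCauchy μ (I * s) + invRecipCauchy μ (I * s) - I * s)
    (I * s)
  have h2 : invRecipCauchy μ (I * s) + invRecipCauchy μ (I * s) - I * s - I * s =
    2 * (invRecipCauchy μ (I * s) - I * s) := by ring
  have h3 := norm_invRecipCauchy_sub_le hμ hw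
  refine ⟨?_, ?_, hw⟩
  · rw [norm_sub_rev, h2, norm_mul, Complex.norm_ofNat]
    rw [him] at h3
    have h4 : 1 / (s - 1) ≤ 2 / s := by
      rw [div_le_div_iff₀ (by linarith) (by linarith)]
      linarith
    calc _ ≤ 2 * (2 / s) := by gcongr; exact h3.trans h4
      _ = 4 / s := by ring
  · rw [h2, norm_mul, Complex.norm_ofNat, him] at h1
    linarith [norm_invRecipCauchy_sub_le_one hμ hw]

theorem norm_cauchyTransform_freeConv_sub_le (hμ : μ ∈ Q3) {s : ℝ} (hs : 4 ≤ s) :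
    ‖cauchyTransform (freeConv μ μ) (I * s) - 1 / (I * s)‖ ≤ 8 / s ^ 3 := by
  obtain ⟨h1, h2, hw⟩ := norm_sub_add_sub_le hμ hs
  have hs0 : 0 < s := by linarith
  have him : |(I * (s : ℂ)).im| = s := by simpa using hs0.le
  rw [← cauchyTransform_freeConv hμ hw]
  refine (norm_cauchyTransform_sub_le _ (by simpa using hs0.ne')
    (abs_pos.1 (abs_im_add_sub_pos hμ hw))).trans ?_
  rw [him]
  calc _ ≤ 4 / s / (s * (s / 2)) := by gcongr
    _ = 8 / s ^ 3 := by field_simp; norm_num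

theorem norm_one_sub_mul_cauchyTransform_freeConv_le (hμ : μ ∈ Q3) {s : ℝ} (hs : 4 ≤ s) :
    ‖1 - I * s * cauchyTransform (freeConv μ μ) (I * s)‖ ≤ 8 / s ^ 2 := by
  have hs0 : 0 < s := by linarith
  have hsC : (I * (s : ℂ)) ≠ 0 := by simpa using hs0.ne'
  have h1 : 1 - I * s * cauchyTransform (freeConv μ μ) (I * s) =
      -(I * s) * (cauchyTransform (freeConv μ μ) (I * s) - 1 / (I * s)) := by
    field_simp
    ring
  rw [h1, norm_mul, norm_neg, norm_mul, norm_I, one_mul, Complex.norm_real,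
    Real.norm_of_nonneg hs0.le]
  calc _ ≤ s * (8 / s ^ 3) := by gcongr; exact norm_cauchyTransform_freeConv_sub_le hμ hs
    _ = 8 / s ^ 2 := by field_simp

theorem integrable_sq_freeConv (hμ : μ ∈ Q3) :
    Integrable (fun x : ℝ => x ^ 2) (freeConv μ μ : Measure ℝ) := by
  refine integrable_sq_of_regularized_le (S := 4) (C := 8) (by norm_num) fun s hs => ?_
  have h1 := (Complex.re_le_norm _).trans (norm_one_sub_mul_cauchyTransform_freeConv_le hμ hs)
  calc _ ≤ s ^ 2 * (8 / s ^ 2) := by gcongr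
    _ = 8 := by field_simp

theorem integral_id_freeConv (hμ : μ ∈ Q3) : ∫ x : ℝ, x ∂(freeConv μ μ : Measure ℝ) = 0 := by
  have h1 := tendsto_first_moment (integrable_id_of_sq (integrable_sq_freeConv hμ))
  have h2 : Tendsto (fun s : ℝ => I * s * (I * s * cauchyTransform (freeConv μ μ) (I * s) - 1))
      atTop (𝓝 0) := by
    refine squeeze_zero_norm' (a := fun s : ℝ => 8 / s) ?_
      (tendsto_const_nhds.div_atTop tendsto_id)
    filter_upwards [eventually_ge_atTop 4] with s hs
    have hs0 : 0 < s := by linarith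
    rw [norm_mul, norm_sub_rev, norm_mul, norm_I, one_mul, Complex.norm_real,
      Real.norm_of_nonneg hs0.le]
    calc _ ≤ s * (8 / s ^ 2) := by
          gcongr; exact norm_one_sub_mul_cauchyTransform_freeConv_le hμ hs
      _ = 8 / s := by field_simp
  exact_mod_cast tendsto_nhds_unique h1 h2

theorem integral_sq_freeConv (hμ : μ ∈ Q3) : ∫ x : ℝ, x ^ 2 ∂(freeConv μ μ : Measure ℝ) = 2 := by
  set v := ∫ x : ℝ, x ^ 2 ∂(freeConv μ μ : Measure ℝ) with hv
  have hv0 : 0 ≤ v := integral_nonneg fun x => sq_nonneg x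
  have h1 := tendsto_I_mul_selfEnergy (integrable_sq_freeConv hμ) (integral_id_freeConv hμ)
  obtain ⟨C, hC, hb⟩ := norm_invRecipCauchy_sub_sub_le hμ
  have h2 : Tendsto (fun s : ℝ => I * s * selfEnergy (freeConv μ μ) (I * s)) atTop (𝓝 2) := by
    rw [tendsto_iff_norm_sub_tendsto_zero]
    refine squeeze_zero' (Eventually.of_forall fun s => norm_nonneg _) (g := fun s : ℝ =>
      (8 * v + 2 * C) / s) ?_ (tendsto_const_nhds.div_atTop tendsto_id)
    filter_upwards [eventually_ge_atTop 4] with s hs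
    obtain ⟨h3, h4, hw⟩ := norm_sub_add_sub_le hμ hs
    have hs0 : 0 < s := by linarith
    have him : |(I * (s : ℂ)).im| = s := by simpa using hs0.le
    have hsC : (I * (s : ℂ)) ≠ 0 := by simpa using hs0.ne'
    set w := I * (s : ℂ) with hwdef
    set z := invRecipCauchy μ w + invRecipCauchy μ w - w with hz
    have h5 := norm_selfEnergy_sub_le (integrable_sq_freeConv hμ) (integral_id_freeConv hμ)
      (z := w) (w := z) (abs_pos.1 (by linarith)) (abs_pos.1 (abs_im_add_sub_pos hμ hw))
    rw [← hv, him] at h5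
    -- Additivity of `R` at the subordinate point; to leading order this is `2/w`, so the variance
    -- is `2`.
    have h6 : selfEnergy (freeConv μ μ) z = 2 * (invRecipCauchy μ w - w) := by
      have := sub_selfEnergy (freeConv μ μ) z
      rw [cauchyTransform_freeConv hμ hw, one_div_one_div] at this
      linear_combination -this + hz
    have h7 : w * selfEnergy (freeConv μ μ) w - 2 =
        w * (selfEnergy (freeConv μ μ) w - selfEnergy (freeConv μ μ) z) +
          2 * w * (invRecipCauchy μ w - w - 1 / w) := by
      rw [h6]
      field_simp
      ring
    have hwn : ‖w‖ = s := by
      rw [hwdef, norm_mul, norm_I, one_mul, Complex.norm_real, Real.norm_of_nonneg hs0.le]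
    rw [h7]
    refine (norm_add_le _ _).trans ?_
    rw [norm_mul w, norm_mul (2 * w), norm_mul 2 w, hwn, Complex.norm_ofNat, add_div]
    have h8 := hb s (by rwa [abs_of_pos hs0])
    refine add_le_add ?_ ?_
    · calc _ ≤ s * (v / (s * (s / 2)) * (4 / s)) := by
            gcongr
            exact h5.trans (by gcongr)
        _ = 8 * v / s / s := by field_simp; ring
        _ ≤ 8 * v / s := div_le_self (by positivity) (by linarith)
    · calc _ ≤ 2 * s * (C / s ^ 2) := by gcongr
        _ = 2 * C / s := by field_simp
  exact_mod_cast tendsto_nhds_unique h1 h2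

/-- A pointwise bound `O(1/s)` for `∫ t⁴/(t² + s²)` would not be integrable in `s`. Instead this
quantity is compared with twice its value for `μ`: both are evaluated at nearby points with known
Cauchy transforms, and the comparison costs only `O(s⁻²)`. -/
theorem integrable_abs_pow_three_freeConv (hμ : μ ∈ Q3) :
    Integrable (fun x : ℝ => |x| ^ 3) (freeConv μ μ : Measure ℝ) := by
  have hμ2 := integrable_sq_of_mem_Q3 hμ
  have hρ2 := integrable_sq_freeConv hμ
  refine integrable_abs_pow_three_of_regularized_le (S := 4) (C := 100) (by norm_num) hρ2 hμ.1
    fun s hs => ?_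
  obtain ⟨h3, h4, hw⟩ := norm_sub_add_sub_le hμ hs.le
  have hs0 : 0 < s := by linarith
  have him : |(I * (s : ℂ)).im| = s := by simpa using hs0.le
  have hsC : (I * (s : ℂ)) ≠ 0 := by simpa using hs0.ne'
  rw [integral_pow_four_div_eq hμ2 hs0, integral_pow_four_div_eq hρ2 hs0, integral_sq_freeConv hμ,
    hμ.2.2]
  have hz := abs_pos.1 (abs_im_add_sub_pos hμ hw)
  have hζ := im_invRecipCauchy_ne_zero hμ hw
  have e1 := norm_sq_mul_one_sub_sub_le hρ2 (integral_id_freeConv hμ) hs0 hz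
  have e2 := norm_sq_mul_one_sub_sub_le hμ2 hμ.2.1 hs0 hζ
  rw [cauchyTransform_freeConv hμ hw, integral_sq_freeConv hμ] at e1
  rw [cauchyTransform_invRecipCauchy hμ hw, hμ.2.2, one_mul] at e2
  have hR := norm_invRecipCauchy_sub_le hμ hw
  have hζim := abs_im_sub_one_le hμ hw
  rw [him] at hR hζim
  set w := I * (s : ℂ) with hwdef
  set ζ := invRecipCauchy μ w with hζdef
  set F := w ^ 2 * (1 - w * cauchyTransform (freeConv μ μ) w)
  set f := w ^ 2 * (1 - w * cauchyTransform μ w)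
  have hwn : ‖w‖ = s := by
    rw [hwdef, norm_mul, norm_I, one_mul, Complex.norm_real, Real.norm_of_nonneg hs0.le]
  have hR' : ‖ζ - w‖ ≤ 2 / s := by
    refine hR.trans ?_
    rw [div_le_div_iff₀ (by linarith) (by linarith)]
    linarith
  have e1' : ‖F - (ζ + ζ - w) ^ 2 * (1 - (ζ + ζ - w) * (1 / w))‖ ≤ 16 / s ^ 2 := by
    refine e1.trans ?_
    calc _ ≤ 2 * (4 / s / (s / 2)) := by gcongr
      _ = 16 / s ^ 2 := by field_simp; norm_num
  have e2' : ‖f - ζ ^ 2 * (1 - ζ * (1 / w))‖ ≤ 4 / s ^ 2 := by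
    refine e2.trans ?_
    rw [norm_sub_rev]
    calc _ ≤ 2 / s / (s / 2) := by gcongr; linarith
      _ = 4 / s ^ 2 := by field_simp; norm_num
  -- With `ζ = w + R` the two terms are `-(w + 2R)² · 2R/w` and `-2(w + R)² · R/w`; the parts linear
  -- in `R` cancel, and `R = O(1/s)`.
  have e3 : ‖(ζ + ζ - w) ^ 2 * (1 - (ζ + ζ - w) * (1 / w)) - 2 * (ζ ^ 2 * (1 - ζ * (1 / w)))‖ ≤
      32 / s ^ 2 := by
    have h5 : (ζ + ζ - w) ^ 2 * (1 - (ζ + ζ - w) * (1 / w)) - 2 * (ζ ^ 2 * (1 - ζ * (1 / w))) =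
        -(2 * (ζ - w) ^ 2 * (2 * w + 3 * (ζ - w))) / w := by
      field_simp
      ring
    rw [h5, norm_div, norm_neg, norm_mul, norm_mul, norm_pow, hwn, Complex.norm_ofNat]
    have h6 : ‖2 * w + 3 * (ζ - w)‖ ≤ 4 * s := by
      refine (norm_add_le _ _).trans ?_
      rw [norm_mul 2 w, norm_mul 3, hwn, Complex.norm_ofNat, Complex.norm_ofNat]
      linarith [norm_invRecipCauchy_sub_le_one hμ hw]
    calc _ ≤ 2 * (2 / s) ^ 2 * (4 * s) / s := by gcongr
      _ = 32 / s ^ 2 := by field_simp; norm_num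
  have h7 : ‖F - 2 * f‖ ≤ 56 / s ^ 2 := by
    have h8 : F - 2 * f = (F - (ζ + ζ - w) ^ 2 * (1 - (ζ + ζ - w) * (1 / w))) +
      ((ζ + ζ - w) ^ 2 * (1 - (ζ + ζ - w) * (1 / w)) - 2 * (ζ ^ 2 * (1 - ζ * (1 / w)))) -
      2 * (f - ζ ^ 2 * (1 - ζ * (1 / w))) := by ring
    rw [h8]
    refine (norm_sub_le _ _).trans ?_
    have h9 := norm_add_le (F - (ζ + ζ - w) ^ 2 * (1 - (ζ + ζ - w) * (1 / w)))
      ((ζ + ζ - w) ^ 2 * (1 - (ζ + ζ - w) * (1 / w)) - 2 * (ζ ^ 2 * (1 - ζ * (1 / w))))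
    rw [norm_mul, Complex.norm_ofNat]
    have : 16 / s ^ 2 + 32 / s ^ 2 + 2 * (4 / s ^ 2) = 56 / s ^ 2 := by ring
    linarith
  have h10 := (Complex.re_le_norm _).trans h7
  rw [Complex.sub_re, show (2 * f).re = 2 * f.re by simp] at h10
  have h11 : 56 / s ^ 2 ≤ 100 / s ^ 2 := by gcongr; norm_num
  linarith

/-! ### The renormalization map on `Q3` -/

theorem coe_renorm (μ : ProbabilityMeasure ℝ) :
    (renorm μ : Measure ℝ) = (freeConv μ μ : Measure ℝ).map fun x : ℝ => x / √2 := rfl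

theorem renorm_mem_Q3 (hμ : μ ∈ Q3) : renorm μ ∈ Q3 := by
  have hm : AEMeasurable (fun x : ℝ => x / √2) (freeConv μ μ : Measure ℝ) := by fun_prop
  refine ⟨?_, ?_, ?_⟩
  · rw [coe_renorm, integrable_map_measure (by fun_prop) hm]
    have h1 : ((fun x : ℝ => |x| ^ 3) ∘ fun x : ℝ => x / √2) = fun x => |x| ^ 3 / √2 ^ 3 := by
      ext x
      simp only [Function.comp_apply]
      rw [abs_div, abs_of_nonneg (Real.sqrt_nonneg 2), div_pow]
    rw [h1]
    exact (integrable_abs_pow_three_freeConv hμ).div_const _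
  · rw [coe_renorm, integral_map hm (by fun_prop), integral_div, integral_id_freeConv hμ, zero_div]
  · rw [coe_renorm, integral_map hm (by fun_prop)]
    simp_rw [div_pow]
    rw [integral_div, integral_sq_freeConv hμ, Real.sq_sqrt (by norm_num), div_self (by norm_num)]

theorem cauchyTransform_renorm (μ : ProbabilityMeasure ℝ) {z : ℂ} (hz : z.im ≠ 0) :
    cauchyTransform (renorm μ) z = (√2 : ℝ) * cauchyTransform (freeConv μ μ) ((√2 : ℝ) * z) := by
  unfold cauchyTransform
  rw [coe_renorm, integral_map (by fun_prop) (continuous_resolvent hz).aestronglyMeasurable,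
    ← integral_const_mul]
  congr 1 with t
  have h2 : ((√2 : ℝ) : ℂ) ≠ 0 := by
    exact_mod_cast (Real.sqrt_pos.2 (by norm_num : (0 : ℝ) < 2)).ne'
  have h3 : z - ((t / √2 : ℝ) : ℂ) ≠ 0 := sub_ofReal_ne_zero hz _
  have h4 : ((√2 : ℝ) : ℂ) * (z - ((t / √2 : ℝ) : ℂ)) = (√2 : ℝ) * z - t := by
    push_cast
    field_simp
  rw [← h4]
  field_simp

theorem invRecipCauchy_renorm (hμ : μ ∈ Q3) {w : ℂ} (hw : 2 < |w.im|) :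
    invRecipCauchy (renorm μ) w =
      w + (√2 : ℝ) * (invRecipCauchy μ ((√2 : ℝ) * w) - (√2 : ℝ) * w) := by
  have hsq : √2 * √2 = (2 : ℝ) := Real.mul_self_sqrt (by norm_num)
  have hsqC : ((√2 : ℝ) : ℂ) * ((√2 : ℝ) : ℂ) = 2 := by exact_mod_cast hsq
  -- These bounds give `|Im (√2 w)| > 2.8`, hence `|R| ≤ 1/1.8` and `√2 |R| ≤ 1.5/1.8 < 1`; the
  -- candidate therefore has height above `1`, as uniqueness of the branch requires.
  have h1 : (1.4 : ℝ) < √2 := Real.lt_sqrt_of_sq_lt (by norm_num)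
  have h1' : √2 < (1.5 : ℝ) := (Real.sqrt_lt' (by norm_num)).2 (by norm_num)
  have him : |(((√2 : ℝ) : ℂ) * w).im| = √2 * |w.im| := by
    rw [Complex.im_ofReal_mul, abs_mul, abs_of_pos (by linarith)]
  have hw' : 2.8 < |(((√2 : ℝ) : ℂ) * w).im| := by
    rw [him]
    nlinarith
  have hw2 : 2 < |(((√2 : ℝ) : ℂ) * w).im| := by linarith
  have hR := norm_invRecipCauchy_sub_le hμ hw2
  set R := invRecipCauchy μ ((√2 : ℝ) * w) - (√2 : ℝ) * w with hRdef
  have hR' : ‖R‖ ≤ 1 / 1.8 := hR.trans (one_div_le_one_div_of_le (by norm_num) (by linarith))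
  have him2 : 1 < |(w + (√2 : ℝ) * R).im| := by
    have h2 := abs_im_sub_le_norm (w + (√2 : ℝ) * R) w
    rw [add_sub_cancel_left, norm_mul, Complex.norm_real, Real.norm_of_nonneg (by linarith)] at h2
    have h3 : √2 * ‖R‖ ≤ 1.5 * (1 / 1.8) := by gcongr
    linarith
  refine (eq_invRecipCauchy (renorm_mem_Q3 hμ) hw him2 ?_).symm
  rw [cauchyTransform_renorm μ (abs_pos.1 (by linarith))]
  have h4 : ((√2 : ℝ) : ℂ) * (w + (√2 : ℝ) * R) = invRecipCauchy μ ((√2 : ℝ) * w) +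
      invRecipCauchy μ ((√2 : ℝ) * w) - (√2 : ℝ) * w := by
    rw [mul_add, ← mul_assoc, hsqC, hRdef]
    ring
  rw [h4, cauchyTransform_freeConv hμ hw2]
  have h5 : ((√2 : ℝ) : ℂ) ≠ 0 := by
    intro h
    rw [h] at hsqC
    norm_num at hsqC
  have h6 : w ≠ 0 := by
    rintro rfl
    norm_num at hw
  field_simp

/-- Doubling of `R` under free convolution, followed by dilation by `1/√2`. The argument only
shrinks, so it stays in the interval over which the metric takes its supremum. -/
theorem rTransform_renorm (hμ : μ ∈ Q3) {y : ℝ} (hy : y ∈ Ioc (0 : ℝ) (1 / 4)) :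
    y / √2 ∈ Ioc (0 : ℝ) (1 / 4) ∧
      rTransform (renorm μ) (I * y) = (√2 : ℝ) * rTransform μ (I * ((y / √2 : ℝ) : ℂ)) := by
  have h1 : (1 : ℝ) ≤ √2 := Real.one_le_sqrt.2 (by norm_num)
  have hy' : y / √2 ∈ Ioc (0 : ℝ) (1 / 4) :=
    ⟨div_pos hy.1 (by linarith), (div_le_self hy.1.le h1).trans hy.2⟩
  refine ⟨hy', ?_⟩
  rw [rTransform_I_mul (renorm_mem_Q3 hμ) hy, rTransform_I_mul hμ hy',
    invRecipCauchy_renorm hμ (two_lt_abs_im_I_mul hy).2]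
  have h2 : ((√2 : ℝ) : ℂ) * (I * ((-(1 / y) : ℝ) : ℂ)) = I * ((-(1 / (y / √2)) : ℝ) : ℂ) := by
    push_cast
    rw [one_div_div]
    ring
  rw [h2]
  ring

/-- The prefactor `√2` and the ratio `(y/√2)²/y² = 1/2` of the weights multiply to `2^(-1/2)`. -/
theorem rDist_renorm_le (hμ : μ ∈ Q3) (hν : ν ∈ Q3) :
    rDist (renorm μ) (renorm ν) ≤ ENNReal.ofReal ((2 : ℝ) ^ (-(1 / 2) : ℝ)) * rDist μ ν := by
  refine iSup₂_le fun y hy => ?_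
  obtain ⟨hy', hRμ⟩ := rTransform_renorm hμ hy
  obtain ⟨-, hRν⟩ := rTransform_renorm hν hy
  have h1 : ‖rTransform (renorm ν) (I * y) - rTransform (renorm μ) (I * y)‖ / y ^ 2 =
      (2 : ℝ) ^ (-(1 / 2) : ℝ) * (‖rTransform ν (I * ((y / √2 : ℝ) : ℂ)) -
        rTransform μ (I * ((y / √2 : ℝ) : ℂ))‖ / (y / √2) ^ 2) := by
    rw [hRμ, hRν, ← mul_sub, norm_mul, Complex.norm_real, Real.norm_of_nonneg (Real.sqrt_nonneg 2),
      Real.rpow_neg (by norm_num), ← Real.sqrt_eq_rpow, div_pow, Real.sq_sqrt (by norm_num)]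
    have h2 : √2 * √2 = (2 : ℝ) := Real.mul_self_sqrt (by norm_num)
    have h3 : √2 ≠ (0 : ℝ) := (Real.sqrt_pos.2 (by norm_num)).ne'
    have hy0 := hy.1.ne'
    field_simp
    rw [sq, h2, mul_comm]
  rw [h1, ENNReal.ofReal_mul (by positivity)]
  gcongr
  exact le_iSup₂ (f := fun (y : ℝ) (_ : y ∈ Ioc (0 : ℝ) (1 / 4)) =>
    ENNReal.ofReal (‖rTransform ν (I * y) - rTransform μ (I * y)‖ / y ^ 2)) _ hy'

end Renorm

end FreeCLT

namespace FreeCLT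

/-! ### The semicircle law -/

section Semicircle

variable {E : Type*} [NormedAddCommGroup E] [NormedSpace ℝ E]

theorem continuous_semicircleDensity : Continuous semicircleDensity := by
  unfold semicircleDensity
  fun_prop

theorem semicircleDensity_nonneg (x : ℝ) : 0 ≤ semicircleDensity x := by
  unfold semicircleDensity
  positivity

theorem semicircleDensity_eq_zero {x : ℝ} (hx : x ∉ Ioc (-2 : ℝ) 2) : semicircleDensity x = 0 := by
  have h : 4 - x ^ 2 ≤ 0 := by
    by_contra! hc
    exact hx ⟨by nlinarith, by nlinarith⟩
  simp [semicircleDensity, max_eq_right h]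

theorem coe_semicircle : (semicircle : Measure ℝ) =
    (volume : Measure ℝ).withDensity fun x => ENNReal.ofReal (semicircleDensity x) := rfl

theorem semicircleDensity_two_mul_cos {θ : ℝ} (hθ : θ ∈ Icc 0 Real.pi) :
    semicircleDensity (2 * Real.cos θ) = 1 / (2 * Real.pi) * (2 * Real.sin θ) := by
  have h1 : 4 - (2 * Real.cos θ) ^ 2 = (2 * Real.sin θ) ^ 2 := by
    rw [mul_pow, mul_pow, Real.sin_sq]
    ring
  rw [semicircleDensity, h1, max_eq_left (sq_nonneg _),
    Real.sqrt_sq (mul_nonneg zero_le_two (Real.sin_nonneg_of_mem_Icc hθ))]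

theorem integrable_semicircle {f : ℝ → ℝ} (hf : Continuous f) :
    Integrable f (semicircle : Measure ℝ) := by
  rw [coe_semicircle, integrable_withDensity_iff_integrable_smul'
    continuous_semicircleDensity.measurable.ennreal_ofReal (by simp)]
  simp_rw [ENNReal.toReal_ofReal (semicircleDensity_nonneg _)]
  refine (integrableOn_iff_integrable_of_support_subset (s := Ioc (-2) 2) fun x hx => ?_).1
    (((continuous_semicircleDensity.smul hf).integrableOn_Icc (a := -2) (b := 2)).mono_set
      Ioc_subset_Icc_self)
  by_contra hc
  exact hx (by simp [semicircleDensity_eq_zero hc])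

/-- The parametrization `x = 2 cos θ` of the semicircle law. -/
theorem integral_semicircle_eq {f : ℝ → E} (hf : Continuous f) :
    ∫ x, f x ∂(semicircle : Measure ℝ) =
      (1 / (2 * Real.pi)) • ∫ θ in 0..Real.pi, (4 * Real.sin θ ^ 2) • f (2 * Real.cos θ) := by
  have h1 : ∫ x, f x ∂(semicircle : Measure ℝ) = ∫ x in (-2 : ℝ)..2, semicircleDensity x • f x := by
    rw [coe_semicircle, integral_withDensity_eq_integral_toReal_smul
      continuous_semicircleDensity.measurable.ennreal_ofReal (by simp)]
    simp_rw [ENNReal.toReal_ofReal (semicircleDensity_nonneg _)]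
    rw [intervalIntegral.integral_of_le (by norm_num), setIntegral_eq_integral_of_forall_compl_eq_zero]
    intro x hx
    rw [semicircleDensity_eq_zero hx, zero_smul]
  have h2 := intervalIntegral.integral_deriv_smul_comp (a := 0) (b := Real.pi)
    (f := fun θ => 2 * Real.cos θ) (f' := fun θ => 2 * -Real.sin θ)
    (g := fun x => semicircleDensity x • f x)
    (fun θ _ => (Real.hasDerivAt_cos θ).const_mul 2) (by fun_prop)
    (continuous_semicircleDensity.smul hf)
  rw [Real.cos_zero, Real.cos_pi, mul_one, mul_neg_one,
    intervalIntegral.integral_symm (-2 : ℝ) 2, ← h1] at h2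
  rw [← neg_neg (∫ x, f x ∂(semicircle : Measure ℝ)), ← h2, ← intervalIntegral.integral_neg,
    ← intervalIntegral.integral_smul]
  refine intervalIntegral.integral_congr fun θ hθ => ?_
  rw [uIcc_of_le Real.pi_pos.le] at hθ
  simp only [Function.comp_apply]
  rw [semicircleDensity_two_mul_cos hθ, smul_smul, smul_smul, ← neg_smul]
  congr 1
  ring

theorem semicircle_mem_Q3 : semicircle ∈ Q3 := by
  refine ⟨integrable_semicircle (by fun_prop), ?_, ?_⟩
  · rw [integral_semicircle_eq continuous_id']
    have h : ∀ θ : ℝ, (4 * Real.sin θ ^ 2) • (2 * Real.cos θ) =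
        8 * (Real.sin θ ^ 2 * Real.cos θ) := fun θ => by
      rw [smul_eq_mul]
      ring
    simp_rw [h]
    rw [intervalIntegral.integral_const_mul, integral_sin_sq_mul_cos]
    simp
  · rw [integral_semicircle_eq (continuous_pow 2)]
    have h : ∀ θ : ℝ, (4 * Real.sin θ ^ 2) • (2 * Real.cos θ) ^ 2 =
        16 * (Real.sin θ ^ 2 * Real.cos θ ^ 2) := fun θ => by
      rw [smul_eq_mul]
      ring
    simp_rw [h]
    rw [intervalIntegral.integral_const_mul, integral_sin_sq_mul_cos_sq]
    have h4 : Real.sin (4 * Real.pi) = 0 := by exact_mod_cast Real.sin_nat_mul_pi 4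
    rw [h4, mul_zero, Real.sin_zero, smul_eq_mul]
    field_simp
    ring

/-- With `u = e^{iθ}` the denominator is `(1 - uv)(u - v)/(uv)`, so the integrand has a single pole
`u = v` in the disc and Cauchy's formula applies to `(1 - u²) v/(1 - uv)`. -/
theorem circle_integral_semicircle_kernel {v : ℂ} (hv : ‖v‖ < 1) (hv0 : v ≠ 0) :
    ∫ θ in 0..2 * Real.pi, (1 - cexp (θ * I) ^ 2) / (v + 1 / v - 2 * Complex.cos θ) =
      2 * Real.pi * v := by
  have hne : ∀ u : ℂ, ‖u‖ ≤ 1 → 1 - u * v ≠ 0 := fun u hu h => by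
    have h1 : ‖u * v‖ = 1 := by rw [← sub_eq_zero.1 h, norm_one]
    rw [norm_mul] at h1
    nlinarith [norm_nonneg u, norm_nonneg v]
  have hd : DifferentiableOn ℂ (fun u : ℂ => (1 - u ^ 2) * v / (1 - u * v))
      (Metric.closedBall 0 1) := fun u hu => by
    refine DifferentiableAt.differentiableWithinAt (DifferentiableAt.div (by fun_prop)
      (by fun_prop) (hne u (by simpa using hu)))
  have h1 := hd.circleIntegral_sub_inv_smul (w := v) (by simpa using hv)
  have h2 : (1 - v ^ 2) * v / (1 - v * v) = v := by
    have := hne v hv.le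
    rw [← sq] at this ⊢
    field_simp
  simp only [circleIntegral, deriv_circleMap] at h1
  rw [smul_eq_mul, h2] at h1
  have h3 : ∀ θ : ℝ, (circleMap 0 1 θ * I) • ((circleMap 0 1 θ - v)⁻¹ •
      ((1 - circleMap 0 1 θ ^ 2) * v / (1 - circleMap 0 1 θ * v))) =
      I * ((1 - cexp (θ * I) ^ 2) / (v + 1 / v - 2 * Complex.cos θ)) := by
    intro θ
    have hu : circleMap 0 1 θ = cexp (θ * I) := by simp [circleMap]
    have hun : ‖cexp (θ * I)‖ = 1 := Complex.norm_exp_ofReal_mul_I θ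
    have hcos : 2 * Complex.cos θ = cexp (θ * I) + (cexp (θ * I))⁻¹ := by
      rw [Complex.cos, ← Complex.exp_neg, neg_mul]
      ring
    rw [hu, hcos]
    set u := cexp (θ * I)
    have hu0 : u ≠ 0 := Complex.exp_ne_zero _
    have huv : u - v ≠ 0 := fun h => by
      rw [sub_eq_zero.1 h] at hun
      linarith
    have h4 : v + 1 / v - (u + u⁻¹) = (1 - u * v) * (u - v) / (u * v) := by
      field_simp
      ring
    have h5 := hne u hun.le
    rw [h4, smul_eq_mul, smul_eq_mul]
    field_simp
  simp_rw [h3] at h1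
  rw [intervalIntegral.integral_const_mul] at h1
  refine mul_left_cancel₀ Complex.I_ne_zero (h1.trans ?_)
  ring

theorem cauchyTransform_semicircle {v : ℂ} (hv : ‖v‖ < 1) (hv0 : v ≠ 0)
    (him : (v + 1 / v).im ≠ 0) : cauchyTransform semicircle (v + 1 / v) = v := by
  have hne : ∀ θ : ℝ, v + 1 / v - 2 * Complex.cos θ ≠ 0 := fun θ => by
    have := sub_ofReal_ne_zero him (2 * Real.cos θ)
    simpa using this
  have hcont : Continuous fun θ : ℝ =>
      (1 - cexp (θ * I) ^ 2) / (v + 1 / v - 2 * Complex.cos θ) :=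
    Continuous.div (by fun_prop) (by fun_prop) hne
  have h1 := circle_integral_semicircle_kernel hv hv0
  rw [← intervalIntegral.integral_add_adjacent_intervals (b := Real.pi)
    (hcont.intervalIntegrable _ _) (hcont.intervalIntegrable _ _)] at h1
  -- Folding the circle by `θ ↦ 2π - θ` keeps the denominator and adds the numerators to `2 - u² -
  -- u⁻² = 4 sin² θ`, the semicircle weight.
  have h2 := intervalIntegral.integral_comp_sub_left (a := 0) (b := Real.pi) (fun θ : ℝ =>
      (1 - cexp (θ * I) ^ 2) / (v + 1 / v - 2 * Complex.cos θ)) (2 * Real.pi)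
  rw [sub_zero, show 2 * Real.pi - Real.pi = Real.pi by ring] at h2
  have hcont' := hcont.comp (continuous_const.sub continuous_id : Continuous (2 * Real.pi - ·))
  rw [← h2, ← intervalIntegral.integral_add (hcont.intervalIntegrable _ _)
    (by exact hcont'.intervalIntegrable _ _)] at h1
  unfold cauchyTransform
  rw [integral_semicircle_eq (continuous_resolvent him)]
  have h3 : ∀ θ : ℝ, (4 * Real.sin θ ^ 2) • (1 / (v + 1 / v - ((2 * Real.cos θ : ℝ) : ℂ))) =
      (1 - cexp (θ * I) ^ 2) / (v + 1 / v - 2 * Complex.cos θ) +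
      (1 - cexp (((2 * Real.pi - θ : ℝ) : ℂ) * I) ^ 2) /
        (v + 1 / v - 2 * Complex.cos ((2 * Real.pi - θ : ℝ) : ℂ)) := by
    intro θ
    have hexp : cexp (((2 * Real.pi - θ : ℝ) : ℂ) * I) = (cexp (θ * I))⁻¹ := by
      rw [← Complex.exp_neg, Complex.ofReal_sub, sub_mul, sub_eq_add_neg, Complex.exp_add]
      push_cast
      rw [Complex.exp_two_pi_mul_I, one_mul]
    have hcos : Complex.cos ((2 * Real.pi - θ : ℝ) : ℂ) = Complex.cos θ := by
      rw [← Complex.ofReal_cos, Real.cos_two_pi_sub, Complex.ofReal_cos]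
    have hu0 : cexp (θ * I) ≠ 0 := Complex.exp_ne_zero _
    have hsin : (4 : ℂ) * Complex.sin θ ^ 2 =
        1 - cexp (θ * I) ^ 2 + (1 - (cexp (θ * I))⁻¹ ^ 2) := by
      rw [Complex.sin, neg_mul, Complex.exp_neg, div_pow, mul_pow, Complex.I_sq]
      field_simp
      ring
    rw [hexp, hcos, ← add_div, ← hsin, Complex.real_smul]
    push_cast
    rw [mul_one_div]
  simp_rw [h3]
  rw [h1, Complex.real_smul]
  push_cast
  have : (Real.pi : ℂ) ≠ 0 := by exact_mod_cast Real.pi_ne_zero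
  field_simp

theorem invRecipCauchy_semicircle {w : ℂ} (hw : 2 < |w.im|) :
    invRecipCauchy semicircle w = w + 1 / w := by
  have h1 : 2 < ‖w‖ := hw.trans_le (Complex.abs_im_le_norm w)
  have hw0 : w ≠ 0 := norm_pos_iff.1 (by linarith)
  have h2 : ‖1 / w‖ < 1 := by
    rw [norm_div, norm_one, div_lt_one (by linarith)]
    linarith
  have him : 1 < |(w + 1 / w).im| := by
    have := abs_im_sub_le_norm (w + 1 / w) w
    rw [add_sub_cancel_left] at this
    linarith
  refine (eq_invRecipCauchy semicircle_mem_Q3 hw him ?_).symm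
  have h3 : w + 1 / w = 1 / w + 1 / (1 / w) := by rw [one_div_one_div, add_comm]
  rw [h3] at him ⊢
  exact cauchyTransform_semicircle h2 (one_div_ne_zero hw0) (abs_pos.1 (by linarith))

theorem rTransform_semicircle {y : ℝ} (hy : y ∈ Ioc (0 : ℝ) (1 / 4)) :
    rTransform semicircle (I * y) = I * y := by
  rw [rTransform_I_mul semicircle_mem_Q3 hy,
    invRecipCauchy_semicircle (two_lt_abs_im_I_mul hy).2, add_sub_cancel_left, ← I_mul_eq_one_div]

/-- On the segment seen by the metric both `R`-transforms are `iy`, and the metric separates points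
of `Q3`. -/
theorem renorm_semicircle : renorm semicircle = semicircle := by
  refine eq_of_rDist_eq_zero (renorm_mem_Q3 semicircle_mem_Q3) semicircle_mem_Q3 ?_
  refine le_antisymm (iSup₂_le fun y hy => ?_) zero_le
  obtain ⟨hy', h⟩ := rTransform_renorm semicircle_mem_Q3 hy
  have h2 : ((√2 : ℝ) : ℂ) ≠ 0 := by
    exact_mod_cast (Real.sqrt_pos.2 (by norm_num : (0 : ℝ) < 2)).ne'
  rw [h, rTransform_semicircle hy, rTransform_semicircle hy']
  have h3 : ((√2 : ℝ) : ℂ) * (I * ((y / √2 : ℝ) : ℂ)) = I * y := by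
    push_cast
    field_simp
  rw [h3, sub_self]
  simp

theorem iterate_renorm_mem_Q3 {ν : ProbabilityMeasure ℝ} (hν : ν ∈ Q3) (n : ℕ) :
    renorm^[n] ν ∈ Q3 :=
  MapsTo.iterate (fun _ h => renorm_mem_Q3 h) n hν

theorem rDist_iterate_renorm_le {ν : ProbabilityMeasure ℝ} (hν : ν ∈ Q3) (n : ℕ) :
    rDist (renorm^[n] ν) semicircle ≤
      ENNReal.ofReal ((2 : ℝ) ^ (-(n : ℝ) / 2)) * rDist ν semicircle := by
  induction n with
  | zero => simp
  | succ n ih =>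
    have h1 := rDist_renorm_le (iterate_renorm_mem_Q3 hν n) semicircle_mem_Q3
    rw [renorm_semicircle] at h1
    rw [Function.iterate_succ_apply']
    refine h1.trans ((mul_le_mul_right ih _).trans_eq ?_)
    rw [← mul_assoc, ← ENNReal.ofReal_mul (by positivity), ← Real.rpow_add (by norm_num)]
    congr 3
    push_cast
    ring

end Semicircle

end FreeCLT

theorem mainTheorem2 :
    -- the `R`-transform of every measure in `Q3` exists and is unique on its domain
    (∀ μ ∈ Q3, IsRTransform μ (rTransform μ) ∧
      ∀ R : ℂ → ℂ, IsRTransform μ R → EqOn R (rTransform μ) (rDomain (stdDev μ))) ∧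
    -- `d` is a finite metric on `Q3`
    (∀ μ ∈ Q3, ∀ ν ∈ Q3, rDist μ ν ≠ ⊤ ∧ rDist μ ν = rDist ν μ ∧ (rDist μ ν = 0 ↔ μ = ν)) ∧
    (∀ μ ∈ Q3, ∀ ν ∈ Q3, ∀ κ ∈ Q3, rDist μ κ ≤ rDist μ ν + rDist ν κ) ∧
    -- `T = renorm` is well defined: `μ ⊞ μ` exists, and `T μ` is the law of `(a + a') / √2`
    (∀ μ ∈ Q3, IsFreeConv μ μ (freeConv μ μ)) ∧
    (∀ μ ∈ Q3, ∀ (A : Type) (_ : CStarAlgebra A) (φ : A →ₗ[ℂ] ℂ) (a a' : A),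
      IsState φ → IsSelfAdjoint a → IsSelfAdjoint a' → FreeElements φ a a' →
      IsLawOf φ a μ → IsLawOf φ a' μ →
      IsLawOf φ (((1 / √2 : ℝ) : ℂ) • (a + a')) (renorm μ)) ∧
    -- `T` is a contraction of `(Q3, d)` with constant `2 ^ (-1/2)`
    MapsTo renorm Q3 Q3 ∧
    (∀ μ ∈ Q3, ∀ ν ∈ Q3,
      rDist (renorm μ) (renorm ν) ≤ ENNReal.ofReal ((2 : ℝ) ^ (-(1 / 2) : ℝ)) * rDist μ ν) ∧
    -- `T` fixes the semicircle law, and its iterates converge to it geometrically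
    semicircle ∈ Q3 ∧ renorm semicircle = semicircle ∧
    (∀ ν ∈ Q3, ∀ n : ℕ,
      rDist (renorm^[n] ν) semicircle ≤
        ENNReal.ofReal ((2 : ℝ) ^ (-(n : ℝ) / 2)) * rDist ν semicircle) := by
  refine ⟨fun μ hμ => ⟨isRTransform_rTransform hμ, fun R hR => hR.eqOn_rTransform hμ⟩,
    fun μ hμ ν hν => ⟨rDist_ne_top hμ hν, rDist_comm μ ν, eq_of_rDist_eq_zero hμ hν, ?_⟩,
    fun μ _ ν _ κ _ => rDist_triangle μ ν κ,
    fun μ hμ => isFreeConv_freeConv (integrable_sq_of_mem_Q3 hμ),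
    fun μ hμ A _ φ a a' hφ ha ha' hfree hl hl' =>
      isLawOf_renorm (integrable_sq_of_mem_Q3 hμ) hφ ha ha' hfree hl hl',
    fun μ hμ => renorm_mem_Q3 hμ, fun μ hμ ν hν => rDist_renorm_le hμ hν,
    semicircle_mem_Q3, renorm_semicircle, fun ν hν n => rDist_iterate_renorm_le hν n⟩
  rintro rfl
  exact rDist_self μ
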